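/- **Setting.** Let $\Omega\subset\mathbb R^2$ be a bounded connected open polygonal domain with $\overline\Omega=\overline{\Omega_s}\cup\overline{\Omega_d}$, where $\Omega_s$ (free flow) and $\Omega_d$ (porous medium) are disjoint polygonal open sets, and let $\mathcal T_h=\mathcal T_{s,h}\cup\mathcal T_{d,h}$ be a conforming triangulation of $\overline\Omega$ into finitely many triangles, $\mathcal T_{s,h}$ triangulating $\overline{\Omega_s}$ and $\mathcal T_{d,h}$ triangulating $\overline{\Omega_d}$. Let $\mathcal E_{s,h}$, $\mathcal E_{d,h}$ be the sets of edges of the two triangulations, $\mathcal E_{sd,h}=\mathcal E_{s,h}\cap\mathcal E_{d,h}$ the interface edges, $h_T$ the diameter of $T$, $\mathbf n$ the unit outward normal on $\partial T$, and $\mathbf n_e$, $\mathbf t_e$ a unit normal and a unit tangent of the edge $e$. Let $\mu>0$ and $\alpha>0$ be constants, let $\kappa$ be a measurable field of symmetric $2\times2$ matrices on $\overline{\Omega_d}$ whose eigenvalues lie between two positive constants, let $\mathbf f_s\in[L^2(\Omega_s)]^2$, $\mathbf f_d\in[L^2(\Omega_d)]^2$, and let $g=(g_s,g_d)\in L^2(\Omega_s)\times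 L^2(\Omega_d)$ with $\int_{\Omega_s}g_s+\int_{\Omega_d}g_d=0$. Fix an integer $k\ge1$. **Spaces.** $V_h$ is the space of pairs $\mathbf v=(\mathbf v_{s,h},\mathbf v_{d,h})$ of weak functions $\mathbf v_{i,h}=\{\mathbf v_{i,0},\mathbf v_{i,b}\}$, $i=s,d$, with $\mathbf v_{i,0}|_T\in[P_k(T)]^2$ for $T\in\mathcal T_{i,h}$; $\mathbf v_{s,b}|_e\in[P_k(e)]^2$ for $e\in\mathcal E_{s,h}$; $\mathbf v_{d,b}|_e\in P_k(e)\,\mathbf n_e$ for $e\in\mathcal E_{d,h}\setminus\mathcal E_{sd,h}$ and $\mathbf v_{d,b}|_e\in[P_k(e)]^2$ for $e\in\mathcal E_{sd,h}$. $V_h^0$ is the subspace of all $\mathbf v$ with $\mathbf v_{s,b}=\mathbf 0$ on every $e\in\mathcal E_{s,h}$ in $\partial\Omega$, $\mathbf v_{d,b}\cdot\mathbf n_e=0$ on every $e\in\mathcal E_{d,h}$ in $\partial\Omega$, and $\mathbf v_{s,b}=\mathbf v_{d,b}$ on every $e\in\mathcal E_{sd,h}$. $W_h$ is the space of functions $q$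 on $\Omega$ with $q|_T\in P_k(T)$ for all $T\in\mathcal T_h$ and $\int_\Omega q=0$. **Local operators.** On each $T$ (with $(\cdot,\cdot)_T$ and $\langle\cdot,\cdot\rangle_{\partial T}$ the $L^2$ products on $T$ and $\partial T$), $\nabla_w\mathbf v\in[P_{k-1}(T)]^{2\times2}$, $\nabla_w\cdot\mathbf v\in P_k(T)$ and $R_T(\mathbf v)\in RT_k(T)=[P_k(T)]^2+\mathbf x P_k(T)$ are the linear operators given by $$(\nabla_w\mathbf v,\varphi)_T=-(\mathbf v_0,\nabla\cdot\varphi)_T+\langle\mathbf v_b,\varphi\mathbf n\rangle_{\partial T}\quad\forall\varphi\in[P_{k-1}(T)]^{2\times2},$$ $$(\nabla_w\cdot\mathbf v,\tau)_T=-(\mathbf v_0,\nabla\tau)_T+\langle\mathbf v_b\cdot\mathbf n,\tau\rangle_{\partial T}\quad\forall\tau\in P_k(T),$$ $$(R_T(\mathbf v),\mathbf w)_T=(\mathbf v_0,\mathbf w)_T\quad\forall\mathbf w\in[P_{k-1}(T)]^2,\qquad \int_e (R_T(\mathbf v)\cdot\mathbf n)\phi\,ds=\int_e(\mathbf v_b\cdot\mathbf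 n)\phi\,ds\quad\forall\phi\in P_k(e),\ e\subset\partial T,$$ and $D_w(\mathbf v)=\frac12(\nabla_w\mathbf v+(\nabla_w\mathbf v)^T)$. **Forms.** For $\mathbf v,\mathbf w\in V_h^0$ and $q\in W_h$ put $$s(\mathbf v,\mathbf w)=\sum_{T\in\mathcal T_{s,h}}h_T^{-1}\langle\mathbf v_{s,0}-\mathbf v_{s,b},\mathbf w_{s,0}-\mathbf w_{s,b}\rangle_{\partial T}+\sum_{T\in\mathcal T_{d,h}}h_T^{-1}\langle(\mathbf v_{d,0}-\mathbf v_{d,b})\cdot\mathbf n,(\mathbf w_{d,0}-\mathbf w_{d,b})\cdot\mathbf n\rangle_{\partial T},$$ $$a(\mathbf v,\mathbf w)=\sum_{T\in\mathcal T_{s,h}}(2\mu D_w(\mathbf v_{s,h}),D_w(\mathbf w_{s,h}))_T+\sum_{T\in\mathcal T_{d,h}}(\mu\kappa^{-1}\mathbf v_{d,0},\mathbf w_{d,0})_T,$$ $$a_s(\mathbf v,\mathbf w)=a(\mathbf v,\mathbf w)+\mu\,s(\mathbf v,\mathbf w)+\sum_{e\in\mathcal E_{sd,h}}\int_e\alpha\mu\,(\kappa^{-1/2}\mathbf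 t_e\cdot\mathbf t_e)(\mathbf v_{s,b}\cdot\mathbf t_e)(\mathbf w_{s,b}\cdot\mathbf t_e)\,ds,$$ $$b(\mathbf v,q)=-\sum_{T\in\mathcal T_h}(\nabla_w\cdot\mathbf v,q)_T.$$ **Theorem.** There is exactly one pair $(\mathbf u_h,p_h)\in V_h^0\times W_h$ such that, for all $\mathbf v_h\in V_h^0$ and $q_h\in W_h$, $$a_s(\mathbf u_h,\mathbf v_h)+b(\mathbf v_h,p_h)=\sum_{T\in\mathcal T_{s,h}}(\mathbf f_s,R_T(\mathbf v_{s,h}))_T+\sum_{T\in\mathcal T_{d,h}}(\mathbf f_d,R_T(\mathbf v_{d,h}))_T,$$ $$b(\mathbf u_h,q_h)=-(g,q_h).$$ -/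

import Mathlib

open MeasureTheory MeasureTheory.Measure

namespace StokesDarcyWG

/-! ### Polynomials on triangles and edges -/

/-- The Euclidean plane. -/
abbrev Pt : Type := EuclideanSpace ℝ (Fin 2)

/-- The closed triangle, or the closed edge, with the given vertices. -/
abbrev cell (s : Finset Pt) : Set Pt := convexHull ℝ (s : Set Pt)

/-- Real polynomials in two variables. -/
abbrev Poly : Type := MvPolynomial (Fin 2) ℝ

/-- Restriction of a polynomial to a set, as a function on this set. -/
noncomputable def evalOn (S : Set Pt) : Poly →ₗ[ℝ] (S → ℝ) where
  toFun p x := MvPolynomial.eval (fun i => (x : Pt) i) p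
  map_add' p q := by ext x; simp
  map_smul' c p := by ext x; simp

/-- `P_k(S)`: the restrictions to `S` of the polynomials of degree at most `k`. -/
noncomputable def polyOn (k : ℕ) (S : Set Pt) : Submodule ℝ (S → ℝ) :=
  (MvPolynomial.restrictTotalDegree (Fin 2) ℝ k).map (evalOn S)

/-- `[P_k(S)]²`. -/
def vecPolyOn (k : ℕ) (S : Set Pt) : Submodule ℝ (S → Pt) where
  carrier := {v | ∀ i, (fun x => v x i) ∈ polyOn k S}
  add_mem' hv hw i := (polyOn k S).add_mem (hv i) (hw i)
  zero_mem' _ := (polyOn k S).zero_mem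
  smul_mem' c _ hv i := (polyOn k S).smul_mem c (hv i)

/-- `[P_k(S)]^{2×2}`. -/
def matPolyOn (k : ℕ) (S : Set Pt) : Submodule ℝ (S → Matrix (Fin 2) (Fin 2) ℝ) where
  carrier := {G | ∀ i j, (fun x => G x i j) ∈ polyOn k S}
  add_mem' hv hw i j := (polyOn k S).add_mem (hv i j) (hw i j)
  zero_mem' _ _ := (polyOn k S).zero_mem
  smul_mem' c _ hv i j := (polyOn k S).smul_mem c (hv i j)

/-- The map `q ↦ x q`. -/
def mulPosition (S : Set Pt) : (S → ℝ) →ₗ[ℝ] (S → Pt) where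
  toFun q x := q x • (x : Pt)
  map_add' p q := by ext x; simp [add_mul]
  map_smul' c p := by ext x; simp [mul_assoc]

/-- The Raviart-Thomas space `RT_k(S) = [P_k(S)]² + x P_k(S)`. -/
noncomputable def rtOn (k : ℕ) (S : Set Pt) : Submodule ℝ (S → Pt) :=
  vecPolyOn k S ⊔ (polyOn k S).map (mulPosition S)

/-! ### Edges, normals and tangents -/

/-- The edges of a triangle. -/
def edges (T : Finset Pt) : Finset (Finset Pt) := T.powersetCard 2

theorem subset_of_mem_edges {T e : Finset Pt} (h : e ∈ edges T) : e ⊆ T :=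
  (Finset.mem_powersetCard.1 h).1

/-- The unit outward normal of the triangle `T` on its edge `e`: the unit vector `ν` such that `T`
lies in the half plane `⟪ν, x - a⟫ ≤ 0` for every end point `a` of `e`. -/
noncomputable def outwardNormal (T e : Finset Pt) : Pt :=
  Classical.epsilon fun ν : Pt => ‖ν‖ = 1 ∧ ∀ a ∈ e, ∀ c ∈ T, inner ℝ ν (c - a) ≤ 0

/-- A unit normal of an edge. Its sign plays no role where it is used. -/
noncomputable def edgeNormal (e : Finset Pt) : Pt :=
  Classical.epsilon fun ν : Pt => ‖ν‖ = 1 ∧ ∀ a ∈ e, ∀ b ∈ e, inner ℝ ν (b - a) = 0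

/-- A unit tangent of an edge. Its sign plays no role where it is used. -/
noncomputable def edgeTangent (e : Finset Pt) : Pt :=
  Classical.epsilon fun t : Pt => ‖t‖ = 1 ∧ ∀ a ∈ e, ∀ b ∈ e, ∃ r : ℝ, b - a = r • t

/-- Restriction to an edge of a function on a triangle. -/
def onEdge {β : Type*} {T e : Finset Pt} (h : e ∈ edges T) (f : cell T → β) : cell e → β :=
  fun x => f ⟨x, convexHull_mono (Finset.coe_subset.2 (subset_of_mem_edges h)) x.2⟩

/-- The Lebesgue measure on a triangle. -/
noncomputable def area (T : Finset Pt) : Measure (cell T) := Measure.comap Subtype.val volume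

/-- The arc length (one-dimensional Hausdorff measure) on an edge. -/
noncomputable def arcLength (e : Finset Pt) : Measure (cell e) := Measure.comap Subtype.val μH[1]

/-! ### Weak functions on one triangle and the local operators -/

/-- Weak functions `{v_0, v_b}` on a triangle: an interior function and one function per edge. -/
abbrev LocalWeak (T : Finset Pt) : Type :=
  (cell T → Pt) × (∀ e : edges T, cell (e : Finset Pt) → Pt)

/-- Weak functions on a triangle all of whose components are polynomials of degree at most `k`. -/
def localV (k : ℕ) (T : Finset Pt) : Submodule ℝ (LocalWeak T) where
  carrier := {v | v.1 ∈ vecPolyOn k (cell T) ∧ ∀ e, v.2 e ∈ vecPolyOn k (cell e.1)}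
  add_mem' hv hw := ⟨Submodule.add_mem _ hv.1 hw.1, fun e => Submodule.add_mem _ (hv.2 e) (hw.2 e)⟩
  zero_mem' := ⟨Submodule.zero_mem _, fun _ => Submodule.zero_mem _⟩
  smul_mem' c _ hv :=
    ⟨Submodule.smul_mem _ c hv.1, fun e => Submodule.smul_mem _ c (hv.2 e)⟩

/-- `(G, φ)_T = -(v_0, ∇·φ)_T + ⟨v_b, φ n⟩_{∂T}` for all `φ ∈ [P_{k-1}(T)]^{2×2}`, where
`(∇·φ)_i = ∑ j, ∂_j φ_{ij}`. -/
def IsWeakGradient (k : ℕ) (T : Finset Pt) (v : LocalWeak T)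
    (G : cell T → Matrix (Fin 2) (Fin 2) ℝ) : Prop :=
  ∀ φ : Fin 2 → Fin 2 → Poly, (∀ i j, (φ i j).totalDegree ≤ k - 1) →
    (∫ x, (∑ i, ∑ j, G x i j * evalOn (cell T) (φ i j) x) ∂area T) =
      -(∫ x, (∑ i, v.1 x i * ∑ j, evalOn (cell T) (MvPolynomial.pderiv j (φ i j)) x) ∂area T)
      + ∑ e : edges T, (∫ x, (∑ i, v.2 e x i *
          ∑ j, evalOn (cell (e : Finset Pt)) (φ i j) x * outwardNormal T e j) ∂arcLength e)

/-- `(D, τ)_T = -(v_0, ∇τ)_T + ⟨v_b · n, τ⟩_{∂T}` for all `τ ∈ P_k(T)`. -/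
def IsWeakDivergence (k : ℕ) (T : Finset Pt) (v : LocalWeak T) (D : cell T → ℝ) : Prop :=
  ∀ τ : Poly, τ.totalDegree ≤ k →
    (∫ x, D x * evalOn (cell T) τ x ∂area T) =
      -(∫ x, (∑ i, v.1 x i * evalOn (cell T) (MvPolynomial.pderiv i τ) x) ∂area T)
      + ∑ e : edges T, (∫ x, inner ℝ (v.2 e x) (outwardNormal T e) *
          evalOn (cell (e : Finset Pt)) τ x ∂arcLength e)

/-- `(r, w)_T = (v_0, w)_T` for all `w ∈ [P_{k-1}(T)]²`, and `⟨r · n, φ⟩_e = ⟨v_b · n, φ⟩_e` for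
all `φ ∈ P_k(e)` and all edges `e` of `T`. -/
def IsReconstruction (k : ℕ) (T : Finset Pt) (v : LocalWeak T) (r : cell T → Pt) : Prop :=
  (∀ w : Fin 2 → Poly, (∀ i, (w i).totalDegree ≤ k - 1) →
    (∫ x, (∑ i, r x i * evalOn (cell T) (w i) x) ∂area T) =
      (∫ x, (∑ i, v.1 x i * evalOn (cell T) (w i) x) ∂area T)) ∧
  ∀ (e : edges T) (φ : Poly), φ.totalDegree ≤ k →
    (∫ x, inner ℝ (onEdge e.2 r x) (outwardNormal T e) *
        evalOn (cell (e : Finset Pt)) φ x ∂arcLength e) =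
      (∫ x, inner ℝ (v.2 e x) (outwardNormal T e) *
        evalOn (cell (e : Finset Pt)) φ x ∂arcLength e)

open Classical in
/-- The discrete weak gradient `∇_w v ∈ [P_{k-1}(T)]^{2×2}`, `(∇_w v)_{ij}` standing for
`∂_j v_i`: the linear operator given by its defining equation. -/
noncomputable def weakGradient (k : ℕ) (T : Finset Pt) :
    localV k T →ₗ[ℝ] matPolyOn (k - 1) (cell T) :=
  if h : ∃ L : localV k T →ₗ[ℝ] matPolyOn (k - 1) (cell T),
    ∀ v : localV k T, IsWeakGradient k T v.1 (L v : cell T → Matrix (Fin 2) (Fin 2) ℝ)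
  then h.choose else 0

open Classical in
/-- The discrete weak divergence `∇_w · v ∈ P_k(T)`: the linear operator given by its defining
equation. -/
noncomputable def weakDivergence (k : ℕ) (T : Finset Pt) :
    localV k T →ₗ[ℝ] polyOn k (cell T) :=
  if h : ∃ L : localV k T →ₗ[ℝ] polyOn k (cell T),
    ∀ v : localV k T, IsWeakDivergence k T v.1 (L v : cell T → ℝ)
  then h.choose else 0

open Classical in
/-- The velocity reconstruction operator `R_T`, with values in `RT_k(T)`: the linear operator
given by its defining equations. -/
noncomputable def reconstruction (k : ℕ) (T : Finset Pt) :
    localV k T →ₗ[ℝ] rtOn k (cell T) :=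
  if h : ∃ L : localV k T →ₗ[ℝ] rtOn k (cell T),
    ∀ v : localV k T, IsReconstruction k T v.1 (L v : cell T → Pt)
  then h.choose else 0

/-- The discrete weak strain tensor `D_w(v) = (∇_w v + (∇_w v)ᵀ) / 2`. -/
noncomputable def weakStrain (k : ℕ) (T : Finset Pt) (v : localV k T) (x : cell T) :
    Matrix (Fin 2) (Fin 2) ℝ :=
  (1 / 2 : ℝ) • ((weakGradient k T v : cell T → Matrix (Fin 2) (Fin 2) ℝ) x
    + ((weakGradient k T v : cell T → Matrix (Fin 2) (Fin 2) ℝ) x).transpose)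

/-- The jump `v_0 - v_b` on an edge of a triangle. -/
def jump {T : Finset Pt} (v : LocalWeak T) (e : edges T) : cell (e : Finset Pt) → Pt :=
  fun x => onEdge e.2 v.1 x - v.2 e x

/-! ### Meshes of a Stokes region and a Darcy region -/

open Classical in
/-- The edges of a set of triangles. -/
noncomputable def edgesOf (𝒯 : Finset (Finset Pt)) : Finset (Finset Pt) := 𝒯.biUnion edges

theorem mem_edgesOf {𝒯 : Finset (Finset Pt)} (T : 𝒯) (e : edges (T : Finset Pt)) :
    (e : Finset Pt) ∈ edgesOf 𝒯 := by
  classical exact Finset.mem_biUnion.2 ⟨T, T.2, e.2⟩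

/-- A conforming simplicial partition of a polygonal domain, split into the triangles of the Stokes
region and those of the Darcy region. -/
structure Mesh where
  complex : Geometry.SimplicialComplex ℝ Pt
  stokes : Finset (Finset Pt)
  darcy : Finset (Finset Pt)
  disjoint : Disjoint stokes darcy
  triangle_iff : ∀ T, (T ∈ stokes ∨ T ∈ darcy) ↔ (T ∈ complex.faces ∧ T.card = 3)
  /-- The domain `Ω`, the interior of the union of the closures of the two regions, is connected. -/
  connected : IsConnected (interior ((⋃ T ∈ stokes, cell T) ∪ ⋃ T ∈ darcy, cell T))

namespace Mesh

/-- The free flow region `Ω_s`. -/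
def stokesDomain (M : Mesh) : Set Pt := interior (⋃ T ∈ M.stokes, cell T)

/-- The porous medium region `Ω_d`. -/
def darcyDomain (M : Mesh) : Set Pt := interior (⋃ T ∈ M.darcy, cell T)

/-- The whole domain `Ω`. -/
def domain (M : Mesh) : Set Pt :=
  interior ((⋃ T ∈ M.stokes, cell T) ∪ ⋃ T ∈ M.darcy, cell T)

open Classical in
/-- The edges on the interface of the two regions. -/
noncomputable def interfaceEdges (M : Mesh) : Finset (Finset Pt) :=
  edgesOf M.stokes ∩ edgesOf M.darcy

theorem stokes_of_interface (M : Mesh) (e : M.interfaceEdges) :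
    (e : Finset Pt) ∈ edgesOf M.stokes := by
  classical exact (Finset.mem_inter.1 e.2).1

theorem darcy_of_interface (M : Mesh) (e : M.interfaceEdges) :
    (e : Finset Pt) ∈ edgesOf M.darcy := by
  classical exact (Finset.mem_inter.1 e.2).2

end Mesh

/-! ### The weak Galerkin spaces -/

/-- Weak functions on a set of triangles: one function per triangle, one per edge. -/
abbrev WeakFn (𝒯 : Finset (Finset Pt)) : Type :=
  (∀ T : 𝒯, cell (T : Finset Pt) → Pt) × (∀ e : edgesOf 𝒯, cell (e : Finset Pt) → Pt)

/-- Weak functions all of whose components are polynomials of degree at most `k`. For the Stokes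
triangles this is the space `V_{s,h}`. -/
def polyWeak (k : ℕ) (𝒯 : Finset (Finset Pt)) : Submodule ℝ (WeakFn 𝒯) where
  carrier := {v | (∀ T, v.1 T ∈ vecPolyOn k (cell T.1)) ∧
    ∀ e, v.2 e ∈ vecPolyOn k (cell e.1)}
  add_mem' hv hw := ⟨fun T => Submodule.add_mem _ (hv.1 T) (hw.1 T),
    fun e => Submodule.add_mem _ (hv.2 e) (hw.2 e)⟩
  zero_mem' := ⟨fun _ => Submodule.zero_mem _, fun _ => Submodule.zero_mem _⟩
  smul_mem' c _ hv := ⟨fun T => Submodule.smul_mem _ c (hv.1 T),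
    fun e => Submodule.smul_mem _ c (hv.2 e)⟩

/-- Restriction of a weak function to one triangle. -/
def loc {k : ℕ} {𝒯 : Finset (Finset Pt)} (v : polyWeak k 𝒯) (T : 𝒯) : localV k T.1 :=
  ⟨(v.1.1 T, fun e => v.1.2 ⟨e.1, mem_edgesOf T e⟩), by
    have h := v.2
    exact ⟨h.1 T, fun e => h.2 ⟨e.1, mem_edgesOf T e⟩⟩⟩

/-- The space `V_{d,h}`: on an edge off the interface the boundary component is `w n_e` with
`w ∈ P_k(e)`. -/
noncomputable def darcyV (k : ℕ) (M : Mesh) : Submodule ℝ (WeakFn M.darcy) where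
  carrier := {v | v ∈ polyWeak k M.darcy ∧
    ∀ e : edgesOf M.darcy, (e : Finset Pt) ∉ M.interfaceEdges →
      ∃ w ∈ polyOn k (cell (e : Finset Pt)), v.2 e = fun x => w x • edgeNormal e}
  add_mem' := by
    rintro v v' ⟨hv, hv'⟩ ⟨hw, hw'⟩
    refine ⟨Submodule.add_mem _ hv hw, fun e he => ?_⟩
    obtain ⟨w, h1, h2⟩ := hv' e he
    obtain ⟨z, h3, h4⟩ := hw' e he
    refine ⟨w + z, Submodule.add_mem _ h1 h3, ?_⟩
    funext x
    simp [h2, h4, add_smul]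
  zero_mem' := ⟨Submodule.zero_mem _, fun e _ => ⟨0, Submodule.zero_mem _, by funext x; simp⟩⟩
  smul_mem' := by
    rintro c v ⟨hv, hv'⟩
    refine ⟨Submodule.smul_mem _ c hv, fun e he => ?_⟩
    obtain ⟨w, h1, h2⟩ := hv' e he
    refine ⟨c • w, Submodule.smul_mem _ c h1, ?_⟩
    funext x
    simp [h2, smul_smul]

/-- The space `V_h^0`: pairs of a Stokes and a Darcy weak function such that `v_{s,b} = 0` on
the Stokes edges in `∂Ω`, `v_{d,b} · n_e = 0` on the Darcy edges in `∂Ω`, and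
`v_{s,b} = v_{d,b}` on the interface edges. -/
noncomputable def Vh0 (k : ℕ) (M : Mesh) : Submodule ℝ (WeakFn M.stokes × WeakFn M.darcy) where
  carrier := {v | v.1 ∈ polyWeak k M.stokes ∧ v.2 ∈ darcyV k M ∧
    (∀ e : edgesOf M.stokes, cell (e : Finset Pt) ⊆ frontier M.domain → v.1.2 e = 0) ∧
    (∀ e : edgesOf M.darcy, cell (e : Finset Pt) ⊆ frontier M.domain →
      ∀ x, inner ℝ (v.2.2 e x) (edgeNormal e) = 0) ∧
    (∀ e : M.interfaceEdges,
      v.1.2 ⟨e, M.stokes_of_interface e⟩ = v.2.2 ⟨e, M.darcy_of_interface e⟩)}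
  add_mem' := by
    rintro v w ⟨h1, h2, h3, h4, h5⟩ ⟨g1, g2, g3, g4, g5⟩
    refine ⟨Submodule.add_mem _ h1 g1, Submodule.add_mem _ h2 g2, fun e he => ?_,
      fun e he x => ?_, fun e => ?_⟩
    · simp [h3 e he, g3 e he]
    · simp [inner_add_left, h4 e he x, g4 e he x]
    · simp [h5 e, g5 e]
  zero_mem' := ⟨Submodule.zero_mem _, Submodule.zero_mem _, fun _ _ => rfl,
    fun _ _ _ => by simp, fun _ => rfl⟩
  smul_mem' := by
    rintro c v ⟨h1, h2, h3, h4, h5⟩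
    refine ⟨Submodule.smul_mem _ c h1, Submodule.smul_mem _ c h2, fun e he => ?_,
      fun e he x => ?_, fun e => ?_⟩
    · simp [h3 e he]
    · simp [inner_smul_left, h4 e he x]
    · simp [h5 e]

/-- The Stokes component `v_{s,h}`. -/
def stokesPart {k : ℕ} {M : Mesh} (v : Vh0 k M) : polyWeak k M.stokes := ⟨v.1.1, v.2.1⟩

/-- The Darcy component `v_{d,h}`. -/
def darcyPart {k : ℕ} {M : Mesh} (v : Vh0 k M) : polyWeak k M.darcy := ⟨v.1.2, v.2.2.1.1⟩

/-- Functions on `Ω` given triangle by triangle. -/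
abbrev BrokenFn (M : Mesh) : Type :=
  (∀ T : M.stokes, cell (T : Finset Pt) → ℝ) × (∀ T : M.darcy, cell (T : Finset Pt) → ℝ)

theorem integrable_of_mem_polyOn {k : ℕ} {s : Finset Pt} {q : cell s → ℝ}
    (hq : q ∈ polyOn k (cell s)) : Integrable q (area s) := by
  obtain ⟨p, -, rfl⟩ := hq
  have hc : IsCompact (cell s) := s.finite_toSet.isCompact_convexHull (𝕜 := ℝ)
  have hm : MeasurableSet (cell s) := hc.isClosed.measurableSet
  have hcont : Continuous fun x : Pt => MvPolynomial.eval (fun i => x i) p := by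
    have h := MvPolynomial.continuous_eval p
    exact h.comp (continuous_pi fun i => by fun_prop)
  have h : IntegrableOn (fun x : Pt => MvPolynomial.eval (fun i => x i) p) (cell s) volume :=
    hcont.continuousOn.integrableOn_compact hc
  exact (MeasurableEmbedding.subtype_coe hm).integrableOn_range_iff_comap.1 (by simpa using h)

/-- The space `W_h`: piecewise polynomials of degree at most `k` with vanishing mean over `Ω`. -/
noncomputable def Wh (k : ℕ) (M : Mesh) : Submodule ℝ (BrokenFn M) where
  carrier := {q | (∀ T, q.1 T ∈ polyOn k (cell T.1)) ∧
    (∀ T, q.2 T ∈ polyOn k (cell T.1)) ∧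
    ∑ T : M.stokes, (∫ x, q.1 T x ∂area T) + ∑ T : M.darcy, (∫ x, q.2 T x ∂area T) = 0}
  add_mem' := by
    rintro p q ⟨h1, h2, h3⟩ ⟨g1, g2, g3⟩
    refine ⟨fun T => Submodule.add_mem _ (h1 T) (g1 T),
      fun T => Submodule.add_mem _ (h2 T) (g2 T), ?_⟩
    have e1 : ∀ T : M.stokes, (∫ x, (p + q).1 T x ∂area T) =
        (∫ x, p.1 T x ∂area T) + (∫ x, q.1 T x ∂area T) := fun T =>
      integral_add (integrable_of_mem_polyOn (h1 T)) (integrable_of_mem_polyOn (g1 T))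
    have e2 : ∀ T : M.darcy, (∫ x, (p + q).2 T x ∂area T) =
        (∫ x, p.2 T x ∂area T) + (∫ x, q.2 T x ∂area T) := fun T =>
      integral_add (integrable_of_mem_polyOn (h2 T)) (integrable_of_mem_polyOn (g2 T))
    simp only [e1, e2, Finset.sum_add_distrib]
    linarith
  zero_mem' := ⟨fun _ => Submodule.zero_mem _, fun _ => Submodule.zero_mem _, by simp⟩
  smul_mem' := by
    rintro c q ⟨h1, h2, h3⟩
    refine ⟨fun T => Submodule.smul_mem _ c (h1 T), fun T => Submodule.smul_mem _ c (h2 T), ?_⟩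
    simp only [Prod.smul_fst, Prod.smul_snd, Pi.smul_apply, smul_eq_mul, integral_const_mul,
      ← Finset.mul_sum, ← mul_add, h3, mul_zero]

/-! ### The permeability -/

/-- `A^{-1/2}` for a symmetric positive definite `2 × 2` matrix `A`, by the closed formula
`√B = (B + √(det B) I) / √(tr B + 2 √(det B))` with `B = A⁻¹`. -/
noncomputable def invSqrt (A : Matrix (Fin 2) (Fin 2) ℝ) : Matrix (Fin 2) (Fin 2) ℝ :=
  (Real.sqrt (A⁻¹.trace + 2 * Real.sqrt A⁻¹.det))⁻¹ • (A⁻¹ + Real.sqrt A⁻¹.det • 1)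

/-- `invSqrt A` is the positive definite square root of `A⁻¹`. -/
theorem invSqrt_spec {A : Matrix (Fin 2) (Fin 2) ℝ} (hA : A.PosDef) :
    (invSqrt A).PosDef ∧ invSqrt A * invSqrt A = A⁻¹ := by
  have hB : (A⁻¹).PosDef := hA.inv
  have hd : 0 < A⁻¹.det := hB.det_pos
  have ht : 0 < A⁻¹.trace := hB.trace_pos
  unfold invSqrt
  generalize A⁻¹ = B at *
  have hs : 0 < Real.sqrt B.det := Real.sqrt_pos.2 hd
  have hr : 0 < B.trace + 2 * Real.sqrt B.det := by positivity
  constructor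
  · exact (hB.add (Matrix.PosDef.one.smul hs)).smul (inv_pos.2 (Real.sqrt_pos.2 hr))
  · rw [smul_mul_smul_comm, ← mul_inv, Real.mul_self_sqrt hr.le, inv_smul_eq_iff₀ hr.ne']
    have hss : Real.sqrt B.det * Real.sqrt B.det = B 0 0 * B 1 1 - B 0 1 * B 1 0 := by
      rw [Real.mul_self_sqrt hd.le, Matrix.det_fin_two]
    generalize Real.sqrt B.det = s at *
    ext i j
    fin_cases i <;> fin_cases j <;>
      simp [Matrix.mul_apply, Fin.sum_univ_two, Matrix.trace_fin_two] <;>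
      first | linear_combination hss | ring

/-- A permeability tensor on the closed Darcy region: a measurable field of symmetric matrices,
uniformly bounded and uniformly positive definite. -/
structure IsPermeability (M : Mesh) (κ : Pt → Matrix (Fin 2) (Fin 2) ℝ) : Prop where
  measurable : ∀ i j, Measurable fun x => κ x i j
  symm : ∀ T ∈ M.darcy, ∀ x ∈ cell T, (κ x).IsSymm
  elliptic : ∃ c C : ℝ, 0 < c ∧ ∀ T ∈ M.darcy, ∀ x ∈ cell T, ∀ ξ : Fin 2 → ℝ,
    c * (ξ ⬝ᵥ ξ) ≤ ξ ⬝ᵥ (κ x).mulVec ξ ∧ ξ ⬝ᵥ (κ x).mulVec ξ ≤ C * (ξ ⬝ᵥ ξ)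

/-! ### The forms of the scheme -/

section Forms

variable {k : ℕ} {M : Mesh}

/-- The stabilizer `s(v, w)`. -/
noncomputable def formS (v w : Vh0 k M) : ℝ :=
  ∑ T : M.stokes, (Metric.diam (cell T.1))⁻¹ *
    ∑ e : edges T.1, (∫ x, inner ℝ (jump (loc (stokesPart v) T).1 e x)
      (jump (loc (stokesPart w) T).1 e x) ∂arcLength e)
  + ∑ T : M.darcy, (Metric.diam (cell T.1))⁻¹ *
    ∑ e : edges T.1, (∫ x, inner ℝ (jump (loc (darcyPart v) T).1 e x) (outwardNormal T e) *
      inner ℝ (jump (loc (darcyPart w) T).1 e x) (outwardNormal T e) ∂arcLength e)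

/-- `a(v, w) = ∑_{T ∈ T_s} (2 μ D_w(v_s), D_w(w_s))_T + ∑_{T ∈ T_d} (μ κ⁻¹ v_{d,0}, w_{d,0})_T`. -/
noncomputable def formA (μ : ℝ) (κ : Pt → Matrix (Fin 2) (Fin 2) ℝ) (v w : Vh0 k M) : ℝ :=
  ∑ T : M.stokes, (∫ x, (∑ i, ∑ j, 2 * μ * weakStrain k T (loc (stokesPart v) T) x i j *
    weakStrain k T (loc (stokesPart w) T) x i j) ∂area T)
  + ∑ T : M.darcy,
    (∫ x, μ * ((κ x)⁻¹.mulVec (v.1.2.1 T x).ofLp ⬝ᵥ (w.1.2.1 T x).ofLp) ∂area T)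

/-- The Beavers-Joseph-Saffman term
`∑_{e ∈ E_sd} ⟨α μ κ^{-1/2} (v_{s,b} · t) t, (w_{s,b} · t) t⟩_e`. -/
noncomputable def formBJS (μ α : ℝ) (κ : Pt → Matrix (Fin 2) (Fin 2) ℝ) (v w : Vh0 k M) : ℝ :=
  ∑ e : M.interfaceEdges,
    (∫ x, α * μ * ((invSqrt (κ x)).mulVec (edgeTangent e).ofLp ⬝ᵥ (edgeTangent e).ofLp) *
      inner ℝ (v.1.1.2 ⟨e, M.stokes_of_interface e⟩ x) (edgeTangent e) *
      inner ℝ (w.1.1.2 ⟨e, M.stokes_of_interface e⟩ x) (edgeTangent e) ∂arcLength e)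

/-- `a_s(v, w) = a(v, w) + μ s(v, w) +` the Beavers-Joseph-Saffman term. -/
noncomputable def formAs (μ α : ℝ) (κ : Pt → Matrix (Fin 2) (Fin 2) ℝ) (v w : Vh0 k M) : ℝ :=
  formA μ κ v w + μ * formS v w + formBJS μ α κ v w

/-- `b(v, q) = -∑_T (∇_w · v, q)_T`. -/
noncomputable def formB (v : Vh0 k M) (q : Wh k M) : ℝ :=
  -(∑ T : M.stokes,
      (∫ x, (weakDivergence k T (loc (stokesPart v) T)).1 x * q.1.1 T x ∂area T)
    + ∑ T : M.darcy,
      (∫ x, (weakDivergence k T (loc (darcyPart v) T)).1 x * q.1.2 T x ∂area T))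

/-- `(f_s, R_T(v_s)) + (f_d, R_T(v_d))`. -/
noncomputable def loadF (f_s f_d : Pt → Pt) (v : Vh0 k M) : ℝ :=
  ∑ T : M.stokes,
    (∫ x, inner ℝ (f_s x) ((reconstruction k T (loc (stokesPart v) T)).1 x) ∂area T)
  + ∑ T : M.darcy,
    (∫ x, inner ℝ (f_d x) ((reconstruction k T (loc (darcyPart v) T)).1 x) ∂area T)

/-- `(g, q)` for `g = (g_s, g_d)`. -/
noncomputable def loadG (g_s g_d : Pt → ℝ) (q : Wh k M) : ℝ :=
  ∑ T : M.stokes, (∫ x, g_s x * q.1.1 T x ∂area T)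
  + ∑ T : M.darcy, (∫ x, g_d x * q.1.2 T x ∂area T)

/-- `(u, p)` solves the pressure-robust weak Galerkin scheme. -/
def IsSolution (μ α : ℝ) (κ : Pt → Matrix (Fin 2) (Fin 2) ℝ) (f_s f_d : Pt → Pt)
    (g_s g_d : Pt → ℝ) (u : Vh0 k M) (p : Wh k M) : Prop :=
  (∀ v : Vh0 k M, formAs μ α κ u v + formB v p = loadF f_s f_d v) ∧
  ∀ q : Wh k M, formB u q = -loadG g_s g_d q

end Forms

end StokesDarcyWG

/-!
The scheme is a square linear system: trial and test functions range over the same finite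
dimensional spaces `Vh0 k M` and `Wh k M`. Existence and uniqueness therefore both follow once the
homogeneous system is known to have only the trivial solution (`existsUnique_saddle_point`). The
right-hand sides matter only through their linearity, which rests on the integrability of the data
on each triangle.

*Velocity* (`eq_zero_of_formAs_self_eq_zero`). Testing the homogeneous system with the solution
itself gives `a_s(u, u) = 0`, a sum of nonnegative terms: the weak strain and the jumps vanish on
the Stokes triangles, `u_{d,0}` and the normal jumps vanish on the Darcy triangles, and the
tangential velocity vanishes on the interface, so that `u_{d,b} = 0` on every Darcy edge. Without
jumps, the divergence theorem on a triangle (`integral_evalOn_pderiv`) identifies the weak gradient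
with the classical one (`weakGradient_eq_of_jump_eq_zero`), so `u_{s,0}` is a rigid motion on each
triangle, and a rigid motion vanishing on an edge vanishes (`eq_zero_of_strain_of_jump`). If `Z` is
the set of Stokes triangles on which `u_{s,0} ≠ 0`, then no edge of `Z` lies in the boundary of the
domain or on the interface, and each is shared by two triangles of `Z`. The divergence theorem for
the field `(x₀, 0)` then shows that the total area of `Z` is a sum of boundary terms cancelling in
pairs, so `Z` is empty (`Mesh.eq_empty_of_edges_shared`). This takes the place of a Korn inequality.

*Pressure* (`pressure_eq_zero`). If `b(v, p) = 0` for all `v`, the test function `v_0 = ∇p`,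
`v_b = 0` shows that `p` is constant on each triangle, and the unit normal on a single interior edge
shows that these constants agree across that edge. Since the domain is connected, and so are
punctured discs about the vertices, they are all equal (`Mesh.eq_of_eq_across_edges`), and the mean
value condition makes them zero. This is all that is needed of the inf-sup condition.

The geometric input on the mesh is that an edge of only one triangle lies in the boundary of the
domain (`Mesh.exists_ne_of_not_subset_frontier`) and that two triangles with a common edge have
opposite outward normals there (`Mesh.outwardNormal_add_eq_zero`).
-/

namespace StokesDarcyWG

/-! ### Triangles in the plane -/

theorem inner_eq (u v : Pt) : inner ℝ u v = u 0 * v 0 + u 1 * v 1 := by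
  simp [PiLp.inner_apply, Fin.sum_univ_two, mul_comm]

theorem norm_sq_eq (u : Pt) : ‖u‖ ^ 2 = u 0 ^ 2 + u 1 ^ 2 := by
  rw [← real_inner_self_eq_norm_sq, inner_eq]; ring

theorem sq_add_sq_of_norm_eq_one {u : Pt} (h : ‖u‖ = 1) : u 0 ^ 2 + u 1 ^ 2 = 1 := by
  rw [← norm_sq_eq, h, one_pow]

theorem sq_add_sq_pos {u : Pt} (h : u ≠ 0) : 0 < u 0 ^ 2 + u 1 ^ 2 := by
  rw [← norm_sq_eq]; have := norm_pos_iff.2 h; positivity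

theorem pt_ext {u v : Pt} (h0 : u 0 = v 0) (h1 : u 1 = v 1) : u = v := by
  ext i; fin_cases i <;> assumption

/-- The two-dimensional cross product. -/
def cross (u v : Pt) : ℝ := u 0 * v 1 - u 1 * v 0

/-- `T` is the nondegenerate triangle with vertices `a`, `b`, `c`. -/
def IsTriangle (T : Finset Pt) (a b c : Pt) : Prop :=
  (T : Set Pt) = {a, b, c} ∧ cross (b - a) (c - a) ≠ 0

namespace IsTriangle

variable {T : Finset Pt} {a b c : Pt}

theorem rotate (h : IsTriangle T a b c) : IsTriangle T b c a := by
  refine ⟨by rw [h.1]; ext; simp; tauto, ?_⟩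
  convert h.2 using 1
  simp [cross]; ring

theorem swap (h : IsTriangle T a b c) : IsTriangle T a c b := by
  refine ⟨by rw [h.1]; ext; simp; tauto, ?_⟩
  intro h0
  refine h.2 ?_
  have : cross (b - a) (c - a) = - cross (c - a) (b - a) := by simp [cross]; ring
  rw [this, h0, neg_zero]

theorem ne (h : IsTriangle T a b c) : a ≠ b := by
  rintro rfl; exact h.2 (by simp [cross])

theorem ne' (h : IsTriangle T a b c) : a ≠ c := h.swap.ne

theorem ne'' (h : IsTriangle T a b c) : b ≠ c := h.rotate.ne

theorem mem_iff (h : IsTriangle T a b c) {x : Pt} : x ∈ T ↔ x = a ∨ x = b ∨ x = c := by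
  rw [← Finset.mem_coe, h.1]; simp

theorem mem_edges [DecidableEq Pt] (h : IsTriangle T a b c) : ({a, b} : Finset Pt) ∈ edges T := by
  refine Finset.mem_powersetCard.2 ⟨?_, Finset.card_pair h.ne⟩
  intro x hx
  rw [h.mem_iff]
  simp at hx; tauto

theorem edges_eq [DecidableEq Pt] (h : IsTriangle T a b c) :
    edges T = {{a, b}, {b, c}, {c, a}} := by
  ext e
  simp only [Finset.mem_insert, Finset.mem_singleton]
  constructor
  · intro he
    obtain ⟨hs, hc⟩ := Finset.mem_powersetCard.1 he
    obtain ⟨x, y, hxy, rfl⟩ := Finset.card_eq_two.1 hc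
    have hx : x = a ∨ x = b ∨ x = c := h.mem_iff.1 (hs (by simp))
    have hy : y = a ∨ y = b ∨ y = c := h.mem_iff.1 (hs (by simp))
    rcases hx with rfl | rfl | rfl <;> rcases hy with rfl | rfl | rfl <;>
      simp_all [Finset.pair_comm]
  · rintro (rfl | rfl | rfl)
    · exact h.mem_edges
    · exact h.rotate.mem_edges
    · exact h.rotate.rotate.mem_edges

theorem sum_edges [DecidableEq Pt] (h : IsTriangle T a b c) (F : Finset Pt → ℝ) :
    ∑ e : edges T, F e = F {a, b} + F {b, c} + F {c, a} := by
  rw [Finset.sum_coe_sort (edges T) F, h.edges_eq]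
  have hab := h.ne
  have hac := h.ne'
  have hbc := h.ne''
  have key : ∀ {x y z : Pt}, x ≠ y → x ≠ z → ({x, y} : Finset Pt) ≠ {y, z} := by
    intro x y z h1 h2 h3
    have : x ∈ ({y, z} : Finset Pt) := h3 ▸ (by simp)
    simp at this; tauto
  rw [Finset.sum_insert, Finset.sum_insert, Finset.sum_singleton, add_assoc]
  · simpa using key hbc hab.symm
  · simp only [Finset.mem_insert, Finset.mem_singleton, not_or]
    exact ⟨key hab hac, fun h' => key hac.symm hbc.symm h'.symm⟩

end IsTriangle

theorem exists_isTriangle_of_mem_edges [DecidableEq Pt] {T e : Finset Pt} {a b c : Pt}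
    (h : IsTriangle T a b c) (he : e ∈ edges T) :
    ∃ a b c, IsTriangle T a b c ∧ e = {a, b} := by
  rw [h.edges_eq] at he
  simp only [Finset.mem_insert, Finset.mem_singleton] at he
  rcases he with rfl | rfl | rfl
  · exact ⟨_, _, _, h, rfl⟩
  · exact ⟨_, _, _, h.rotate, rfl⟩
  · exact ⟨_, _, _, h.rotate.rotate, rfl⟩

theorem exists_isTriangle {T : Finset Pt} (h3 : T.card = 3)
    (hi : AffineIndependent ℝ ((↑) : T → Pt)) : ∃ a b c, IsTriangle T a b c := by
  classical
  obtain ⟨a, b, c, hab, hac, hbc, rfl⟩ := Finset.card_eq_three.1 h3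
  refine ⟨a, b, c, by simp, fun h0 => ?_⟩
  let f : Fin 3 ↪ ({a, b, c} : Finset Pt) :=
    ⟨![⟨a, by simp⟩, ⟨b, by simp⟩, ⟨c, by simp⟩], by
      intro i j hij
      fin_cases i <;> fin_cases j <;> simp_all⟩
  have h1 := hi.comp_embedding f
  have h2 : (fun x : ({a, b, c} : Finset Pt) => (x : Pt)) ∘ f = ![a, b, c] := by
    funext i; fin_cases i <;> rfl
  rw [h2, affineIndependent_iff_not_collinear_set] at h1
  refine h1 ((collinear_iff_of_mem (p₀ := a) (by simp)).2 ⟨b - a, ?_⟩)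
  have hp : 0 < (b - a) 0 ^ 2 + (b - a) 1 ^ 2 := sq_add_sq_pos (sub_ne_zero.2 hab.symm)
  simp only [Set.mem_insert_iff, Set.mem_singleton_iff, vadd_eq_add, forall_eq_or_imp, forall_eq]
  refine ⟨⟨0, by simp⟩, ⟨1, by simp⟩,
    ⟨((c - a) 0 * (b - a) 0 + (c - a) 1 * (b - a) 1) / ((b - a) 0 ^ 2 + (b - a) 1 ^ 2), ?_⟩⟩
  simp only [cross] at h0
  apply pt_ext
  · simp only [PiLp.add_apply, PiLp.smul_apply, smul_eq_mul, PiLp.sub_apply] at *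
    field_simp
    linear_combination -(b.ofLp 1 - a.ofLp 1) * h0
  · simp only [PiLp.add_apply, PiLp.smul_apply, smul_eq_mul, PiLp.sub_apply] at *
    field_simp
    linear_combination (b.ofLp 0 - a.ofLp 0) * h0

theorem mem_cell_pair [DecidableEq Pt] {a b x : Pt} :
    x ∈ cell {a, b} ↔ ∃ t : ℝ, 0 ≤ t ∧ t ≤ 1 ∧ x = a + t • (b - a) := by
  rw [cell, Finset.coe_pair, convexHull_pair, segment_eq_image']
  simp only [Set.mem_image, Set.mem_Icc]
  constructor
  · rintro ⟨t, ⟨h0, h1⟩, rfl⟩; exact ⟨t, h0, h1, rfl⟩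
  · rintro ⟨t, h0, h1, rfl⟩; exact ⟨t, ⟨h0, h1⟩, rfl⟩

theorem IsTriangle.mem_cell {T : Finset Pt} {a b c x : Pt} (h : IsTriangle T a b c) :
    x ∈ cell T ↔ ∃ s t : ℝ, 0 ≤ s ∧ 0 ≤ t ∧ s + t ≤ 1 ∧ x = a + s • (b - a) + t • (c - a) := by
  rw [cell, h.1, convexHull_insert (by simp), convexHull_pair, segment_eq_image']
  simp only [convexJoin_singleton_left, Set.mem_image, Set.mem_Icc, Set.mem_iUnion, exists_prop]
  constructor
  · rintro ⟨y, ⟨r, ⟨h0, h1⟩, rfl⟩, hx⟩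
    rw [segment_eq_image'] at hx
    obtain ⟨t, ⟨g0, g1⟩, rfl⟩ := hx
    refine ⟨t * (1 - r), t * r, by nlinarith, by positivity, by nlinarith, ?_⟩
    module
  · rintro ⟨s, t, h0, h1, h2, rfl⟩
    rcases eq_or_lt_of_le (add_nonneg h0 h1) with h3 | h3
    · have hs : s = 0 := by linarith
      have ht : t = 0 := by linarith
      refine ⟨b, ⟨0, by simp, by simp⟩, ?_⟩
      simp [hs, ht, left_mem_segment]
    · refine ⟨b + (t / (s + t)) • (c - b), ⟨t / (s + t), ⟨by positivity, ?_⟩, rfl⟩, ?_⟩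
      · rw [div_le_one h3]; linarith
      · rw [segment_eq_image']
        refine ⟨s + t, ⟨h3.le, h2⟩, ?_⟩
        have : (s + t) • (b + (t / (s + t)) • (c - b) - a) =
            (s + t) • (b - a) + ((s + t) * (t / (s + t))) • (c - b) := by module
        simp only [this]
        rw [mul_div_cancel₀ _ h3.ne']
        module

/-! ### Normals and tangents -/

theorem exists_unit_normal (w : Pt) (hw : w ≠ 0) : ∃ ν : Pt, ‖ν‖ = 1 ∧ inner ℝ ν w = 0 := by
  let z : Pt := !₂[-w 1, w 0]
  have hz : z ≠ 0 := by
    intro h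
    have h0 : z 0 = 0 := by rw [h]; rfl
    have h1 : z 1 = 0 := by rw [h]; rfl
    simp [z] at h0 h1
    exact hw (pt_ext h1 h0)
  refine ⟨‖z‖⁻¹ • z, by simp [norm_smul, hz], ?_⟩
  rw [inner_smul_left, inner_eq]
  simp [z]; right; ring

/-- In the plane, two vectors orthogonal to the same nonzero vector are proportional. -/
theorem eq_inner_smul {w u v : Pt} (hw : w ≠ 0) (hu : inner ℝ u w = 0) (hv : inner ℝ v w = 0)
    (hv1 : ‖v‖ = 1) : u = (inner ℝ u v : ℝ) • v := by
  have hv2 := sq_add_sq_of_norm_eq_one hv1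
  have hp := sq_add_sq_pos hw
  rw [inner_eq] at hu hv
  have hc : u 0 * v 1 - u 1 * v 0 = 0 := by
    have h0 : (u 0 * v 1 - u 1 * v 0) * w 0 = 0 := by linear_combination v 1 * hu - u 1 * hv
    have h1 : (u 0 * v 1 - u 1 * v 0) * w 1 = 0 := by linear_combination -v 0 * hu + u 0 * hv
    have : (u 0 * v 1 - u 1 * v 0) * (w 0 ^ 2 + w 1 ^ 2) = 0 := by
      linear_combination w 0 * h0 + w 1 * h1
    exact (mul_eq_zero.1 this).resolve_right hp.ne'
  apply pt_ext <;> simp only [PiLp.smul_apply, smul_eq_mul, inner_eq]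
  · linear_combination -u 0 * hv2 + v 1 * hc
  · linear_combination -u 1 * hv2 - v 0 * hc

/-- A vector orthogonal to two vectors with nonzero cross product vanishes. -/
theorem eq_zero_of_inner_eq_zero {n u v : Pt} (h : cross u v ≠ 0) (hu : inner ℝ n u = 0)
    (hv : inner ℝ n v = 0) : n = 0 := by
  rw [inner_eq] at hu hv
  have h0 : n 0 * cross u v = 0 := by unfold cross; linear_combination v 1 * hu - u 1 * hv
  have h1 : n 1 * cross u v = 0 := by unfold cross; linear_combination -v 0 * hu + u 0 * hv
  exact pt_ext ((mul_eq_zero.1 h0).resolve_right h) ((mul_eq_zero.1 h1).resolve_right h)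

theorem outwardNormal_spec [DecidableEq Pt] {T : Finset Pt} {a b c : Pt} (h : IsTriangle T a b c) :
    ‖outwardNormal T {a, b}‖ = 1 ∧ inner ℝ (outwardNormal T {a, b}) (b - a) = 0 ∧
      inner ℝ (outwardNormal T {a, b}) (c - a) < 0 := by
  have hex : ∃ ν : Pt, ‖ν‖ = 1 ∧
      ∀ a' ∈ ({a, b} : Finset Pt), ∀ c' ∈ T, inner ℝ ν (c' - a') ≤ 0 := by
    obtain ⟨ν, h1, h2⟩ := exists_unit_normal (b - a) (sub_ne_zero.2 h.ne.symm)
    have key : ∀ ν : Pt, inner ℝ ν (b - a) = 0 → inner ℝ ν (c - a) ≤ 0 →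
        ∀ a' ∈ ({a, b} : Finset Pt), ∀ c' ∈ T, inner ℝ ν (c' - a') ≤ 0 := by
      intro ν h2 h3 a' ha' c' hc'
      rw [h.mem_iff] at hc'
      simp only [Finset.mem_insert, Finset.mem_singleton] at ha'
      rw [inner_sub_right] at *
      rcases ha' with rfl | rfl <;> rcases hc' with rfl | rfl | rfl <;> linarith
    rcases le_total (inner ℝ ν (c - a)) 0 with h3 | h3
    · exact ⟨ν, h1, key ν h2 h3⟩
    · exact ⟨-ν, by simpa, key (-ν) (by simpa using h2) (by simpa using h3)⟩
  have hs := Classical.epsilon_spec hex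
  change ‖outwardNormal T {a, b}‖ = 1 ∧ _ at hs
  obtain ⟨h1, h2⟩ := hs
  change ∀ a' ∈ ({a, b} : Finset Pt), ∀ c' ∈ T, inner ℝ (outwardNormal T {a, b}) (c' - a') ≤ 0 at h2
  have hb := h2 a (by simp) b (h.mem_iff.2 (by simp))
  have ha := h2 b (by simp) a (h.mem_iff.2 (by simp))
  have hc := h2 a (by simp) c (h.mem_iff.2 (by simp))
  have hab : inner ℝ (outwardNormal T {a, b}) (b - a) = 0 := by
    rw [inner_sub_right] at *; linarith
  refine ⟨h1, hab, lt_of_le_of_ne hc fun h0 => ?_⟩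
  have := eq_zero_of_inner_eq_zero h.2 hab h0
  rw [this, norm_zero] at h1
  exact zero_ne_one h1

theorem inner_outwardNormal_le [DecidableEq Pt] {T : Finset Pt} {a b c : Pt}
    (h : IsTriangle T a b c) {x : Pt} (hx : x ∈ cell T) :
    inner ℝ (outwardNormal T {a, b}) (x - a) ≤ 0 := by
  obtain ⟨-, h1, h2⟩ := outwardNormal_spec h
  obtain ⟨s, t, -, ht, -, rfl⟩ := h.mem_cell.1 hx
  rw [show a + s • (b - a) + t • (c - a) - a = s • (b - a) + t • (c - a) by abel,
    inner_add_right, inner_smul_right, inner_smul_right, h1]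
  nlinarith

theorem edgeNormal_spec [DecidableEq Pt] {a b : Pt} (h : a ≠ b) :
    ‖edgeNormal {a, b}‖ = 1 ∧ inner ℝ (edgeNormal {a, b}) (b - a) = 0 := by
  have hex : ∃ ν : Pt, ‖ν‖ = 1 ∧
      ∀ a' ∈ ({a, b} : Finset Pt), ∀ b' ∈ ({a, b} : Finset Pt), inner ℝ ν (b' - a') = 0 := by
    obtain ⟨ν, h1, h2⟩ := exists_unit_normal (b - a) (sub_ne_zero.2 h.symm)
    refine ⟨ν, h1, ?_⟩
    rw [inner_sub_right] at h2
    intro a' ha' b' hb'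
    simp only [Finset.mem_insert, Finset.mem_singleton] at ha' hb'
    rw [inner_sub_right]
    rcases ha' with rfl | rfl <;> rcases hb' with rfl | rfl <;> linarith
  have hs := Classical.epsilon_spec hex
  exact ⟨hs.1, hs.2 a (by simp) b (by simp)⟩

theorem edgeTangent_spec [DecidableEq Pt] {a b : Pt} (h : a ≠ b) :
    ‖edgeTangent {a, b}‖ = 1 ∧ ∃ r : ℝ, b - a = r • edgeTangent {a, b} := by
  have hex : ∃ t : Pt, ‖t‖ = 1 ∧
      ∀ a' ∈ ({a, b} : Finset Pt), ∀ b' ∈ ({a, b} : Finset Pt), ∃ r : ℝ, b' - a' = r • t := by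
    have hn : ‖b - a‖ ≠ 0 := norm_ne_zero_iff.2 (sub_ne_zero.2 h.symm)
    have h1 : b - a = ‖b - a‖ • (‖b - a‖⁻¹ • (b - a)) := by
      rw [smul_smul, mul_inv_cancel₀ hn, one_smul]
    refine ⟨‖b - a‖⁻¹ • (b - a), by rw [norm_smul, norm_inv, norm_norm, inv_mul_cancel₀ hn], ?_⟩
    intro a' ha' b' hb'
    simp only [Finset.mem_insert, Finset.mem_singleton] at ha' hb'
    rcases ha' with rfl | rfl <;> rcases hb' with rfl | rfl
    · exact ⟨0, by simp⟩
    · exact ⟨_, h1⟩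
    · exact ⟨-‖a' - b'‖, by rw [neg_smul, ← h1]; abel⟩
    · exact ⟨0, by simp⟩
  have hs := Classical.epsilon_spec hex
  exact ⟨hs.1, hs.2 a (by simp) b (by simp)⟩

/-! ### Polynomials as functions -/

/-- The value of a polynomial at a point of the plane. -/
noncomputable def ev (p : Poly) (x : Pt) : ℝ := MvPolynomial.eval (fun i => x i) p

theorem evalOn_apply (S : Set Pt) (p : Poly) (x : S) : evalOn S p x = ev p x := rfl

@[fun_prop]
theorem continuous_ev (p : Poly) : Continuous (ev p) :=
  (MvPolynomial.continuous_eval p).comp (continuous_pi fun i => by fun_prop)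

@[fun_prop]
theorem continuous_evalOn (S : Set Pt) (p : Poly) : Continuous (evalOn S p) :=
  (continuous_ev p).comp continuous_subtype_val

theorem ev_mul (p q : Poly) (x : Pt) : ev (p * q) x = ev p x * ev q x := by simp [ev]

theorem ev_add (p q : Poly) (x : Pt) : ev (p + q) x = ev p x + ev q x := by simp [ev]

theorem hasDerivAt_ev_line (p : Poly) (x v : Pt) (t : ℝ) :
    HasDerivAt (fun t : ℝ => ev p (x + t • v))
      (ev (MvPolynomial.pderiv 0 p) (x + t • v) * v 0 +
        ev (MvPolynomial.pderiv 1 p) (x + t • v) * v 1) t := by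
  induction p using MvPolynomial.induction_on with
  | C a => simpa [ev] using hasDerivAt_const t a
  | add p q hp hq =>
    simp only [map_add, ev_add]
    convert! hp.add hq using 1
    ring
  | mul_X p i hp =>
    have hX : HasDerivAt (fun t : ℝ => ev (MvPolynomial.X i) (x + t • v)) (v i) t := by
      have : (fun t : ℝ => ev (MvPolynomial.X i) (x + t • v)) = fun t => x i + t * v i := by
        funext t; simp [ev]
      rw [this]
      simpa using ((hasDerivAt_id t).mul_const (v i)).const_add (x i)
    simp only [ev_mul]
    convert! hp.mul hX using 1
    fin_cases i <;>
      simp [ev, MvPolynomial.pderiv_X] <;> ring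

/-! ### Lebesgue measure on triangles and arc length on edges -/

theorem isCompact_cell (s : Finset Pt) : IsCompact (cell s) :=
  s.finite_toSet.isCompact_convexHull (𝕜 := ℝ)

theorem measurableSet_cell (s : Finset Pt) : MeasurableSet (cell s) :=
  (isCompact_cell s).isClosed.measurableSet

instance (s : Finset Pt) : CompactSpace (cell s) := isCompact_iff_compactSpace.1 (isCompact_cell s)

theorem comap_val_univ {S : Set Pt} (hS : MeasurableSet S) (ν : Measure Pt) :
    Measure.comap (Subtype.val : S → Pt) ν Set.univ = ν S := by
  rw [(MeasurableEmbedding.subtype_coe hS).comap_apply]; simp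

instance (T : Finset Pt) : IsFiniteMeasure (area T) :=
  ⟨by rw [area, comap_val_univ (measurableSet_cell T)]; exact (isCompact_cell T).measure_lt_top⟩

theorem isFiniteMeasure_arcLength {e : Finset Pt} (he : e.card = 2) :
    IsFiniteMeasure (arcLength e) := by
  classical
  obtain ⟨a, b, -, rfl⟩ := Finset.card_eq_two.1 he
  refine ⟨?_⟩
  rw [arcLength, comap_val_univ (measurableSet_cell _), cell, Finset.coe_pair, convexHull_pair,
    hausdorffMeasure_segment]
  exact edist_lt_top a b

instance {T : Finset Pt} (e : edges T) : IsFiniteMeasure (arcLength e) :=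
  isFiniteMeasure_arcLength (Finset.mem_powersetCard.1 e.2).2

theorem card_of_mem_edgesOf {𝒯 : Finset (Finset Pt)} {e : Finset Pt} (he : e ∈ edgesOf 𝒯) :
    e.card = 2 := by
  classical
  obtain ⟨T, -, h⟩ := Finset.mem_biUnion.1 he
  exact (Finset.mem_powersetCard.1 h).2

instance {M : Mesh} (e : M.interfaceEdges) : IsFiniteMeasure (arcLength e) :=
  isFiniteMeasure_arcLength (card_of_mem_edgesOf (M.stokes_of_interface e))

theorem integrable_of_continuous {X : Type*} [TopologicalSpace X] [CompactSpace X]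
    [MeasurableSpace X] [OpensMeasurableSpace X] {ν : Measure X} [IsFiniteMeasure ν] {f : X → ℝ}
    (hf : Continuous f) : Integrable f ν :=
  hf.integrable_of_hasCompactSupport (HasCompactSupport.of_compactSpace f)

/-- Arc length integrals in the affine parametrization of an edge. -/
theorem integral_arcLength [DecidableEq Pt] {a b : Pt} (hab : a ≠ b) (g : Pt → ℝ) :
    ∫ x, g x ∂arcLength {a, b} = dist a b * ∫ t in (0 : ℝ)..1, g (a + t • (b - a)) := by
  rw [arcLength, integral_subtype_comap (measurableSet_cell _)]
  set l := dist a b with hl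
  have hl0 : 0 < l := dist_pos.2 hab
  set u : Pt := l⁻¹ • (b - a) with hu
  have hu1 : ‖u‖ = 1 := by
    rw [hu, norm_smul, norm_inv, Real.norm_of_nonneg hl0.le, hl, dist_comm, dist_eq_norm,
      inv_mul_cancel₀]
    rw [← dist_eq_norm, dist_comm]; exact hl0.ne'
  have hlu : b - a = l • u := by rw [hu, smul_smul, mul_inv_cancel₀ hl0.ne', one_smul]
  set γ : ℝ → Pt := fun t => a + t • u with hγ
  have hiso : Isometry γ := by
    refine Isometry.of_dist_eq fun s t => ?_
    rw [dist_eq_norm, Real.dist_eq]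
    simp only [hγ, add_sub_add_left_eq_sub, ← sub_smul, norm_smul, hu1, mul_one, Real.norm_eq_abs]
  have hemb : MeasurableEmbedding γ := hiso.isClosedEmbedding.measurableEmbedding
  have hpre : γ ⁻¹' (cell {a, b}) = Set.Icc 0 l := by
    ext t
    simp only [Set.mem_preimage, mem_cell_pair, Set.mem_Icc]
    constructor
    · rintro ⟨s, h0, h1, h2⟩
      have : t = s * l := by
        apply hiso.injective
        simp only [hγ]
        rw [mul_smul, ← hlu]; exact h2
      rw [this]; constructor <;> nlinarith
    · rintro ⟨h0, h1⟩
      refine ⟨t / l, by positivity, (div_le_one hl0).2 h1, ?_⟩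
      simp only [hγ]
      rw [hlu, smul_smul (t / l), div_mul_cancel₀ _ hl0.ne']
  have hsub : cell {a, b} ⊆ Set.range γ := by
    intro x hx
    obtain ⟨t, -, -, rfl⟩ := mem_cell_pair.1 hx
    exact ⟨t * l, by simp only [hγ]; rw [mul_smul, ← hlu]⟩
  have hmap := hiso.map_hausdorffMeasure (d := 1) (Or.inl zero_le_one)
  have h1 : (μH[1] : Measure Pt).restrict (cell {a, b}) =
      (Measure.map γ μH[1]).restrict (cell {a, b}) := by
    rw [hmap, Measure.restrict_restrict_of_subset hsub]
  rw [h1, hemb.setIntegral_map, hpre, hausdorffMeasure_real, integral_Icc_eq_integral_Ioc,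
    ← intervalIntegral.integral_of_le hl0.le]
  have := intervalIntegral.smul_integral_comp_mul_right (a := 0) (b := 1) (fun t => g (γ t)) l
  rw [zero_mul, one_mul] at this
  rw [← this, smul_eq_mul]
  simp only [hγ, mul_smul, ← hlu]

theorem isOpenPosMeasure_arcLength {e : Finset Pt} (he : e.card = 2) :
    (arcLength e).IsOpenPosMeasure := by
  classical
  obtain ⟨a, b, hab, rfl⟩ := Finset.card_eq_two.1 he
  refine ⟨fun U hU hne => ?_⟩
  obtain ⟨V, hV, rfl⟩ := isOpen_induced_iff.1 hU
  obtain ⟨⟨x, hx⟩, hxV⟩ := hne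
  change x ∈ V at hxV
  obtain ⟨t₀, h0, h1, rfl⟩ := mem_cell_pair.1 hx
  set γ : ℝ → Pt := fun t => a + t • (b - a) with hγ
  have hc : Continuous γ := by fun_prop
  have hW : IsOpen (γ ⁻¹' V) := hV.preimage hc
  have hcl : t₀ ∈ closure (Set.Ioo (0 : ℝ) 1) := by
    rw [closure_Ioo zero_ne_one]; exact ⟨h0, h1⟩
  obtain ⟨t₁, ht₁⟩ := mem_closure_iff.1 hcl _ hW hxV
  obtain ⟨ε, hε, hball⟩ := Metric.isOpen_iff.1 (hW.inter isOpen_Ioo) t₁ ht₁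
  -- a short subsegment of positive length lies in the open set
  have hsub : segment ℝ (γ t₁) (γ (t₁ + ε / 2)) ⊆ V ∩ cell {a, b} := by
    rw [segment_eq_image']
    rintro _ ⟨r, ⟨hr0, hr1⟩, rfl⟩
    have hx : γ t₁ + r • (γ (t₁ + ε / 2) - γ t₁) = γ (t₁ + r * (ε / 2)) := by
      simp only [hγ]; module
    have hm : t₁ + r * (ε / 2) ∈ Metric.ball t₁ ε := by
      rw [Metric.mem_ball, Real.dist_eq, add_sub_cancel_left, abs_of_nonneg (by positivity)]
      nlinarith
    obtain ⟨hm1, hm2⟩ := hball hm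
    simp only [hx]
    exact ⟨hm1, mem_cell_pair.2 ⟨_, hm2.1.le, hm2.2.le, rfl⟩⟩
  have himg : (Subtype.val : cell {a, b} → Pt) '' (Subtype.val ⁻¹' V) = V ∩ cell {a, b} := by
    rw [Set.image_preimage_eq_inter_range, Subtype.range_coe]
  rw [arcLength, (MeasurableEmbedding.subtype_coe (measurableSet_cell _)).comap_apply, himg]
  refine (lt_of_lt_of_le ?_ (measure_mono hsub)).ne'
  rw [hausdorffMeasure_segment, edist_pos]
  intro h
  have h2 : (ε / 2) • (b - a) = 0 := by
    have : γ (t₁ + ε / 2) - γ t₁ = (ε / 2) • (b - a) := by simp only [hγ]; module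
    rw [← this, h, sub_self]
  rcases smul_eq_zero.1 h2 with h3 | h3
  · linarith
  · exact hab (sub_eq_zero.1 h3).symm

/-- The affine map sending the reference triangle to the triangle with vertices `a`, `b`, `c`. -/
noncomputable def refMap (a b c : Pt) (z : ℝ × ℝ) : Pt := a + z.1 • (b - a) + z.2 • (c - a)

/-- The reference triangle. -/
def refTriangle : Set (ℝ × ℝ) := {z | 0 ≤ z.1 ∧ 0 ≤ z.2 ∧ z.1 + z.2 ≤ 1}

theorem measurableSet_refTriangle : MeasurableSet refTriangle :=
  ((isClosed_le continuous_const continuous_fst).inter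
    ((isClosed_le continuous_const continuous_snd).inter
      (isClosed_le (continuous_fst.add continuous_snd) continuous_const))).measurableSet

theorem setIntegral_refTriangle {g : ℝ × ℝ → ℝ} (hg : Continuous g) :
    ∫ z in refTriangle, g z = ∫ s in (0 : ℝ)..1, ∫ t in (0 : ℝ)..(1 - s), g (s, t) := by
  have hsub : refTriangle ⊆ Set.Icc (0 : ℝ) 1 ×ˢ Set.Icc (0 : ℝ) 1 := by
    rintro ⟨s, t⟩ ⟨h0, h1, h2⟩
    simp only [Set.mem_prod, Set.mem_Icc] at *
    refine ⟨⟨h0, by linarith⟩, h1, by linarith⟩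
  have hint : Integrable (refTriangle.indicator g) (volume.prod volume) := by
    rw [integrable_indicator_iff measurableSet_refTriangle]
    exact (hg.continuousOn.integrableOn_compact (isCompact_Icc.prod isCompact_Icc)).mono_set hsub
  rw [← integral_indicator measurableSet_refTriangle, volume_eq_prod, integral_prod _ hint,
    intervalIntegral.integral_of_le zero_le_one, ← integral_Icc_eq_integral_Ioc,
    ← integral_indicator measurableSet_Icc]
  congr 1
  funext s
  by_cases hs : s ∈ Set.Icc (0 : ℝ) 1
  · rw [Set.indicator_of_mem hs, intervalIntegral.integral_of_le (by linarith [hs.2]),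
      ← integral_Icc_eq_integral_Ioc, ← integral_indicator measurableSet_Icc]
    congr 1
    funext t
    have hiff : (s, t) ∈ refTriangle ↔ t ∈ Set.Icc 0 (1 - s) :=
      ⟨fun h => ⟨h.2.1, by linarith [show s + t ≤ 1 from h.2.2]⟩,
        fun h => ⟨hs.1, h.1, by change s + t ≤ 1; linarith [h.2]⟩⟩
    by_cases ht : t ∈ Set.Icc 0 (1 - s)
    · rw [Set.indicator_of_mem ht, Set.indicator_of_mem (hiff.2 ht)]
    · rw [Set.indicator_of_notMem ht, Set.indicator_of_notMem (mt hiff.1 ht)]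
  · rw [Set.indicator_of_notMem hs]
    rw [← integral_zero ℝ ℝ (μ := volume)]
    congr 1
    funext t
    refine Set.indicator_of_notMem (fun h => hs ?_) _
    exact ⟨h.1, by linarith [h.2.1, h.2.2, show s + t ≤ 1 from h.2.2]⟩

/-- Change of variables to the reference triangle. -/
theorem integral_area {T : Finset Pt} {a b c : Pt} (h : IsTriangle T a b c) (g : Pt → ℝ) :
    ∫ x, g x ∂area T =
      |cross (b - a) (c - a)| * ∫ z in refTriangle, g (refMap a b c z) := by
  rw [area, integral_subtype_comap (measurableSet_cell _)]
  -- the coordinates `z ↦ (z 0, z 1)` preserve volume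
  let ψ : Pt ≃ᵐ ℝ × ℝ :=
    (MeasurableEquiv.toLp 2 (Fin 2 → ℝ)).symm.trans MeasurableEquiv.finTwoArrow
  have hψ : MeasurePreserving ψ volume volume :=
    (EuclideanSpace.volume_preserving_symm_measurableEquiv_toLp (Fin 2)).trans
      (volume_preserving_finTwoArrow ℝ)
  have hψ1 : ∀ z : Pt, ψ z = (z 0, z 1) := fun z => rfl
  let A : Pt →ₗ[ℝ] Pt :=
    { toFun := fun z => z 0 • (b - a) + z 1 • (c - a)
      map_add' := by intro x y; simp only [PiLp.add_apply]; module
      map_smul' := by intro r x; simp only [PiLp.smul_apply, smul_eq_mul, RingHom.id_apply]; module }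
  have hdet : LinearMap.det A = cross (b - a) (c - a) := by
    rw [← LinearMap.det_toMatrix (EuclideanSpace.basisFun (Fin 2) ℝ).toBasis, Matrix.det_fin_two]
    simp [LinearMap.toMatrix_apply, A, cross]
    ring
  let A' : Pt →L[ℝ] Pt := LinearMap.toContinuousLinearMap A
  have hdet' : A'.det = cross (b - a) (c - a) := hdet
  have himg : cell T = (fun z => a + A' z) '' (ψ ⁻¹' refTriangle) := by
    ext x
    rw [h.mem_cell]
    constructor
    · rintro ⟨s, t, h0, h1, h2, rfl⟩
      refine ⟨!₂[s, t], ⟨h0, h1, h2⟩, ?_⟩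
      change a + (s • (b - a) + t • (c - a)) = _
      abel
    · rintro ⟨z, ⟨h0, h1, h2⟩, rfl⟩
      refine ⟨z 0, z 1, h0, h1, h2, ?_⟩
      change a + (z 0 • (b - a) + z 1 • (c - a)) = _
      abel
  have hinj : Set.InjOn (fun z => a + A' z) (ψ ⁻¹' refTriangle) := by
    have hd : LinearMap.det A ≠ 0 := by rw [hdet]; exact h.2
    have := (LinearMap.equivOfDetNeZero A hd).injective
    intro z _ w _ hzw
    exact this (add_left_cancel hzw)
  rw [himg, integral_image_eq_integral_abs_det_fderiv_smul volume
    (ψ.measurable measurableSet_refTriangle)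
    (fun z _ => ((A'.hasFDerivAt).const_add a).hasFDerivWithinAt) hinj]
  simp only [smul_eq_mul, hdet']
  rw [integral_const_mul, ← hψ.setIntegral_preimage_emb ψ.measurableEmbedding]
  congr 2
  funext z
  rw [hψ1, refMap]
  change g (a + (z 0 • (b - a) + z 1 • (c - a))) = _
  rw [add_assoc]

theorem IsTriangle.area_pos {T : Finset Pt} {a b c : Pt} (h : IsTriangle T a b c) :
    0 < ∫ _ : cell T, (1 : ℝ) ∂area T := by
  rw [integral_area h (fun _ => 1), setIntegral_refTriangle (g := fun _ => 1) continuous_const]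
  have : ∫ s in (0 : ℝ)..1, ∫ _ in (0 : ℝ)..(1 - s), (1 : ℝ) = 1 / 2 := by
    simp only [intervalIntegral.integral_const, sub_zero, smul_eq_mul, mul_one]
    rw [intervalIntegral.integral_sub (by simp) (by simp)]
    simp; norm_num
  rw [this]
  have := abs_pos.2 h.2
  positivity

theorem IsTriangle.volume_cell_pos {T : Finset Pt} {a b c : Pt} (h : IsTriangle T a b c) :
    0 < volume (cell T) := by
  have h1 := h.area_pos
  rw [integral_const, smul_eq_mul, mul_one, Measure.real, area,
    comap_val_univ (measurableSet_cell T)] at h1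
  exact (ENNReal.toReal_pos_iff.1 h1).1

theorem IsTriangle.interior_nonempty {T : Finset Pt} {a b c : Pt} (h : IsTriangle T a b c) :
    (interior (cell T)).Nonempty := by
  by_contra hne
  rw [Set.not_nonempty_iff_eq_empty] at hne
  have h1 : frontier (cell T) = cell T := by
    rw [(isCompact_cell T).isClosed.frontier_eq, hne, Set.sdiff_empty]
  have h2 := Convex.addHaar_frontier volume (convex_convexHull ℝ (T : Set Pt))
  rw [h1] at h2
  exact h.volume_cell_pos.ne' h2

theorem IsTriangle.closure_interior {T : Finset Pt} {a b c : Pt} (h : IsTriangle T a b c) :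
    closure (interior (cell T)) = cell T := by
  rw [(convex_convexHull ℝ (T : Set Pt)).closure_interior_eq_closure_of_nonempty_interior
    h.interior_nonempty, (isCompact_cell T).isClosed.closure_eq]

theorem IsTriangle.isOpenPosMeasure_area {T : Finset Pt} {a b c : Pt} (h : IsTriangle T a b c) :
    (area T).IsOpenPosMeasure := by
  refine ⟨fun U hU hne => ?_⟩
  obtain ⟨V, hV, rfl⟩ := isOpen_induced_iff.1 hU
  obtain ⟨⟨x, hx⟩, hxV⟩ := hne
  rw [← h.closure_interior] at hx
  have hne := mem_closure_iff.1 hx V hV hxV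
  have himg : (Subtype.val : cell T → Pt) '' (Subtype.val ⁻¹' V) = V ∩ cell T := by
    rw [Set.image_preimage_eq_inter_range, Subtype.range_coe]
  rw [area, (MeasurableEmbedding.subtype_coe (measurableSet_cell _)).comap_apply, himg]
  exact (lt_of_lt_of_le ((hV.inter isOpen_interior).measure_pos volume hne)
    (measure_mono (Set.inter_subset_inter_right V interior_subset))).ne'

theorem eq_zero_of_integral_eq_zero {X : Type*} [TopologicalSpace X] [CompactSpace X]
    [MeasurableSpace X] [OpensMeasurableSpace X] {ν : Measure X} [IsFiniteMeasure ν]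
    (hν : ν.IsOpenPosMeasure) {f : X → ℝ} (hf : Continuous f) (h0 : ∀ x, 0 ≤ f x)
    (h : ∫ x, f x ∂ν = 0) (x : X) : f x = 0 := by
  have h1 := (integral_eq_zero_iff_of_nonneg h0 (integrable_of_continuous hf)).1 h
  exact congrFun ((hf.ae_eq_iff_eq ν continuous_zero).1 h1) x

/-! ### The divergence theorem on a triangle -/

/-- The mean of a function over the segment from `a` to `b`. -/
noncomputable def segMean (g : Pt → ℝ) (a b : Pt) : ℝ := ∫ t in (0 : ℝ)..1, g (a + t • (b - a))

theorem segMean_comm (g : Pt → ℝ) (a b : Pt) : segMean g a b = segMean g b a := by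
  have h := intervalIntegral.integral_comp_sub_left (a := 0) (b := 1)
    (fun t : ℝ => g (a + t • (b - a))) 1
  rw [sub_self, sub_zero] at h
  rw [segMean, segMean, ← h]
  congr 1
  funext t
  congr 1
  module

theorem abs_cross_rotate (a b c : Pt) :
    |cross (c - b) (a - b)| = |cross (b - a) (c - a)| := by
  congr 1; simp [cross]; ring

/-- The fundamental theorem of calculus along the lines of direction `c - a`. -/
theorem integral_directional {T : Finset Pt} {a b c : Pt} (h : IsTriangle T a b c) (p : Poly) :
    ∫ x, (ev (MvPolynomial.pderiv 0 p) x * (c - a) 0 + ev (MvPolynomial.pderiv 1 p) x * (c - a) 1)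
        ∂area T =
      |cross (b - a) (c - a)| * (segMean (ev p) b c - segMean (ev p) a b) := by
  rw [integral_area h (fun x => ev (MvPolynomial.pderiv 0 p) x * (c - a) 0 +
    ev (MvPolynomial.pderiv 1 p) x * (c - a) 1), setIntegral_refTriangle (by unfold refMap; fun_prop)]
  congr 1
  have h1 : ∀ s : ℝ, ∫ t in (0 : ℝ)..(1 - s),
      (ev (MvPolynomial.pderiv 0 p) (refMap a b c (s, t)) * (c - a) 0 +
        ev (MvPolynomial.pderiv 1 p) (refMap a b c (s, t)) * (c - a) 1) =
      ev p (c + s • (b - c)) - ev p (a + s • (b - a)) := by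
    intro s
    simp only [refMap]
    rw [intervalIntegral.integral_eq_sub_of_hasDerivAt
      (f := fun t => ev p (a + s • (b - a) + t • (c - a)))
      (fun t _ => hasDerivAt_ev_line p (a + s • (b - a)) (c - a) t)
      (Continuous.intervalIntegrable (by fun_prop) _ _)]
    congr 2
    · module
    · simp
  simp only [h1]
  rw [segMean_comm (ev p) b c, intervalIntegral.integral_sub]
  · rfl
  · exact Continuous.intervalIntegrable (by fun_prop) _ _
  · exact Continuous.intervalIntegrable (by fun_prop) _ _

section Divergence

variable [DecidableEq Pt] {T : Finset Pt} {a b c : Pt}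

/-- The length of an edge times the normal component of a second edge is twice the area. -/
theorem dist_mul_inner_outwardNormal (h : IsTriangle T a b c) :
    dist a b * inner ℝ (outwardNormal T {a, b}) (c - a) = -|cross (b - a) (c - a)| := by
  obtain ⟨h1, h2, h3⟩ := outwardNormal_spec h
  set n := outwardNormal T {a, b}
  have hd : dist a b ^ 2 = (b - a) 0 ^ 2 + (b - a) 1 ^ 2 := by
    rw [dist_comm, dist_eq_norm, norm_sq_eq]
  have hn := sq_add_sq_of_norm_eq_one h1
  have hsq : (dist a b * inner ℝ n (c - a)) ^ 2 = (-|cross (b - a) (c - a)|) ^ 2 := by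
    rw [mul_pow, hd, neg_sq, sq_abs]
    rw [inner_eq] at *
    generalize b - a = u at *
    generalize c - a = w at *
    unfold cross
    -- `u` is orthogonal to the unit vector `n`, so `u = r n^⊥` with `r = n₀ u₁ - n₁ u₀`
    have hu0 : u 0 = -(n 0 * u 1 - n 1 * u 0) * n 1 := by linear_combination n 0 * h2 - u 0 * hn
    have hu1 : u 1 = (n 0 * u 1 - n 1 * u 0) * n 0 := by linear_combination n 1 * h2 - u 1 * hn
    generalize n 0 * u 1 - n 1 * u 0 = r at *
    rw [hu0, hu1]
    linear_combination r ^ 2 * (n 0 * w 0 + n 1 * w 1) ^ 2 * hn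
  have hab : 0 ≤ dist a b := dist_nonneg
  have hcr := abs_nonneg (cross (b - a) (c - a))
  have := (sq_eq_sq₀ (a := -(dist a b * inner ℝ n (c - a))) (by nlinarith) hcr).1
    (by rw [neg_sq, hsq, neg_sq])
  linarith

/-- The divergence theorem in the direction of an edge. -/
theorem integral_directional_eq_boundary (h : IsTriangle T a b c) (p : Poly) :
    ∫ x, (ev (MvPolynomial.pderiv 0 p) x * (c - a) 0 + ev (MvPolynomial.pderiv 1 p) x * (c - a) 1)
        ∂area T =
      ∑ e : edges T, inner ℝ (outwardNormal T e) (c - a) * ∫ x, ev p x ∂arcLength e := by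
  rw [integral_directional h,
    h.sum_edges (fun e => inner ℝ (outwardNormal T e) (c - a) * ∫ x, ev p x ∂arcLength e),
    integral_arcLength h.ne, integral_arcLength h.ne'', integral_arcLength h.ne'.symm]
  have h1 := dist_mul_inner_outwardNormal h
  have h2 := dist_mul_inner_outwardNormal h.rotate
  obtain ⟨-, h3, -⟩ := outwardNormal_spec h.rotate.rotate
  obtain ⟨-, h4, -⟩ := outwardNormal_spec h.rotate
  have h5 : inner ℝ (outwardNormal T {c, a}) (c - a) = 0 := by
    rw [← neg_sub, inner_neg_right, h3, neg_zero]
  have h6 : inner ℝ (outwardNormal T {b, c}) (c - a) =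
      -inner ℝ (outwardNormal T {b, c}) (a - b) := by
    rw [inner_sub_right] at h4
    rw [inner_sub_right, inner_sub_right]; linarith
  rw [abs_cross_rotate] at h2
  change _ = _ * (_ * segMean (ev p) a b) + _ * (_ * segMean (ev p) b c) + _ * (_ * _)
  rw [h5, h6]
  linear_combination -segMean (ev p) a b * h1 + segMean (ev p) b c * h2

/-- The divergence theorem on a triangle, componentwise. The two edge directions at a vertex are
linearly independent, so the identities in these directions suffice. -/
theorem integral_evalOn_pderiv (h : IsTriangle T a b c) (p : Poly) (i : Fin 2) :
    ∫ x, evalOn (cell T) (MvPolynomial.pderiv i p) x ∂area T =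
      ∑ e : edges T, ∫ x, evalOn (cell (e : Finset Pt)) p x * outwardNormal T e i ∂arcLength e := by
  let D : Pt := !₂[∫ x, ev (MvPolynomial.pderiv 0 p) x ∂area T,
    ∫ x, ev (MvPolynomial.pderiv 1 p) x ∂area T]
  let B : Pt := ∑ e : edges T, (∫ x, ev p x ∂arcLength (e : Finset Pt)) • outwardNormal T e
  have key : ∀ {b c : Pt}, IsTriangle T a b c → inner ℝ (D - B) (c - a) = 0 := by
    intro b c h
    have h1 := integral_directional_eq_boundary h p
    rw [integral_add (integrable_of_continuous (by fun_prop))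
      (integrable_of_continuous (by fun_prop)), integral_mul_const, integral_mul_const] at h1
    rw [inner_sub_left, sub_eq_zero, sum_inner, inner_eq]
    simp only [real_inner_smul_left]
    simp only [mul_comm (inner ℝ _ _)] at h1
    exact h1
  have h0 := eq_zero_of_inner_eq_zero h.2 (key h.swap) (key h)
  have hDB := sub_eq_zero.1 h0
  have hB : B i = ∑ e : edges T, ∫ x, evalOn (cell (e : Finset Pt)) p x * outwardNormal T e i
      ∂arcLength e := by
    simp only [B, WithLp.ofLp_sum, Finset.sum_apply, PiLp.smul_apply, smul_eq_mul,
      integral_mul_const]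
    rfl
  rw [← hB, ← hDB]
  fin_cases i <;> rfl

end Divergence

/-! ### Polynomial spaces and the discrete differential operators -/

theorem continuous_of_mem_polyOn {k : ℕ} {S : Set Pt} {f : S → ℝ} (hf : f ∈ polyOn k S) :
    Continuous f := by
  obtain ⟨p, -, rfl⟩ := hf
  exact continuous_evalOn S p

theorem continuous_of_mem_vecPolyOn {k : ℕ} {S : Set Pt} {f : S → Pt} (hf : f ∈ vecPolyOn k S)
    (i : Fin 2) : Continuous fun x => f x i :=
  continuous_of_mem_polyOn (hf i)

theorem exists_of_mem_polyOn {k : ℕ} {S : Set Pt} {f : S → ℝ} (hf : f ∈ polyOn k S) :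
    ∃ p : Poly, p.totalDegree ≤ k ∧ f = evalOn S p := by
  obtain ⟨p, hp, rfl⟩ := hf
  exact ⟨p, (MvPolynomial.mem_restrictTotalDegree _ _ _).1 hp, rfl⟩

theorem evalOn_mem_polyOn {k : ℕ} {S : Set Pt} {p : Poly} (hp : p.totalDegree ≤ k) :
    evalOn S p ∈ polyOn k S :=
  ⟨p, (MvPolynomial.mem_restrictTotalDegree _ _ _).2 hp, rfl⟩

/-- A triangle has interior points, so it contains a product of two intervals, and a polynomial
vanishing there is zero. -/
theorem IsTriangle.poly_eq_zero {T : Finset Pt} {a b c : Pt} (h : IsTriangle T a b c) {p : Poly}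
    (hp : ∀ x ∈ cell T, ev p x = 0) : p = 0 := by
  obtain ⟨x, hx⟩ := h.interior_nonempty
  have ho : IsOpen ((WithLp.toLp 2 : (Fin 2 → ℝ) → Pt) ⁻¹' interior (cell T)) :=
    isOpen_interior.preimage (PiLp.continuous_toLp 2 _)
  obtain ⟨ε, hε, hball⟩ := Metric.isOpen_iff.1 ho x.ofLp (by simpa using hx)
  refine MvPolynomial.funext_set (fun i => Metric.ball (x.ofLp i) ε) (fun i => ?_) fun y hy => ?_
  · rw [Real.ball_eq_Ioo]
    exact Set.Ioo_infinite (by linarith)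
  · rw [← ball_pi _ hε] at hy
    rw [map_zero]
    exact hp (WithLp.toLp 2 y) (interior_subset (hball hy))

theorem integrable_evalOn_mul {S : Set Pt} [CompactSpace S] {ν : Measure S} [IsFiniteMeasure ν]
    (p q : Poly) : Integrable (fun x => evalOn S p x * evalOn S q x) ν :=
  integrable_of_continuous (by fun_prop)

/-- Riesz representation in the polynomials of degree at most `m` with the `L²` product on a
triangle, linearly in a parameter. -/
theorem IsTriangle.exists_riesz {T : Finset Pt} {a b c : Pt} (h : IsTriangle T a b c) {V : Type*}
    [AddCommGroup V] [Module ℝ V] (m : ℕ) (F : V →ₗ[ℝ] Poly →ₗ[ℝ] ℝ) :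
    ∃ L : V →ₗ[ℝ] polyOn m (cell T), ∀ v, ∀ τ : Poly, τ.totalDegree ≤ m →
      ∫ x, (L v : cell T → ℝ) x * evalOn (cell T) τ x ∂area T = F v τ := by
  let U := MvPolynomial.restrictTotalDegree (Fin 2) ℝ m
  let B : U →ₗ[ℝ] Module.Dual ℝ U := LinearMap.mk₂ ℝ
    (fun p q => ∫ x, evalOn (cell T) p x * evalOn (cell T) q x ∂area T)
    (by
      intro p p' q
      rw [← integral_add (integrable_evalOn_mul _ _) (integrable_evalOn_mul _ _)]
      simp [add_mul])
    (by
      intro r p q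
      rw [smul_eq_mul, ← integral_const_mul]
      simp [mul_assoc])
    (by
      intro p q q'
      rw [← integral_add (integrable_evalOn_mul _ _) (integrable_evalOn_mul _ _)]
      simp [mul_add])
    (by
      intro r p q
      rw [smul_eq_mul, ← integral_const_mul]
      simp [mul_left_comm])
  have hB : Function.Injective B := by
    rw [← LinearMap.ker_eq_bot, LinearMap.ker_eq_bot']
    intro p hp
    have h0 : ∫ x, evalOn (cell T) p x * evalOn (cell T) p x ∂area T = 0 :=
      congrArg (fun l : Module.Dual ℝ U => l p) hp
    have h1 := eq_zero_of_integral_eq_zero h.isOpenPosMeasure_area (by fun_prop)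
      (fun x => mul_self_nonneg _) h0
    apply Subtype.ext
    exact h.poly_eq_zero fun x hx => mul_self_eq_zero.1 (h1 ⟨x, hx⟩)
  let B' : U ≃ₗ[ℝ] Module.Dual ℝ U :=
    LinearMap.linearEquivOfInjective B hB Subspace.dual_finrank_eq.symm
  let E : U →ₗ[ℝ] polyOn m (cell T) :=
    ((evalOn (cell T)).domRestrict U).codRestrict (polyOn m (cell T))
      fun p => ⟨p, p.2, rfl⟩
  refine ⟨E ∘ₗ B'.symm.toLinearMap ∘ₗ LinearMap.lcomp ℝ ℝ U.subtype ∘ₗ F, fun v τ hτ => ?_⟩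
  have h1 : B (B'.symm (LinearMap.lcomp ℝ ℝ U.subtype (F v))) =
      LinearMap.lcomp ℝ ℝ U.subtype (F v) :=
    B'.apply_symm_apply _
  exact congrArg (fun l : Module.Dual ℝ U =>
    l ⟨τ, (MvPolynomial.mem_restrictTotalDegree _ _ _).2 hτ⟩) h1

section Operators

variable {k : ℕ} {T : Finset Pt}

@[fun_prop]
theorem continuous_localV_fst (v : localV k T) (i : Fin 2) : Continuous fun x => v.1.1 x i :=
  continuous_of_mem_vecPolyOn v.2.1 i

@[fun_prop]
theorem continuous_localV_snd (v : localV k T) (e : edges T) (i : Fin 2) :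
    Continuous fun x => v.1.2 e x i :=
  continuous_of_mem_vecPolyOn (v.2.2 e) i

/-- The functional `φ ↦ -(v_{0,i}, ∂_j φ)_T + ⟨v_{b,i}, φ n_j⟩_{∂T}`, which defines the weak partial
derivative `∂_j v_i`. -/
noncomputable def weakPartial (k : ℕ) (T : Finset Pt) (i j : Fin 2) :
    localV k T →ₗ[ℝ] Poly →ₗ[ℝ] ℝ :=
  LinearMap.mk₂ ℝ
    (fun v φ => -(∫ x, v.1.1 x i * evalOn (cell T) (MvPolynomial.pderiv j φ) x ∂area T) +
      ∑ e : edges T, ∫ x, v.1.2 e x i * (evalOn (cell (e : Finset Pt)) φ x * outwardNormal T e j)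
        ∂arcLength e)
    (by
      intro v w φ
      rw [add_add_add_comm, ← neg_add, ← integral_add (integrable_of_continuous (by fun_prop))
        (integrable_of_continuous (by fun_prop)), ← Finset.sum_add_distrib]
      refine congrArg₂ (· + ·) (congrArg Neg.neg ?_) (Finset.sum_congr rfl fun e _ => ?_)
      · simp [add_mul]
      · rw [← integral_add (integrable_of_continuous (by fun_prop))
          (integrable_of_continuous (by fun_prop))]
        simp [add_mul])
    (by
      intro r v φ
      rw [smul_eq_mul, mul_add, mul_neg, Finset.mul_sum]
      simp only [← integral_const_mul]
      simp [mul_assoc])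
    (by
      intro v φ ψ
      rw [add_add_add_comm, ← neg_add, ← integral_add (integrable_of_continuous (by fun_prop))
        (integrable_of_continuous (by fun_prop)), ← Finset.sum_add_distrib]
      refine congrArg₂ (· + ·) (congrArg Neg.neg ?_) (Finset.sum_congr rfl fun e _ => ?_)
      · simp [mul_add]
      · rw [← integral_add (integrable_of_continuous (by fun_prop))
          (integrable_of_continuous (by fun_prop))]
        simp [add_mul, mul_add])
    (by
      intro r v φ
      rw [smul_eq_mul, mul_add, mul_neg, Finset.mul_sum]
      simp only [← integral_const_mul]
      simp [mul_assoc, mul_left_comm])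

theorem weakPartial_apply (i j : Fin 2) (v : localV k T) (φ : Poly) : weakPartial k T i j v φ =
    -(∫ x, v.1.1 x i * evalOn (cell T) (MvPolynomial.pderiv j φ) x ∂area T) +
      ∑ e : edges T, ∫ x, v.1.2 e x i * (evalOn (cell (e : Finset Pt)) φ x * outwardNormal T e j)
        ∂arcLength e := rfl

theorem continuous_matPolyOn {S : Set Pt} (G : matPolyOn k S) (i j : Fin 2) :
    Continuous fun x => (G : S → Matrix (Fin 2) (Fin 2) ℝ) x i j :=
  continuous_of_mem_polyOn (G.2 i j)

theorem isWeakGradient_iff (v : localV k T) (G : cell T → Matrix (Fin 2) (Fin 2) ℝ)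
    (hG : ∀ i j, Continuous fun x => G x i j) : IsWeakGradient k T v.1 G ↔
      ∀ φ : Fin 2 → Fin 2 → Poly, (∀ i j, (φ i j).totalDegree ≤ k - 1) →
        ∑ i, ∑ j, ∫ x, G x i j * evalOn (cell T) (φ i j) x ∂area T =
          ∑ i, ∑ j, weakPartial k T i j v (φ i j) := by
  refine forall_congr' fun φ => imp_congr_right fun _ => ?_
  have h1 : ∫ x, (∑ i, ∑ j, G x i j * evalOn (cell T) (φ i j) x) ∂area T =
      ∑ i, ∑ j, ∫ x, G x i j * evalOn (cell T) (φ i j) x ∂area T := by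
    rw [integral_finsetSum _ fun i _ => integrable_of_continuous (by fun_prop)]
    exact Finset.sum_congr rfl fun i _ =>
      integral_finsetSum _ fun j _ => integrable_of_continuous (by fun_prop)
  have h2 : ∫ x, (∑ i, v.1.1 x i *
        ∑ j, evalOn (cell T) (MvPolynomial.pderiv j (φ i j)) x) ∂area T =
      ∑ i, ∑ j, ∫ x, v.1.1 x i * evalOn (cell T) (MvPolynomial.pderiv j (φ i j)) x ∂area T := by
    rw [integral_finsetSum _ fun i _ => integrable_of_continuous (by fun_prop)]
    refine Finset.sum_congr rfl fun i _ => ?_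
    simp only [Finset.mul_sum]
    rw [integral_finsetSum _ fun j _ => integrable_of_continuous (by fun_prop)]
  have h3 : ∀ e : edges T, (∫ x, (∑ i, v.1.2 e x i *
      ∑ j, evalOn (cell (e : Finset Pt)) (φ i j) x * outwardNormal T e j) ∂arcLength e) =
      ∑ i, ∑ j, ∫ x, v.1.2 e x i *
        (evalOn (cell (e : Finset Pt)) (φ i j) x * outwardNormal T e j) ∂arcLength e := by
    intro e
    rw [integral_finsetSum _ fun i _ => integrable_of_continuous (by fun_prop)]
    refine Finset.sum_congr rfl fun i _ => ?_
    simp only [Finset.mul_sum]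
    rw [integral_finsetSum _ fun j _ => integrable_of_continuous (by fun_prop)]
  have h4 : -(∫ x, (∑ i, v.1.1 x i *
        ∑ j, evalOn (cell T) (MvPolynomial.pderiv j (φ i j)) x) ∂area T)
      + ∑ e : edges T, (∫ x, (∑ i, v.1.2 e x i *
          ∑ j, evalOn (cell (e : Finset Pt)) (φ i j) x * outwardNormal T e j) ∂arcLength e) =
      ∑ i, ∑ j, weakPartial k T i j v (φ i j) := by
    simp only [h2, h3, weakPartial_apply, Finset.sum_add_distrib, Finset.sum_neg_distrib]
    congr 1
    rw [Finset.sum_comm]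
    exact Finset.sum_congr rfl fun i _ => Finset.sum_comm
  rw [h1, h4]

/-- The weak gradient exists and satisfies its defining equation, by Riesz representation of each
entry. -/
theorem weakGradient_spec {a b c : Pt} (h : IsTriangle T a b c) (v : localV k T) :
    IsWeakGradient k T v.1 (weakGradient k T v : cell T → Matrix (Fin 2) (Fin 2) ℝ) := by
  have hex : ∃ L : localV k T →ₗ[ℝ] matPolyOn (k - 1) (cell T),
      ∀ v : localV k T, IsWeakGradient k T v.1 (L v : cell T → Matrix (Fin 2) (Fin 2) ℝ) := by
    choose L hL using fun i j => h.exists_riesz (k - 1) (weakPartial k T i j)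
    refine ⟨{ toFun := fun v => ⟨fun x => Matrix.of fun i j => (L i j v : cell T → ℝ) x,
                fun i j => (L i j v).2⟩
              map_add' := ?_
              map_smul' := ?_ }, fun v => (isWeakGradient_iff v _ ?_).2 fun φ hφ => ?_⟩
    · intro v w; ext x i j; simp
    · intro r v; ext x i j; simp
    · exact fun i j => continuous_of_mem_polyOn (L i j v).2
    · exact Finset.sum_congr rfl fun i _ => Finset.sum_congr rfl fun j _ => hL i j v _ (hφ i j)
  rw [weakGradient, dif_pos hex]
  exact hex.choose_spec v

/-- The weak divergence exists and satisfies its defining equation: it is the trace of the weak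
partial derivatives represented in the polynomials of degree at most `k`. -/
theorem weakDivergence_spec {a b c : Pt} (h : IsTriangle T a b c) (v : localV k T) :
    IsWeakDivergence k T v.1 (weakDivergence k T v : cell T → ℝ) := by
  have hex : ∃ L : localV k T →ₗ[ℝ] polyOn k (cell T),
      ∀ v : localV k T, IsWeakDivergence k T v.1 (L v : cell T → ℝ) := by
    choose L hL using fun i => h.exists_riesz k (weakPartial k T i i)
    refine ⟨∑ i, L i, fun v τ hτ => ?_⟩
    have hc : ∀ i, Continuous (L i v : cell T → ℝ) :=
      fun i => continuous_of_mem_polyOn (L i v).2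
    have h2 : ∀ e : edges T, (∫ x, inner ℝ (v.1.2 e x) (outwardNormal T e) *
          evalOn (cell (e : Finset Pt)) τ x ∂arcLength e) =
        ∑ i, ∫ x, v.1.2 e x i *
            (evalOn (cell (e : Finset Pt)) τ x * outwardNormal T e i) ∂arcLength e := by
      intro e
      rw [← integral_finsetSum _ fun i _ => integrable_of_continuous (by fun_prop)]
      congr 1
      funext x
      rw [inner_eq, Fin.sum_univ_two]; ring
    simp only [h2]
    rw [Finset.sum_comm, integral_finsetSum _ fun i _ => integrable_of_continuous (by fun_prop),
      ← Finset.sum_neg_distrib, ← Finset.sum_add_distrib]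
    have h3 : ∀ x, ((∑ i, L i) v : polyOn k (cell T)).1 x * evalOn (cell T) τ x =
        ∑ i, (L i v : cell T → ℝ) x * evalOn (cell T) τ x := by
      intro x; simp [add_mul]
    simp only [h3]
    rw [integral_finsetSum _ fun i _ => integrable_of_continuous (by fun_prop)]
    refine Finset.sum_congr rfl fun i _ => ?_
    rw [hL i v _ hτ, weakPartial_apply]
  rw [weakDivergence, dif_pos hex]
  exact hex.choose_spec v

end Operators

/-! ### Combinatorial geometry of the mesh -/

theorem IsTriangle.of_mem_edges [DecidableEq Pt] {T : Finset Pt} {a b c p q : Pt}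
    (h : IsTriangle T a b c) (he : {p, q} ∈ edges T) : ∃ d, IsTriangle T p q d := by
  obtain ⟨a, b, c, h', he⟩ := exists_isTriangle_of_mem_edges h he
  have hpq : p ≠ q := by
    rintro rfl
    have := congrArg Finset.card he
    rw [Finset.card_pair h'.ne] at this
    simp at this
  have hp : p = a ∨ p = b := by
    have : p ∈ ({a, b} : Finset Pt) := he ▸ (by simp)
    simpa using this
  have hq : q = a ∨ q = b := by
    have : q ∈ ({a, b} : Finset Pt) := he ▸ (by simp)
    simpa using this
  rcases hp with rfl | rfl <;> rcases hq with rfl | rfl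
  · exact absurd rfl hpq
  · exact ⟨c, h'⟩
  · exact ⟨c, h'.rotate.swap⟩
  · exact absurd rfl hpq

namespace Mesh

variable (M : Mesh)

open Classical in
/-- All triangles of the mesh. -/
noncomputable def triangles : Finset (Finset Pt) := M.stokes ∪ M.darcy

variable {M}

theorem mem_triangles {T : Finset Pt} : T ∈ M.triangles ↔ T ∈ M.stokes ∨ T ∈ M.darcy := by
  classical exact Finset.mem_union

theorem exists_isTriangle {T : Finset Pt} (hT : T ∈ M.triangles) :
    ∃ a b c, IsTriangle T a b c := by
  obtain ⟨h1, h2⟩ := (M.triangle_iff T).1 (mem_triangles.1 hT)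
  exact StokesDarcyWG.exists_isTriangle h2 (M.complex.indep h1)

theorem exists_isTriangle_stokes (T : M.stokes) : ∃ a b c, IsTriangle T a b c :=
  exists_isTriangle (mem_triangles.2 (Or.inl T.2))

theorem exists_isTriangle_darcy (T : M.darcy) : ∃ a b c, IsTriangle T a b c :=
  exists_isTriangle (mem_triangles.2 (Or.inr T.2))

theorem domain_eq : M.domain = interior (⋃ T ∈ M.triangles, cell T) := by
  rw [domain]
  congr 1
  ext x
  simp only [Set.mem_union, Set.mem_iUnion, exists_prop, mem_triangles]
  constructor
  · rintro (⟨T, h1, h2⟩ | ⟨T, h1, h2⟩)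
    exacts [⟨T, Or.inl h1, h2⟩, ⟨T, Or.inr h1, h2⟩]
  · rintro ⟨T, h1 | h1, h2⟩
    exacts [Or.inl ⟨T, h1, h2⟩, Or.inr ⟨T, h1, h2⟩]

theorem isOpen_domain : IsOpen M.domain := isOpen_interior

theorem interior_cell_subset_domain {T : Finset Pt} (hT : T ∈ M.triangles) :
    interior (cell T) ⊆ M.domain := by
  rw [domain_eq]
  exact interior_mono (Set.subset_biUnion_of_mem (u := fun T : Finset Pt => cell T) hT)

theorem mem_cell_inter [DecidableEq Pt] {T T' : Finset Pt} (hT : T ∈ M.triangles)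
    (hT' : T' ∈ M.triangles) {x : Pt} (h : x ∈ cell T) (h' : x ∈ cell T') :
    x ∈ cell (T ∩ T') := by
  have h1 := ((M.triangle_iff T).1 (mem_triangles.1 hT)).1
  have h2 := ((M.triangle_iff T').1 (mem_triangles.1 hT')).1
  have := M.complex.inter_subset_convexHull h1 h2 ⟨h, h'⟩
  rwa [cell, Finset.coe_inter]

/-- A triangle of the mesh containing a point in the relative interior of an edge has that edge. -/
theorem mem_edges_of_mem_cell [DecidableEq Pt] {T T' : Finset Pt} (hT : T ∈ M.triangles)
    (hT' : T' ∈ M.triangles) {a b c : Pt} (h : IsTriangle T a b c) {t : ℝ} (h0 : 0 < t)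
    (h1 : t < 1) (hx : a + t • (b - a) ∈ cell T') : {a, b} ∈ edges T' := by
  have hxT : a + t • (b - a) ∈ cell T :=
    h.mem_cell.2 ⟨t, 0, h0.le, le_rfl, by linarith, by simp⟩
  have hx' := mem_cell_inter hT hT' hxT hx
  have key : ∀ {p q : Pt}, IsTriangle T p q c → ∀ s : ℝ, s < 1 →
      p + s • (q - p) ∈ cell (T ∩ T') → p ∈ T' := by
    intro p q hp s hs hmem
    by_contra hpT'
    have hsub : T ∩ T' ⊆ {q, c} := by
      intro y hy
      rw [Finset.mem_inter, hp.mem_iff] at hy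
      simp only [Finset.mem_insert, Finset.mem_singleton]
      rcases hy with ⟨rfl | rfl | rfl, hy⟩
      · exact absurd hy hpT'
      · simp
      · simp
    obtain ⟨r, -, -, hr⟩ := mem_cell_pair.1 (convexHull_mono (Finset.coe_subset.2 hsub) hmem)
    have e1 : cross (p + s • (q - p) - q) (c - q) = (1 - s) * cross (p - q) (c - q) := by
      simp [cross]; ring
    rw [hr] at e1
    have e2 : cross (q + r • (c - q) - q) (c - q) = 0 := by simp [cross]; ring
    rw [e2] at e1
    have h3 := hp.rotate.swap.2
    rcases mul_eq_zero.1 e1.symm with h4 | h4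
    · linarith
    · exact h3 h4
  have ha : a ∈ T' := key h t h1 hx'
  have hb : b ∈ T' := by
    refine key (p := b) (q := a) h.rotate.swap (1 - t) (by linarith) ?_
    convert hx' using 1
    module
  refine Finset.mem_powersetCard.2 ⟨?_, Finset.card_pair h.ne⟩
  intro y hy
  simp only [Finset.mem_insert, Finset.mem_singleton] at hy
  rcases hy with rfl | rfl <;> assumption

/-- An edge that belongs to just one triangle lies in the boundary of the domain. -/
theorem exists_ne_of_not_subset_frontier {T e : Finset Pt} (hT : T ∈ M.triangles)
    (he : e ∈ edges T) (hf : ¬ cell e ⊆ frontier M.domain) :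
    ∃ T' ∈ M.triangles, T' ≠ T ∧ e ∈ edges T' := by
  classical
  by_contra! hcon
  apply hf
  obtain ⟨a, b, c, h⟩ := exists_isTriangle hT
  obtain ⟨a, b, c, h, rfl⟩ := exists_isTriangle_of_mem_edges h he
  have key : ∀ t ∈ Set.Ioo (0 : ℝ) 1, a + t • (b - a) ∈ frontier M.domain := by
    rintro t ⟨h0, h1⟩
    rw [isOpen_domain.frontier_eq]
    have hxT : a + t • (b - a) ∈ cell T :=
      h.mem_cell.2 ⟨t, 0, h0.le, le_rfl, by linarith, by simp⟩
    refine ⟨?_, fun hx => ?_⟩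
    · exact closure_mono (interior_cell_subset_domain hT) (h.closure_interior.symm ▸ hxT)
    · -- near the point, the domain is covered by `T` alone
      let K : Set Pt := ⋃ T' ∈ M.triangles.erase T, cell T'
      have hK : IsClosed K := isClosed_biUnion_finset fun T' _ => (isCompact_cell T').isClosed
      have hxK : a + t • (b - a) ∉ K := by
        intro hxK
        simp only [K, Set.mem_iUnion, exists_prop, Finset.mem_erase] at hxK
        obtain ⟨T', ⟨hne, hT'⟩, hx'⟩ := hxK
        exact hcon T' hT' hne (mem_edges_of_mem_cell hT hT' h h0 h1 hx')
      obtain ⟨ε, hε, hball⟩ := Metric.isOpen_iff.1 (isOpen_domain.sdiff hK) _ ⟨hx, hxK⟩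
      obtain ⟨n1, n2, n3⟩ := outwardNormal_spec h
      set n := outwardNormal T {a, b}
      have hy : a + t • (b - a) + (ε / 2) • n ∈ M.domain \ K := by
        apply hball
        rw [Metric.mem_ball, dist_eq_norm, add_sub_cancel_left, norm_smul, n1,
          Real.norm_of_nonneg (by positivity)]
        linarith
      have hyT : a + t • (b - a) + (ε / 2) • n ∈ cell T := by
        have h2 := hy.1
        rw [domain_eq] at h2
        have h3 := interior_subset h2
        simp only [Set.mem_iUnion, exists_prop] at h3
        obtain ⟨T', hT', h4⟩ := h3
        by_cases hTT : T' = T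
        · rwa [hTT] at h4
        · exact absurd (Set.mem_biUnion (Finset.mem_erase.2 ⟨hTT, hT'⟩) h4) hy.2
      have h5 := inner_outwardNormal_le h hyT
      rw [show a + t • (b - a) + (ε / 2) • n - a = t • (b - a) + (ε / 2) • n by abel,
        inner_add_right, inner_smul_right, inner_smul_right, n2, real_inner_self_eq_norm_sq,
        n1] at h5
      linarith
  intro x hx
  obtain ⟨t, h0, h1, rfl⟩ := mem_cell_pair.1 hx
  have hcl : t ∈ closure (Set.Ioo (0 : ℝ) 1) := by
    rw [closure_Ioo zero_ne_one]; exact ⟨h0, h1⟩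
  exact closure_minimal key
    (isClosed_frontier.preimage (by fun_prop : Continuous fun t : ℝ => a + t • (b - a))) hcl

/-- Two triangles of the mesh with a common edge lie on opposite sides of it. -/
theorem outwardNormal_add_eq_zero {T T' e : Finset Pt} (hT : T ∈ M.triangles)
    (hT' : T' ∈ M.triangles) (hne : T ≠ T') (he : e ∈ edges T) (he' : e ∈ edges T') :
    outwardNormal T e + outwardNormal T' e = 0 := by
  classical
  obtain ⟨a, b, c, h⟩ := exists_isTriangle hT
  obtain ⟨a, b, c, h, rfl⟩ := exists_isTriangle_of_mem_edges h he
  obtain ⟨a', b', c', h'⟩ := exists_isTriangle hT'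
  obtain ⟨d, h'⟩ := h'.of_mem_edges he'
  obtain ⟨n1, n2, n3⟩ := outwardNormal_spec h
  obtain ⟨m1, m2, m3⟩ := outwardNormal_spec h'
  set n := outwardNormal T {a, b}
  set m := outwardNormal T' {a, b}
  have hmn := eq_inner_smul (sub_ne_zero.2 h.ne.symm) m2 n2 n1
  have hsq : |inner ℝ m n| = 1 := by
    have := congrArg norm hmn
    rwa [norm_smul, m1, n1, mul_one, Real.norm_eq_abs, eq_comm] at this
  rcases eq_or_eq_neg_of_abs_eq hsq with h1 | h1
  · exfalso
    rw [h1, one_smul] at hmn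
    rw [hmn] at m3
    set J := cross (b - a) (c - a) with hJ
    have hJ0 : J ≠ 0 := h.2
    -- barycentric coordinates of `d` with respect to `T`
    set r := cross (b - a) (d - a) / J
    set s := cross (d - a) (c - a) / J
    have hd : d - a = s • (b - a) + r • (c - a) := by
      apply pt_ext <;>
      · simp only [PiLp.add_apply, PiLp.smul_apply, smul_eq_mul, r, s]
        field_simp
        simp only [hJ, cross, PiLp.sub_apply]
        ring
    have hr : 0 < r := by
      rw [hd, inner_add_right, inner_smul_right, inner_smul_right, n2] at m3
      nlinarith
    -- a point near the midpoint of the common edge, in both triangles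
    set ε := 1 / (2 * (|s - 1 / 2| + r + 1)) with hεdef
    have hpos : 0 < |s - 1 / 2| + r + 1 := by positivity
    have hε : 0 < ε := by positivity
    have hε1 : ε * (|s - 1 / 2| + r + 1) = 1 / 2 := by rw [hεdef]; field_simp
    have hε2 : ε ≤ 1 / 2 := by nlinarith [abs_nonneg (s - 1 / 2)]
    have habs1 := mul_le_mul_of_nonneg_left (le_abs_self (s - 1 / 2)) hε.le
    have habs2 := mul_le_mul_of_nonneg_left (neg_abs_le (s - 1 / 2)) hε.le
    have hεr : 0 < ε * r := by positivity
    set x := a + (1 / 2 + ε * (s - 1 / 2)) • (b - a) + (ε * r) • (c - a)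
    have hxT : x ∈ cell T :=
      h.mem_cell.2 ⟨_, _, by linarith, by positivity, by linarith, rfl⟩
    have hxT' : x ∈ cell T' := by
      refine h'.mem_cell.2 ⟨(1 - ε) / 2, ε, by linarith, hε.le, by linarith, ?_⟩
      rw [hd]; simp only [x]; module
    have hsub : T ∩ T' ⊆ {a, b} := by
      intro y hy
      rw [Finset.mem_inter, h.mem_iff] at hy
      simp only [Finset.mem_insert, Finset.mem_singleton]
      obtain ⟨rfl | rfl | rfl, hy⟩ := hy
      · simp
      · simp
      · exfalso
        rcases h'.mem_iff.1 hy with h2 | h2 | h2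
        · exact h.ne' h2.symm
        · exact h.ne'' h2.symm
        · apply hne
          rw [← Finset.coe_inj, h.1, h'.1, h2]
    obtain ⟨q, -, -, hq⟩ := mem_cell_pair.1
      (convexHull_mono (Finset.coe_subset.2 hsub) (mem_cell_inter hT hT' hxT hxT'))
    have e1 : inner ℝ n (x - a) = ε * r * inner ℝ n (c - a) := by
      rw [show x - a = (1 / 2 + ε * (s - 1 / 2)) • (b - a) + (ε * r) • (c - a) by
        simp only [x]; abel, inner_add_right, inner_smul_right, inner_smul_right, n2]
      ring
    rw [hq, add_sub_cancel_left, inner_smul_right, n2] at e1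
    nlinarith
  · rw [h1, neg_one_smul] at hmn
    rw [hmn, add_neg_cancel]

theorem norm_outwardNormal {T e : Finset Pt} (hT : T ∈ M.triangles) (he : e ∈ edges T) :
    ‖outwardNormal T e‖ = 1 := by
  classical
  obtain ⟨a, b, c, h⟩ := exists_isTriangle hT
  obtain ⟨a, b, c, h, rfl⟩ := exists_isTriangle_of_mem_edges h he
  exact (outwardNormal_spec h).1

/-- No third triangle has the common edge of two triangles, since any two of the three would have
opposite normals there. -/
theorem filter_mem_edges_eq [DecidableEq (Finset Pt)] {𝒯 : Finset (Finset Pt)}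
    (h𝒯 : 𝒯 ⊆ M.triangles) {T T' e : Finset Pt} (hT : T ∈ 𝒯) (hT' : T' ∈ 𝒯) (hne : T ≠ T')
    (he : e ∈ edges T) (he' : e ∈ edges T') :
    𝒯.filter (fun S => e ∈ edges S) = {T, T'} := by
  ext S
  simp only [Finset.mem_filter, Finset.mem_insert, Finset.mem_singleton]
  constructor
  · rintro ⟨hS, heS⟩
    by_contra! hcon
    have h1 := outwardNormal_add_eq_zero (h𝒯 hT) (h𝒯 hT') hne he he'
    have h2 := outwardNormal_add_eq_zero (h𝒯 hS) (h𝒯 hT') hcon.2 heS he'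
    have h3 := outwardNormal_add_eq_zero (h𝒯 hS) (h𝒯 hT) hcon.1 heS he
    have h4 : (2 : ℝ) • outwardNormal T e = 0 := by
      rw [two_smul]
      have : outwardNormal T e + outwardNormal T e =
        (outwardNormal T e + outwardNormal T' e) + (outwardNormal S e + outwardNormal T e)
          - (outwardNormal S e + outwardNormal T' e) := by abel
      rw [this, h1, h2, h3]; simp
    have h5 : outwardNormal T e = 0 := (smul_eq_zero.1 h4).resolve_left two_ne_zero
    have h6 := norm_outwardNormal (h𝒯 hT) he
    rw [h5, norm_zero] at h6
    exact zero_ne_one h6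
  · rintro (rfl | rfl)
    exacts [⟨hT, he⟩, ⟨hT', he'⟩]

theorem isPreconnected_punctured_ball (x : Pt) (r : ℝ) :
    IsPreconnected (Metric.ball x r \ {x}) := by
  have hrank : 1 < Module.rank ℝ Pt :=
    Module.one_lt_rank_of_one_lt_finrank (by rw [finrank_euclideanSpace_fin]; norm_num)
  have h1 : IsPreconnected ((Metric.sphere (0 : Pt) 1) ×ˢ (Set.Ioo (0 : ℝ) r)) :=
    (isPreconnected_sphere hrank 0 1).prod isPreconnected_Ioo
  have h2 : Metric.ball x r \ {x} =
      (fun p : Pt × ℝ => x + p.2 • p.1) '' ((Metric.sphere (0 : Pt) 1) ×ˢ (Set.Ioo (0 : ℝ) r)) := by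
    ext y
    constructor
    · rintro ⟨hy, hne⟩
      have hn : 0 < ‖y - x‖ := norm_pos_iff.2 (sub_ne_zero.2 hne)
      refine ⟨(‖y - x‖⁻¹ • (y - x), ‖y - x‖), ⟨?_, hn, ?_⟩, ?_⟩
      · rw [mem_sphere_zero_iff_norm, norm_smul, norm_inv, norm_norm, inv_mul_cancel₀ hn.ne']
      · rwa [Metric.mem_ball, dist_eq_norm] at hy
      · simp only [smul_smul, mul_inv_cancel₀ hn.ne', one_smul]; abel
    · rintro ⟨⟨u, t⟩, ⟨hu, h0, hr⟩, rfl⟩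
      rw [mem_sphere_zero_iff_norm] at hu
      simp only at hu h0 hr ⊢
      refine ⟨?_, ?_⟩
      · rwa [Metric.mem_ball, dist_eq_norm, add_sub_cancel_left, norm_smul, hu, mul_one,
          Real.norm_of_nonneg h0.le]
      · intro h
        have h3 : t • u = 0 := by simpa using h
        rcases smul_eq_zero.1 h3 with h4 | h4
        · linarith
        · rw [h4, norm_zero] at hu; exact zero_ne_one hu
  rw [h2]
  exact h1.image _ (by fun_prop)

/-- A quantity that does not jump across interior edges is constant, because the domain is
connected. -/
theorem eq_of_eq_across_edges (c : Finset Pt → ℝ)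
    (h : ∀ T ∈ M.triangles, ∀ T' ∈ M.triangles, T ≠ T' → ∀ e ∈ edges T, e ∈ edges T' →
      ¬ cell e ⊆ frontier M.domain → c T = c T')
    {T₀ T₁ : Finset Pt} (hT₀ : T₀ ∈ M.triangles) (hT₁ : T₁ ∈ M.triangles) : c T₀ = c T₁ := by
  classical
  by_contra hne
  let A : Set Pt := ⋃ T ∈ M.triangles.filter (fun T => c T = c T₀), cell T
  let B : Set Pt := ⋃ T ∈ M.triangles.filter (fun T => c T ≠ c T₀), cell T
  have hA : IsClosed A := isClosed_biUnion_finset fun T _ => (isCompact_cell T).isClosed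
  have hB : IsClosed B := isClosed_biUnion_finset fun T _ => (isCompact_cell T).isClosed
  have memA : ∀ {x}, x ∈ A ↔ ∃ T ∈ M.triangles, c T = c T₀ ∧ x ∈ cell T := by
    intro x; simp [A, and_assoc]
  have memB : ∀ {x}, x ∈ B ↔ ∃ T ∈ M.triangles, c T ≠ c T₀ ∧ x ∈ cell T := by
    intro x; simp [B, and_assoc]
  have hcover : M.domain ⊆ A ∪ B := by
    intro x hx
    rw [domain_eq] at hx
    have := interior_subset hx
    simp only [Set.mem_iUnion, exists_prop] at this
    obtain ⟨T, hT, hxT⟩ := this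
    by_cases hc : c T = c T₀
    · exact Or.inl (memA.2 ⟨T, hT, hc, hxT⟩)
    · exact Or.inr (memB.2 ⟨T, hT, hc, hxT⟩)
  have hmeet : ∀ T ∈ M.triangles, (M.domain ∩ cell T).Nonempty := by
    intro T hT
    obtain ⟨a, b, d, htri⟩ := exists_isTriangle hT
    obtain ⟨x, hx⟩ := htri.interior_nonempty
    exact ⟨x, interior_cell_subset_domain hT hx, interior_subset hx⟩
  -- the two closed sets meet in vertices only
  have hvert : ∀ x ∈ M.domain, x ∈ A → x ∈ B → x ∈ M.triangles.biUnion id := by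
    intro x hx hxA hxB
    obtain ⟨T, hT, hc, hxT⟩ := memA.1 hxA
    obtain ⟨T', hT', hc', hxT'⟩ := memB.1 hxB
    have hTT : T ≠ T' := by rintro rfl; exact hc' hc
    have hxi := mem_cell_inter hT hT' hxT hxT'
    have h3 := ((M.triangle_iff T).1 (mem_triangles.1 hT)).2
    have h3' := ((M.triangle_iff T').1 (mem_triangles.1 hT')).2
    have hlt : (T ∩ T').card < 3 := by
      by_contra! hge
      have e1 := Finset.eq_of_subset_of_card_le (Finset.inter_subset_left (s₁ := T) (s₂ := T'))
        (by omega)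
      have e2 := Finset.eq_of_subset_of_card_le (Finset.inter_subset_right (s₁ := T) (s₂ := T'))
        (by omega)
      exact hTT (e1.symm.trans e2)
    have hpos : 0 < (T ∩ T').card := by
      rw [Finset.card_pos, ← Finset.coe_nonempty, ← convexHull_nonempty_iff (𝕜 := ℝ)]
      exact ⟨x, hxi⟩
    obtain h1 | h2 : (T ∩ T').card = 1 ∨ (T ∩ T').card = 2 := by omega
    · obtain ⟨v, hv⟩ := Finset.card_eq_one.1 h1
      rw [hv, cell, Finset.coe_singleton, convexHull_singleton, Set.mem_singleton_iff] at hxi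
      rw [Finset.mem_biUnion]
      refine ⟨T, hT, ?_⟩
      have : v ∈ T ∩ T' := by rw [hv]; simp
      rw [hxi]
      exact (Finset.mem_inter.1 this).1
    · exfalso
      refine hc' ((h T hT T' hT' hTT (T ∩ T')
        (Finset.mem_powersetCard.2 ⟨Finset.inter_subset_left, h2⟩)
        (Finset.mem_powersetCard.2 ⟨Finset.inter_subset_right, h2⟩) fun hf => ?_) ▸ hc)
      have := hf hxi
      rw [isOpen_domain.frontier_eq] at this
      exact this.2 hx
  have hconn : IsPreconnected M.domain := M.connected.2
  obtain ⟨x, hx, hxA, hxB⟩ := isPreconnected_closed_iff.1 hconn A B hA hB hcover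
    ((hmeet T₀ hT₀).mono fun y hy => ⟨hy.1, memA.2 ⟨T₀, hT₀, rfl, hy.2⟩⟩)
    ((hmeet T₁ hT₁).mono fun y hy => ⟨hy.1, memB.2 ⟨T₁, hT₁, Ne.symm hne, hy.2⟩⟩)
  -- a small punctured ball about the common vertex is connected
  have hfin : IsClosed (((M.triangles.biUnion id).erase x : Finset Pt) : Set Pt) :=
    (Finset.finite_toSet _).isClosed
  obtain ⟨r, hr, hball⟩ := Metric.isOpen_iff.1 (isOpen_domain.sdiff hfin) x ⟨hx, by simp⟩
  have hpt : ∀ T ∈ M.triangles, x ∈ cell T → ∃ y ∈ Metric.ball x r \ {x}, y ∈ cell T := by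
    intro T hT hxT
    obtain ⟨a, b, d, htri⟩ := exists_isTriangle hT
    obtain ⟨y, hyT, hyx⟩ : ∃ y ∈ cell T, y ≠ x := by
      by_cases hax : a = x
      · exact ⟨b, subset_convexHull ℝ _ (Finset.mem_coe.2 (htri.mem_iff.2 (by simp))),
          fun hb => htri.ne (hax.trans hb.symm)⟩
      · exact ⟨a, subset_convexHull ℝ _ (Finset.mem_coe.2 (htri.mem_iff.2 (by simp))), hax⟩
    have hn : 0 < ‖y - x‖ := norm_pos_iff.2 (sub_ne_zero.2 hyx)
    set ε := min 1 (r / (2 * ‖y - x‖)) with hε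
    have hε0 : 0 < ε := by positivity
    have hε1 : ε ≤ 1 := min_le_left _ _
    have hε2 : ε * ‖y - x‖ ≤ r / 2 := by
      calc ε * ‖y - x‖ ≤ r / (2 * ‖y - x‖) * ‖y - x‖ :=
            mul_le_mul_of_nonneg_right (min_le_right _ _) hn.le
        _ = r / 2 := by field_simp
    refine ⟨x + ε • (y - x), ⟨?_, ?_⟩,
      (convex_convexHull ℝ (T : Set Pt)).add_smul_sub_mem hxT hyT ⟨hε0.le, hε1⟩⟩
    · rw [Metric.mem_ball, dist_eq_norm, add_sub_cancel_left, norm_smul,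
        Real.norm_of_nonneg hε0.le]
      linarith
    · intro h0
      have h1 : ε • (y - x) = 0 := by simpa using h0
      rcases smul_eq_zero.1 h1 with h2 | h2
      · exact hε0.ne' h2
      · exact hyx (sub_eq_zero.1 h2)
  obtain ⟨T, hT, hc, hxT⟩ := memA.1 hxA
  obtain ⟨T', hT', hc', hxT'⟩ := memB.1 hxB
  obtain ⟨y, hy, hyT⟩ := hpt T hT hxT
  obtain ⟨y', hy', hyT'⟩ := hpt T' hT' hxT'
  obtain ⟨z, hz, hzA, hzB⟩ := isPreconnected_closed_iff.1 (isPreconnected_punctured_ball x r) A B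
    hA hB (fun z hz => hcover (hball hz.1).1) ⟨y, hy, memA.2 ⟨T, hT, hc, hyT⟩⟩
    ⟨y', hy', memB.2 ⟨T', hT', hc', hyT'⟩⟩
  exact (hball hz.1).2 (Finset.mem_coe.2 (Finset.mem_erase.2 ⟨hz.2, hvert z (hball hz.1).1 hzA hzB⟩))

end Mesh

/-! ### Bilinear forms and square linear systems -/

/-- A function of two vectors that is linear in each of them. -/
def IsBilin {V W : Type*} [AddCommGroup V] [Module ℝ V] [AddCommGroup W] [Module ℝ W]
    (f : V → W → ℝ) : Prop :=
  ∃ L : V →ₗ[ℝ] W →ₗ[ℝ] ℝ, ∀ v w, L v w = f v w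

namespace IsBilin

variable {V W : Type*} [AddCommGroup V] [Module ℝ V] [AddCommGroup W] [Module ℝ W]

theorem mul {f : V → ℝ} {g : W → ℝ} (hf : IsLinearMap ℝ f) (hg : IsLinearMap ℝ g) :
    IsBilin fun v w => f v * g w :=
  ⟨LinearMap.mk₂ ℝ (fun v w => f v * g w) (by intros; rw [hf.map_add, add_mul])
    (by intros; rw [hf.map_smul, smul_eq_mul, smul_eq_mul, mul_assoc])
    (by intros; rw [hg.map_add, mul_add])
    (by intros; rw [hg.map_smul, smul_eq_mul, smul_eq_mul, mul_left_comm]), fun _ _ => rfl⟩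

theorem add {f g : V → W → ℝ} (hf : IsBilin f) (hg : IsBilin g) :
    IsBilin fun v w => f v w + g v w := by
  obtain ⟨L, hL⟩ := hf
  obtain ⟨L', hL'⟩ := hg
  exact ⟨L + L', fun v w => by simp [hL, hL']⟩

theorem const_mul {f : V → W → ℝ} (hf : IsBilin f) (r : ℝ) : IsBilin fun v w => r * f v w := by
  obtain ⟨L, hL⟩ := hf
  exact ⟨r • L, fun v w => by simp [hL]⟩

theorem neg {f : V → W → ℝ} (hf : IsBilin f) : IsBilin fun v w => -f v w := by
  obtain ⟨L, hL⟩ := hf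
  exact ⟨-L, fun v w => by simp [hL]⟩

theorem sum {ι : Type*} (s : Finset ι) {f : ι → V → W → ℝ} (hf : ∀ i, IsBilin (f i)) :
    IsBilin fun v w => ∑ i ∈ s, f i v w := by
  choose L hL using hf
  exact ⟨∑ i ∈ s, L i, fun v w => by simp [LinearMap.sum_apply, hL]⟩

theorem integral {X : Type*} [MeasurableSpace X] {ν : Measure X} {f : X → V → W → ℝ}
    (hf : ∀ x, IsBilin (f x)) (hi : ∀ v w, Integrable (fun x => f x v w) ν) :
    IsBilin fun v w => ∫ x, f x v w ∂ν := by
  choose L hL using hf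
  refine ⟨LinearMap.mk₂ ℝ (fun v w => ∫ x, f x v w ∂ν) ?_ ?_ ?_ ?_, fun _ _ => rfl⟩
  · intro v v' w
    rw [← integral_add (hi _ _) (hi _ _)]
    simp only [← hL, map_add, LinearMap.add_apply]
  · intro r v w
    rw [smul_eq_mul, ← integral_const_mul]
    simp only [← hL, map_smul, LinearMap.smul_apply, smul_eq_mul]
  · intro v w w'
    rw [← integral_add (hi _ _) (hi _ _)]
    simp only [← hL, map_add]
  · intro r v w
    rw [smul_eq_mul, ← integral_const_mul]
    simp only [← hL, map_smul, smul_eq_mul]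

end IsBilin

theorem isLinearMap_integral {V X : Type*} [AddCommGroup V] [Module ℝ V] [MeasurableSpace X]
    {ν : Measure X} {f : X → V → ℝ} (hf : ∀ x, IsLinearMap ℝ (f x))
    (hi : ∀ v, Integrable (fun x => f x v) ν) : IsLinearMap ℝ fun v => ∫ x, f x v ∂ν := by
  constructor
  · intro v w
    rw [← integral_add (hi _) (hi _)]
    simp only [(hf _).map_add]
  · intro r v
    rw [smul_eq_mul, ← integral_const_mul]
    simp only [(hf _).map_smul, smul_eq_mul]

theorem isLinearMap_sum {V ι : Type*} [AddCommGroup V] [Module ℝ V] (s : Finset ι) {f : ι → V → ℝ}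
    (hf : ∀ i, IsLinearMap ℝ (f i)) : IsLinearMap ℝ fun v => ∑ i ∈ s, f i v := by
  constructor
  · intro v w; simp only [(hf _).map_add, Finset.sum_add_distrib]
  · intro r v; simp only [(hf _).map_smul, Finset.smul_sum]

theorem isLinearMap_add {V : Type*} [AddCommGroup V] [Module ℝ V] {f g : V → ℝ}
    (hf : IsLinearMap ℝ f) (hg : IsLinearMap ℝ g) : IsLinearMap ℝ fun v => f v + g v := by
  constructor
  · intro v w; rw [hf.map_add, hg.map_add]; ring
  · intro r v; rw [hf.map_smul, hg.map_smul, smul_add]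

/-- A square saddle point system has exactly one solution if its homogeneous version has only the
trivial one. -/
theorem existsUnique_saddle_point {V W : Type*} [AddCommGroup V] [Module ℝ V] [AddCommGroup W]
    [Module ℝ W] [FiniteDimensional ℝ V] [FiniteDimensional ℝ W] {a : V → V → ℝ} {b : V → W → ℝ}
    (ha : IsBilin a) (hb : IsBilin b) {F : V → ℝ} {G : W → ℝ} (hF : IsLinearMap ℝ F)
    (hG : IsLinearMap ℝ G)
    (h0 : ∀ u p, (∀ v, a u v + b v p = 0) → (∀ q, b u q = 0) → u = 0 ∧ p = 0) :
    ∃! up : V × W, (∀ v, a up.1 v + b v up.2 = F v) ∧ ∀ q, b up.1 q = G q := by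
  obtain ⟨A, hA⟩ := ha
  obtain ⟨B, hB⟩ := hb
  let S : V × W →ₗ[ℝ] Module.Dual ℝ V × Module.Dual ℝ W :=
    (A ∘ₗ LinearMap.fst ℝ V W + B.flip ∘ₗ LinearMap.snd ℝ V W).prod (B ∘ₗ LinearMap.fst ℝ V W)
  have hS1 : ∀ up v, (S up).1 v = a up.1 v + b v up.2 := by
    intro up v; simp [S, hA, hB]
  have hS2 : ∀ up q, (S up).2 q = b up.1 q := by
    intro up q; simp [S, hB]
  have hinj : Function.Injective S := by
    rw [← LinearMap.ker_eq_bot, LinearMap.ker_eq_bot']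
    intro up hup
    have h := h0 up.1 up.2 (fun v => by rw [← hS1, hup]; rfl) (fun q => by rw [← hS2, hup]; rfl)
    exact Prod.ext h.1 h.2
  have hdim : Module.finrank ℝ (V × W) =
      Module.finrank ℝ (Module.Dual ℝ V × Module.Dual ℝ W) := by
    rw [Module.finrank_prod, Module.finrank_prod, Subspace.dual_finrank_eq,
      Subspace.dual_finrank_eq]
  obtain ⟨up, hup⟩ := (LinearMap.injective_iff_surjective_of_finrank_eq_finrank hdim).1 hinj
    (hF.mk' F, hG.mk' G)
  refine ⟨up, ⟨fun v => ?_, fun q => ?_⟩, fun up' h' => hinj ?_⟩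
  · rw [← hS1, hup]; rfl
  · rw [← hS2, hup]; rfl
  · rw [hup]
    refine Prod.ext (LinearMap.ext fun v => ?_) (LinearMap.ext fun q => ?_)
    · rw [hS1, h'.1 v]; rfl
    · rw [hS2, h'.2 q]; rfl

/-! ### Finite dimension of the discrete spaces -/

instance (k : ℕ) (S : Set Pt) : FiniteDimensional ℝ (polyOn k S) := by
  unfold polyOn; infer_instance

instance (k : ℕ) (S : Set Pt) : FiniteDimensional ℝ (vecPolyOn k S) := by
  let f : vecPolyOn k S →ₗ[ℝ] (Fin 2 → polyOn k S) :=
    { toFun := fun v i => ⟨fun x => v.1 x i, v.2 i⟩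
      map_add' := fun _ _ => rfl
      map_smul' := fun _ _ => rfl }
  refine FiniteDimensional.of_injective f fun v w h => ?_
  ext x i
  exact congrFun (congrArg Subtype.val (congrFun h i)) x

section Spaces

variable (k : ℕ) (M : Mesh)

instance : FiniteDimensional ℝ (Vh0 k M) := by
  let f : Vh0 k M →ₗ[ℝ]
      ((∀ T : M.stokes, vecPolyOn k (cell T.1)) × (∀ e : edgesOf M.stokes, vecPolyOn k (cell e.1))) ×
      ((∀ T : M.darcy, vecPolyOn k (cell T.1)) × (∀ e : edgesOf M.darcy, vecPolyOn k (cell e.1))) :=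
    { toFun := fun v => ((fun T => ⟨v.1.1.1 T, v.2.1.1 T⟩, fun e => ⟨v.1.1.2 e, v.2.1.2 e⟩),
        (fun T => ⟨v.1.2.1 T, v.2.2.1.1.1 T⟩, fun e => ⟨v.1.2.2 e, v.2.2.1.1.2 e⟩))
      map_add' := fun _ _ => rfl
      map_smul' := fun _ _ => rfl }
  refine FiniteDimensional.of_injective f fun v w h => Subtype.ext ?_
  have h1 := congrArg Prod.fst h
  have h2 := congrArg Prod.snd h
  refine Prod.ext (Prod.ext ?_ ?_) (Prod.ext ?_ ?_) <;> funext T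
  · exact congrArg Subtype.val (congrFun (congrArg Prod.fst h1) T)
  · exact congrArg Subtype.val (congrFun (congrArg Prod.snd h1) T)
  · exact congrArg Subtype.val (congrFun (congrArg Prod.fst h2) T)
  · exact congrArg Subtype.val (congrFun (congrArg Prod.snd h2) T)

instance : FiniteDimensional ℝ (Wh k M) := by
  let f : Wh k M →ₗ[ℝ]
      (∀ T : M.stokes, polyOn k (cell T.1)) × (∀ T : M.darcy, polyOn k (cell T.1)) :=
    { toFun := fun q => (fun T => ⟨q.1.1 T, q.2.1 T⟩, fun T => ⟨q.1.2 T, q.2.2.1 T⟩)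
      map_add' := fun _ _ => rfl
      map_smul' := fun _ _ => rfl }
  refine FiniteDimensional.of_injective f fun v w h => Subtype.ext ?_
  refine Prod.ext ?_ ?_ <;> funext T
  · exact congrArg Subtype.val (congrFun (congrArg Prod.fst h) T)
  · exact congrArg Subtype.val (congrFun (congrArg Prod.snd h) T)

end Spaces

/-! ### Bounds for the permeability -/

theorem measurable_inv_entry {κ : Pt → Matrix (Fin 2) (Fin 2) ℝ}
    (h : ∀ i j, Measurable fun x => κ x i j) (i j : Fin 2) : Measurable fun x => (κ x)⁻¹ i j := by
  have hd : Measurable fun x => (κ x).det := by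
    simp only [Matrix.det_fin_two]
    exact ((h 0 0).mul (h 1 1)).sub ((h 0 1).mul (h 1 0))
  simp only [Matrix.inv_def, Matrix.smul_apply, smul_eq_mul, Ring.inverse_eq_inv',
    Matrix.adjugate_fin_two]
  refine hd.inv.mul ?_
  fin_cases i <;> fin_cases j
  exacts [h 1 1, (h 0 1).neg, (h 1 0).neg, h 0 0]

theorem measurable_invSqrt_entry {κ : Pt → Matrix (Fin 2) (Fin 2) ℝ}
    (h : ∀ i j, Measurable fun x => κ x i j) (i j : Fin 2) :
    Measurable fun x => invSqrt (κ x) i j := by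
  have hB := measurable_inv_entry h
  have hd : Measurable fun x => (κ x)⁻¹.det := by
    simp only [Matrix.det_fin_two]
    exact ((hB 0 0).mul (hB 1 1)).sub ((hB 0 1).mul (hB 1 0))
  have ht : Measurable fun x => (κ x)⁻¹.trace := by
    simp only [Matrix.trace_fin_two]
    exact (hB 0 0).add (hB 1 1)
  simp only [invSqrt, Matrix.smul_apply, Matrix.add_apply, smul_eq_mul]
  exact (ht.add (hd.sqrt.const_mul 2)).sqrt.inv.mul ((hB i j).add (hd.sqrt.mul_const _))

theorem IsPermeability.posDef {M : Mesh} {κ : Pt → Matrix (Fin 2) (Fin 2) ℝ}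
    (hκ : IsPermeability M κ) {T : Finset Pt} (hT : T ∈ M.darcy) {x : Pt} (hx : x ∈ cell T) :
    (κ x).PosDef := by
  obtain ⟨c, C, hc, h⟩ := hκ.elliptic
  refine Matrix.PosDef.of_dotProduct_mulVec_pos ?_ fun ξ hξ => ?_
  · rw [Matrix.IsHermitian, Matrix.conjTranspose_eq_transpose_of_trivial]
    exact hκ.symm T hT x hx
  · have h1 := (h T hT x hx ξ).1
    rw [star_trivial]
    have h2 : 0 < ξ ⬝ᵥ ξ := by
      have := Matrix.dotProduct_star_self_pos_iff.2 hξ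
      rwa [star_trivial] at this
    nlinarith

/-- A lower bound for the quadratic form of a matrix bounds the entries of its inverse. -/
theorem abs_inv_entry_le {A : Matrix (Fin 2) (Fin 2) ℝ} (hA : A.PosDef) {c : ℝ} (hc : 0 < c)
    (h : ∀ ξ : Fin 2 → ℝ, c * (ξ ⬝ᵥ ξ) ≤ ξ ⬝ᵥ A.mulVec ξ) (i j : Fin 2) : |A⁻¹ i j| ≤ 1 / c := by
  -- the columns `η` of the inverse satisfy `c |η|² ≤ η ⬝ A η = η_j`
  have hη := h (A⁻¹.col j)
  have hAη : A.mulVec (A⁻¹.col j) = Pi.single j 1 := by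
    rw [← Matrix.mulVec_single_one, Matrix.mulVec_mulVec,
      Matrix.mul_nonsing_inv _ ((Matrix.isUnit_iff_isUnit_det _).1 hA.isUnit), Matrix.one_mulVec]
  rw [hAη, dotProduct_single, mul_one] at hη
  have h2 : (A⁻¹.col j) ⬝ᵥ (A⁻¹.col j) = A⁻¹ 0 j ^ 2 + A⁻¹ 1 j ^ 2 := by
    simp [dotProduct, Fin.sum_univ_two]; ring
  rw [h2, Matrix.col_apply] at hη
  have hj : c * A⁻¹ j j ^ 2 ≤ A⁻¹ j j := by
    fin_cases j <;> simp at hη ⊢ <;> nlinarith [sq_nonneg (A⁻¹ 0 0), sq_nonneg (A⁻¹ 1 0),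
      sq_nonneg (A⁻¹ 0 1), sq_nonneg (A⁻¹ 1 1)]
  have hij : c * A⁻¹ i j ^ 2 ≤ A⁻¹ j j := by
    fin_cases i <;> fin_cases j <;> simp at hη ⊢ <;>
      nlinarith [sq_nonneg (A⁻¹ 0 0), sq_nonneg (A⁻¹ 1 0),
      sq_nonneg (A⁻¹ 0 1), sq_nonneg (A⁻¹ 1 1)]
  have hjj : A⁻¹ j j ≤ 1 / c := by
    rw [le_div_iff₀ hc]
    by_contra! hcon
    nlinarith [hA.inv.diag_pos (i := j)]
  refine abs_le_of_sq_le_sq ?_ (by positivity)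
  have : c * A⁻¹ i j ^ 2 ≤ c * (1 / c) ^ 2 := by
    calc _ ≤ 1 / c := hij.trans hjj
      _ = _ := by field_simp
  exact le_of_mul_le_mul_left this hc

theorem abs_invSqrt_entry_le {A : Matrix (Fin 2) (Fin 2) ℝ} (hA : A.PosDef) {K : ℝ}
    (h : ∀ i j, |A⁻¹ i j| ≤ K) (i j : Fin 2) : |invSqrt A i j| ≤ 1 + K := by
  obtain ⟨hS, hS2⟩ := invSqrt_spec hA
  have hsymm : ∀ i j, invSqrt A i j = invSqrt A j i := fun i j => by
    simpa using (hS.isHermitian.apply i j).symm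
  have h1 : A⁻¹ i i = invSqrt A i 0 ^ 2 + invSqrt A i 1 ^ 2 := by
    rw [← hS2, Matrix.mul_apply, Fin.sum_univ_two, hsymm 0 i, hsymm 1 i]; ring
  have h2 : invSqrt A i j ^ 2 ≤ K := by
    refine le_trans ?_ ((le_abs_self _).trans (h i i))
    rw [h1]
    fin_cases j <;> simp <;> positivity
  rw [← sq_abs] at h2
  nlinarith [sq_nonneg (|invSqrt A i j| - 1)]

theorem IsPermeability.exists_bound {M : Mesh} {κ : Pt → Matrix (Fin 2) (Fin 2) ℝ}
    (hκ : IsPermeability M κ) : ∃ K : ℝ, ∀ T ∈ M.darcy, ∀ x ∈ cell T, ∀ i j,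
      |(κ x)⁻¹ i j| ≤ K ∧ |invSqrt (κ x) i j| ≤ K := by
  obtain ⟨c, C, hc, h⟩ := hκ.elliptic
  refine ⟨1 + 1 / c, fun T hT x hx i j => ?_⟩
  have hA := hκ.posDef hT hx
  have h1 := abs_inv_entry_le hA hc fun ξ => (h T hT x hx ξ).1
  exact ⟨(h1 i j).trans (by linarith), abs_invSqrt_entry_le hA h1 i j⟩

theorem integrable_mul_of_bounded {X : Type*} [TopologicalSpace X] [CompactSpace X]
    [MeasurableSpace X] [OpensMeasurableSpace X] {ν : Measure X} [IsFiniteMeasure ν] {f g : X → ℝ}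
    {K : ℝ} (hf : Measurable f) (hK : ∀ x, |f x| ≤ K) (hg : Continuous g) :
    Integrable (fun x => f x * g x) ν :=
  (integrable_of_continuous hg).bdd_mul hf.aestronglyMeasurable (.of_forall hK)

/-! ### Linearity of the forms and of the loads -/

section Forms

variable {k : ℕ} {M : Mesh}

/-- Restriction of the Stokes component to a triangle, as a linear map. -/
def locStokes (T : M.stokes) : Vh0 k M →ₗ[ℝ] localV k T.1 where
  toFun v := loc (stokesPart v) T
  map_add' _ _ := rfl
  map_smul' _ _ := rfl

/-- Restriction of the Darcy component to a triangle, as a linear map. -/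
def locDarcy (T : M.darcy) : Vh0 k M →ₗ[ℝ] localV k T.1 where
  toFun v := loc (darcyPart v) T
  map_add' _ _ := rfl
  map_smul' _ _ := rfl

theorem continuous_jump {T : Finset Pt} (v : localV k T) (e : edges T) (i : Fin 2) :
    Continuous fun x => jump v.1 e x i := by
  have h1 : Continuous fun x => onEdge e.2 v.1.1 x i :=
    (continuous_localV_fst v i).comp (by fun_prop)
  exact h1.sub (continuous_localV_snd v e i)

theorem isLinearMap_jump {V : Type*} [AddCommGroup V] [Module ℝ V] {T : Finset Pt}
    (L : V →ₗ[ℝ] localV k T) (e : edges T) (x : cell (e : Finset Pt)) (i : Fin 2) :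
    IsLinearMap ℝ fun v => jump (L v).1 e x i := by
  constructor
  · intro v w; simp [jump, onEdge]; ring
  · intro r v; simp [jump, onEdge]; ring

theorem continuous_inner_of_coord {X : Type*} [TopologicalSpace X] {f g : X → Pt}
    (hf : ∀ i, Continuous fun x => f x i) (hg : ∀ i, Continuous fun x => g x i) :
    Continuous fun x => (inner ℝ (f x) (g x) : ℝ) := by
  simp only [inner_eq]
  exact ((hf 0).mul (hg 0)).add ((hf 1).mul (hg 1))

theorem isBilin_inner {V W : Type*} [AddCommGroup V] [Module ℝ V] [AddCommGroup W] [Module ℝ W]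
    {f : V → Pt} {g : W → Pt} (hf : ∀ i, IsLinearMap ℝ fun v => f v i)
    (hg : ∀ i, IsLinearMap ℝ fun w => g w i) : IsBilin fun v w => (inner ℝ (f v) (g w) : ℝ) := by
  simp only [inner_eq]
  exact .add (.mul (hf 0) (hg 0)) (.mul (hf 1) (hg 1))

theorem isLinearMap_inner_const {V : Type*} [AddCommGroup V] [Module ℝ V] {f : V → Pt}
    (hf : ∀ i, IsLinearMap ℝ fun v => f v i) (n : Pt) :
    IsLinearMap ℝ fun v => (inner ℝ (f v) n : ℝ) := by
  simp only [inner_eq]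
  constructor
  · intro v w; rw [(hf 0).map_add, (hf 1).map_add]; ring
  · intro r v; rw [(hf 0).map_smul, (hf 1).map_smul]; simp only [smul_eq_mul]; ring

theorem integrable_inner_jump {T : Finset Pt} (v w : localV k T) (e : edges T) :
    Integrable (fun x => (inner ℝ (jump v.1 e x) (jump w.1 e x) : ℝ)) (arcLength e) :=
  integrable_of_continuous (continuous_inner_of_coord (continuous_jump v e) (continuous_jump w e))

theorem continuous_inner_jump_const {T : Finset Pt} (v : localV k T) (e : edges T) (n : Pt) :
    Continuous fun x => (inner ℝ (jump v.1 e x) n : ℝ) :=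
  continuous_inner_of_coord (g := fun _ => n) (continuous_jump v e) fun _ => continuous_const

theorem integrable_normal_jump {T : Finset Pt} (v w : localV k T) (e : edges T) (n : Pt) :
    Integrable (fun x => (inner ℝ (jump v.1 e x) n * inner ℝ (jump w.1 e x) n : ℝ))
      (arcLength e) :=
  integrable_of_continuous
    ((continuous_inner_jump_const v e n).mul (continuous_inner_jump_const w e n))

theorem isBilin_formS : IsBilin (formS (k := k) (M := M)) := by
  unfold formS
  refine .add (.sum _ fun T => .const_mul (.sum _ fun e => .integral (fun x => ?_) fun v w => ?_) _)
    (.sum _ fun T => .const_mul (.sum _ fun e => .integral (fun x => ?_) fun v w => ?_) _)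
  · exact isBilin_inner (isLinearMap_jump (locStokes T) e x) (isLinearMap_jump (locStokes T) e x)
  · exact integrable_inner_jump (loc (stokesPart v) T) (loc (stokesPart w) T) e
  · exact .mul (isLinearMap_inner_const (isLinearMap_jump (locDarcy T) e x) _)
      (isLinearMap_inner_const (isLinearMap_jump (locDarcy T) e x) _)
  · exact integrable_normal_jump (loc (darcyPart v) T) (loc (darcyPart w) T) e _

theorem isLinearMap_weakStrain (T : M.stokes) (x : cell (T : Finset Pt)) (i j : Fin 2) :
    IsLinearMap ℝ fun v : Vh0 k M => weakStrain k T (loc (stokesPart v) T) x i j := by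
  constructor
  · intro v w
    have h : loc (stokesPart (v + w)) T = loc (stokesPart v) T + loc (stokesPart w) T := rfl
    simp [weakStrain, h]; ring
  · intro r v
    have h : loc (stokesPart (r • v)) T = r • loc (stokesPart v) T := rfl
    simp [weakStrain, h]; ring

theorem continuous_weakStrain {T : Finset Pt} (v : localV k T) (i j : Fin 2) :
    Continuous fun x => weakStrain k T v x i j := by
  have h := continuous_matPolyOn (weakGradient k T v)
  simp only [weakStrain, Matrix.smul_apply, Matrix.add_apply, Matrix.transpose_apply, smul_eq_mul]
  exact continuous_const.mul ((h i j).add (h j i))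

theorem continuous_darcy_fst (v : Vh0 k M) (T : M.darcy) (i : Fin 2) :
    Continuous fun x => v.1.2.1 T x i :=
  continuous_of_mem_vecPolyOn (v.2.2.1.1.1 T) i

theorem integrable_permeability_term {μ : ℝ} {κ : Pt → Matrix (Fin 2) (Fin 2) ℝ}
    (hκ : IsPermeability M κ) (v w : Vh0 k M) (T : M.darcy) :
    Integrable (fun x : cell (T : Finset Pt) =>
      μ * ((κ x)⁻¹.mulVec (v.1.2.1 T x).ofLp ⬝ᵥ (w.1.2.1 T x).ofLp)) (area T) := by
  obtain ⟨K, hK⟩ := hκ.exists_bound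
  simp only [Matrix.mulVec, dotProduct, Finset.sum_mul]
  refine .const_mul (integrable_finsetSum _ fun i _ => integrable_finsetSum _ fun j _ => ?_) _
  simp only [mul_assoc]
  exact integrable_mul_of_bounded
    ((measurable_inv_entry hκ.measurable i j).comp measurable_subtype_coe)
    (fun x => (hK T T.2 x x.2 i j).1)
    ((continuous_darcy_fst v T j).mul (continuous_darcy_fst w T i))

theorem isBilin_formA {μ : ℝ} {κ : Pt → Matrix (Fin 2) (Fin 2) ℝ} (hκ : IsPermeability M κ) :
    IsBilin (formA (k := k) (M := M) μ κ) := by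
  unfold formA
  refine .add (.sum _ fun T => .integral (fun x => ?_) fun v w => ?_)
    (.sum _ fun T => .integral (fun x => .const_mul ?_ _) fun v w =>
      integrable_permeability_term hκ v w T)
  · refine .sum _ fun i => .sum _ fun j => ?_
    simp only [mul_assoc]
    exact .const_mul (.const_mul (.mul (isLinearMap_weakStrain T x i j)
      (isLinearMap_weakStrain T x i j)) _) _
  · have hv := continuous_weakStrain (loc (stokesPart v) T)
    have hw := continuous_weakStrain (loc (stokesPart w) T)
    exact integrable_of_continuous (by fun_prop)
  · simp only [Matrix.mulVec, dotProduct, Finset.sum_mul, mul_assoc]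
    refine .sum _ fun i => .sum _ fun j => .const_mul (.mul ?_ ?_) _
    · exact ⟨fun _ _ => rfl, fun _ _ => rfl⟩
    · exact ⟨fun _ _ => rfl, fun _ _ => rfl⟩

theorem continuous_interface (v : Vh0 k M) (e : M.interfaceEdges) (i : Fin 2) :
    Continuous fun x => v.1.1.2 ⟨e, M.stokes_of_interface e⟩ x i :=
  continuous_of_mem_vecPolyOn (v.2.1.2 ⟨e, M.stokes_of_interface e⟩) i

theorem exists_darcy_of_interface (e : M.interfaceEdges) :
    ∃ T ∈ M.darcy, (e : Finset Pt) ∈ edges T := by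
  classical
  exact Finset.mem_biUnion.1 (M.darcy_of_interface e)

theorem continuous_inner_interface (v : Vh0 k M) (e : M.interfaceEdges) (n : Pt) :
    Continuous fun x => (inner ℝ (v.1.1.2 ⟨e, M.stokes_of_interface e⟩ x) n : ℝ) :=
  continuous_inner_of_coord (g := fun _ => n) (continuous_interface v e) fun _ => continuous_const

theorem integrable_invSqrt_mul {κ : Pt → Matrix (Fin 2) (Fin 2) ℝ} (hκ : IsPermeability M κ)
    (e : M.interfaceEdges) (t : Fin 2 → ℝ) {g : cell (e : Finset Pt) → ℝ} (hg : Continuous g) :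
    Integrable (fun x : cell (e : Finset Pt) => ((invSqrt (κ x)).mulVec t ⬝ᵥ t) * g x)
      (arcLength e) := by
  obtain ⟨K, hK⟩ := hκ.exists_bound
  obtain ⟨T, hT, he⟩ := exists_darcy_of_interface e
  simp only [Matrix.mulVec, dotProduct, Finset.sum_mul]
  refine integrable_finsetSum _ fun i _ => integrable_finsetSum _ fun j _ => ?_
  simp only [mul_assoc]
  exact integrable_mul_of_bounded (K := K)
    ((measurable_invSqrt_entry hκ.measurable i j).comp measurable_subtype_coe)
    (fun x => (hK T hT x
      (convexHull_mono (Finset.coe_subset.2 (subset_of_mem_edges he)) x.2) i j).2)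
    (continuous_const.mul (continuous_const.mul hg))

theorem integrable_interface_term {μ α : ℝ} {κ : Pt → Matrix (Fin 2) (Fin 2) ℝ}
    (hκ : IsPermeability M κ) (v w : Vh0 k M) (e : M.interfaceEdges) :
    Integrable (fun x : cell (e : Finset Pt) =>
      α * μ * ((invSqrt (κ x)).mulVec (edgeTangent e).ofLp ⬝ᵥ (edgeTangent e).ofLp) *
      inner ℝ (v.1.1.2 ⟨e, M.stokes_of_interface e⟩ x) (edgeTangent e) *
      inner ℝ (w.1.1.2 ⟨e, M.stokes_of_interface e⟩ x) (edgeTangent e)) (arcLength e) := by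
  have h := (integrable_invSqrt_mul hκ e (edgeTangent e).ofLp
    ((continuous_inner_interface v e (edgeTangent e)).mul
      (continuous_inner_interface w e (edgeTangent e)))).const_mul (α * μ)
  refine h.congr (.of_forall fun x => ?_)
  simp only [Pi.mul_apply, mul_assoc]

theorem isBilin_formBJS {μ α : ℝ} {κ : Pt → Matrix (Fin 2) (Fin 2) ℝ} (hκ : IsPermeability M κ) :
    IsBilin (formBJS (k := k) (M := M) μ α κ) := by
  unfold formBJS
  refine .sum _ fun e => .integral (fun x => ?_) fun v w => integrable_interface_term hκ v w e
  simp only [mul_assoc _ (inner ℝ _ _) (inner ℝ _ _)]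
  refine .const_mul (.mul ?_ ?_) _ <;>
  · constructor
    · intro v w; simp [inner_add_left]
    · intro r v; simp [inner_smul_left]

theorem isBilin_formAs {μ α : ℝ} {κ : Pt → Matrix (Fin 2) (Fin 2) ℝ} (hκ : IsPermeability M κ) :
    IsBilin (formAs (k := k) (M := M) μ α κ) :=
  .add (.add (isBilin_formA hκ) (isBilin_formS.const_mul μ)) (isBilin_formBJS hκ)

theorem isBilin_formB : IsBilin (formB (k := k) (M := M)) := by
  unfold formB
  refine .neg (.add (.sum _ fun T => .integral (fun x => .mul ?_ ?_) fun v q => ?_)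
    (.sum _ fun T => .integral (fun x => .mul ?_ ?_) fun v q => ?_))
  · constructor
    · intro v w
      have h : loc (stokesPart (v + w)) T = loc (stokesPart v) T + loc (stokesPart w) T := rfl
      simp [h]
    · intro r v
      have h : loc (stokesPart (r • v)) T = r • loc (stokesPart v) T := rfl
      simp [h]
  · exact ⟨fun _ _ => rfl, fun _ _ => rfl⟩
  · exact integrable_of_continuous
      ((continuous_of_mem_polyOn (weakDivergence k T (loc (stokesPart v) T)).2).mul
        (continuous_of_mem_polyOn (q.2.1 T)))
  · constructor
    · intro v w
      have h : loc (darcyPart (v + w)) T = loc (darcyPart v) T + loc (darcyPart w) T := rfl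
      simp [h]
    · intro r v
      have h : loc (darcyPart (r • v)) T = r • loc (darcyPart v) T := rfl
      simp [h]
  · exact ⟨fun _ _ => rfl, fun _ _ => rfl⟩
  · exact integrable_of_continuous
      ((continuous_of_mem_polyOn (weakDivergence k T (loc (darcyPart v) T)).2).mul
        (continuous_of_mem_polyOn (q.2.2.1 T)))

/-- Square integrable functions on a region are integrable on the triangles of the region. -/
theorem integrable_area_of_memLp {E : Type*} [NormedAddCommGroup E] {f : Pt → E}
    {𝒯 : Finset (Finset Pt)} (hf : MemLp f 2 (volume.restrict (interior (⋃ T ∈ 𝒯, cell T))))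
    {T : Finset Pt} (hT : T ∈ 𝒯) : Integrable (fun x : cell T => f x) (area T) := by
  have hsub : interior (cell T) ⊆ interior (⋃ T ∈ 𝒯, cell T) :=
    interior_mono (Set.subset_biUnion_of_mem (u := fun T : Finset Pt => cell T) hT)
  have hfin : IsFiniteMeasure (volume.restrict (interior (cell T))) :=
    isFiniteMeasure_restrict.2
      ((measure_mono interior_subset).trans_lt (isCompact_cell T).measure_lt_top).ne
  have h1 : IntegrableOn f (interior (cell T)) volume :=
    (hf.mono_measure (Measure.restrict_mono hsub le_rfl)).integrable one_le_two
  have h2 : IntegrableOn f (cell T) volume := by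
    refine h1.congr_set_ae (ae_eq_set.2 ⟨?_, ?_⟩)
    · refine measure_mono_null ?_ (Convex.addHaar_frontier volume (convex_convexHull ℝ (T : Set Pt)))
      exact Set.sdiff_subset_sdiff_left subset_closure
    · rw [Set.sdiff_eq_empty.2 interior_subset, measure_empty]
  exact (MeasurableEmbedding.subtype_coe (measurableSet_cell T)).integrableOn_range_iff_comap.1
    (by simpa using h2)

theorem continuous_of_mem_rtOn {S : Set Pt} {r : S → Pt} (hr : r ∈ rtOn k S) : Continuous r := by
  obtain ⟨p, hp, _, ⟨q, hq, rfl⟩, rfl⟩ := Submodule.mem_sup.1 hr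
  have h1 : Continuous p := by
    have : p = fun x => WithLp.toLp 2 (fun i => p x i) := rfl
    rw [this]
    exact (PiLp.continuous_toLp 2 _).comp (continuous_pi fun i => continuous_of_mem_vecPolyOn hp i)
  exact h1.add ((continuous_of_mem_polyOn hq).smul continuous_subtype_val)

theorem integrable_inner_of_continuous {T : Finset Pt} {f r : cell T → Pt}
    (hf : Integrable f (area T)) (hr : Continuous r) :
    Integrable (fun x => inner ℝ (f x) (r x)) (area T) := by
  obtain ⟨C, hC⟩ := isCompact_univ.exists_bound_of_continuousOn hr.continuousOn
  refine (hf.norm.mul_const C).mono' (hf.aestronglyMeasurable.inner hr.aestronglyMeasurable)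
    (.of_forall fun x => ?_)
  exact (norm_inner_le_norm _ _).trans
    (mul_le_mul_of_nonneg_left (hC x (Set.mem_univ x)) (norm_nonneg _))

theorem isLinearMap_loadF {f_s f_d : Pt → Pt} (hfs : MemLp f_s 2 (volume.restrict M.stokesDomain))
    (hfd : MemLp f_d 2 (volume.restrict M.darcyDomain)) :
    IsLinearMap ℝ (loadF (k := k) (M := M) f_s f_d) := by
  unfold loadF
  refine isLinearMap_add (isLinearMap_sum _ fun T => isLinearMap_integral (fun x => ?_) fun v => ?_)
    (isLinearMap_sum _ fun T => isLinearMap_integral (fun x => ?_) fun v => ?_)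
  · constructor
    · intro v w
      have h : loc (stokesPart (v + w)) T = loc (stokesPart v) T + loc (stokesPart w) T := rfl
      simp [h, inner_add_right]
    · intro r v
      have h : loc (stokesPart (r • v)) T = r • loc (stokesPart v) T := rfl
      simp [h, inner_smul_right]
  · exact integrable_inner_of_continuous (integrable_area_of_memLp hfs T.2)
      (continuous_of_mem_rtOn (reconstruction k T (loc (stokesPart v) T)).2)
  · constructor
    · intro v w
      have h : loc (darcyPart (v + w)) T = loc (darcyPart v) T + loc (darcyPart w) T := rfl
      simp [h, inner_add_right]
    · intro r v
      have h : loc (darcyPart (r • v)) T = r • loc (darcyPart v) T := rfl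
      simp [h, inner_smul_right]
  · exact integrable_inner_of_continuous (integrable_area_of_memLp hfd T.2)
      (continuous_of_mem_rtOn (reconstruction k T (loc (darcyPart v) T)).2)

theorem integrable_mul_of_continuous {T : Finset Pt} {f r : cell T → ℝ}
    (hf : Integrable f (area T)) (hr : Continuous r) :
    Integrable (fun x => f x * r x) (area T) := by
  obtain ⟨C, hC⟩ := isCompact_univ.exists_bound_of_continuousOn hr.continuousOn
  exact hf.mul_bdd hr.aestronglyMeasurable (.of_forall fun x => hC x (Set.mem_univ x))

theorem isLinearMap_loadG {g_s g_d : Pt → ℝ} (hgs : MemLp g_s 2 (volume.restrict M.stokesDomain))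
    (hgd : MemLp g_d 2 (volume.restrict M.darcyDomain)) :
    IsLinearMap ℝ (loadG (k := k) (M := M) g_s g_d) := by
  unfold loadG
  refine isLinearMap_add (isLinearMap_sum _ fun T => isLinearMap_integral (fun x => ?_) fun q => ?_)
    (isLinearMap_sum _ fun T => isLinearMap_integral (fun x => ?_) fun q => ?_)
  · exact ⟨fun p q => by simp [mul_add], fun r q => by simp [mul_left_comm]⟩
  · exact integrable_mul_of_continuous (integrable_area_of_memLp hgs T.2)
      (continuous_of_mem_polyOn (q.2.1 T))
  · exact ⟨fun p q => by simp [mul_add], fun r q => by simp [mul_left_comm]⟩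
  · exact integrable_mul_of_continuous (integrable_area_of_memLp hgd T.2)
      (continuous_of_mem_polyOn (q.2.2.1 T))

end Forms

/-! ### Weak functions without jumps and without strain -/

theorem totalDegree_pderiv_le (i : Fin 2) (p : Poly) :
    (MvPolynomial.pderiv i p).totalDegree ≤ p.totalDegree - 1 := by
  refine Finset.sup_le fun m hm => ?_
  rw [MvPolynomial.mem_support_iff, MvPolynomial.coeff_pderiv] at hm
  have h1 : m + Finsupp.single i 1 ∈ p.support :=
    MvPolynomial.mem_support_iff.2 (left_ne_zero_of_mul hm)
  have h2 := MvPolynomial.le_totalDegree h1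
  rw [Finsupp.sum_add_index' (by simp) (by simp), Finsupp.sum_single_index rfl] at h2
  omega

theorem eq_of_hasDerivAt_zero {f f' : ℝ → ℝ} (hf : ∀ t, HasDerivAt f (f' t) t)
    (h0 : ∀ t ∈ Set.Ioo (0 : ℝ) 1, f' t = 0) : f 1 = f 0 := by
  obtain ⟨t, ht, h⟩ := exists_hasDerivAt_eq_slope f f' zero_lt_one
    (fun t _ => (hf t).continuousAt.continuousWithinAt) (fun t _ => hf t)
  rw [h0 t ht] at h
  linarith [h, show (f 1 - f 0) / (1 - 0) = f 1 - f 0 by ring]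

theorem segment_mem_cell {T : Finset Pt} {x y : Pt} (hx : x ∈ cell T) (hy : y ∈ cell T) {t : ℝ}
    (ht : t ∈ Set.Ioo (0 : ℝ) 1) : x + t • (y - x) ∈ cell T :=
  (convex_convexHull ℝ (T : Set Pt)).add_smul_sub_mem hx hy ⟨ht.1.le, ht.2.le⟩

theorem ev_eq_of_pderiv_eq_zero {T : Finset Pt} {p : Poly}
    (hp : ∀ i, ∀ x ∈ cell T, ev (MvPolynomial.pderiv i p) x = 0) {x y : Pt} (hx : x ∈ cell T)
    (hy : y ∈ cell T) : ev p y = ev p x := by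
  have h := eq_of_hasDerivAt_zero (fun t => hasDerivAt_ev_line p x (y - x) t) fun t ht => by
    rw [hp 0 _ (segment_mem_cell hx hy ht), hp 1 _ (segment_mem_cell hx hy ht)]; ring
  simpa using h

/-- For a field with skew gradient, `⟪v x, y - x⟫` is constant along the segment from `x` to `y`. -/
theorem inner_eq_of_skew {T : Finset Pt} {P : Fin 2 → Poly}
    (hP : ∀ i j, ∀ x ∈ cell T, ev (MvPolynomial.pderiv j (P i)) x +
      ev (MvPolynomial.pderiv i (P j)) x = 0) {x y : Pt} (hx : x ∈ cell T) (hy : y ∈ cell T) :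
    ev (P 0) y * (y - x) 0 + ev (P 1) y * (y - x) 1 =
      ev (P 0) x * (y - x) 0 + ev (P 1) x * (y - x) 1 := by
  have h := eq_of_hasDerivAt_zero (fun t =>
    ((hasDerivAt_ev_line (P 0) x (y - x) t).mul_const ((y - x) 0)).add
      ((hasDerivAt_ev_line (P 1) x (y - x) t).mul_const ((y - x) 1))) fun t ht => by
    have hm := segment_mem_cell hx hy ht
    have h00 := hP 0 0 _ hm
    have h11 := hP 1 1 _ hm
    have h01 := hP 0 1 _ hm
    linear_combination (y - x) 0 ^ 2 / 2 * h00 + (y - x) 1 ^ 2 / 2 * h11 +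
      (y - x) 0 * (y - x) 1 * h01
  simpa using h

/-- A rigid motion that vanishes on an edge of a triangle vanishes on the triangle. -/
theorem eq_zero_of_skew_of_edge [DecidableEq Pt] {T : Finset Pt} {a b c : Pt}
    (h : IsTriangle T a b c) {P : Fin 2 → Poly}
    (hP : ∀ i j, ∀ x ∈ cell T, ev (MvPolynomial.pderiv j (P i)) x +
      ev (MvPolynomial.pderiv i (P j)) x = 0)
    (h0 : ∀ i, ∀ x ∈ cell {a, b}, ev (P i) x = 0) (i : Fin 2) {x : Pt} (hx : x ∈ cell T) :
    ev (P i) x = 0 := by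
  have ha : a ∈ cell {a, b} := subset_convexHull ℝ _ (by simp)
  have hb : b ∈ cell {a, b} := subset_convexHull ℝ _ (by simp)
  have haT : a ∈ cell T := subset_convexHull ℝ _ (Finset.mem_coe.2 (h.mem_iff.2 (by simp)))
  have hbT : b ∈ cell T := subset_convexHull ℝ _ (Finset.mem_coe.2 (h.mem_iff.2 (by simp)))
  have h1 := inner_eq_of_skew hP haT hx
  have h2 := inner_eq_of_skew hP hbT hx
  rw [h0 0 a ha, h0 1 a ha] at h1
  rw [h0 0 b hb, h0 1 b hb] at h2
  by_cases hc : cross (x - a) (x - b) = 0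
  · -- `x` lies on the edge
    obtain ⟨s, t, hs, ht, hst, rfl⟩ := h.mem_cell.1 hx
    have h3 : cross (a + s • (b - a) + t • (c - a) - a) (a + s • (b - a) + t • (c - a) - b) =
        t * cross (b - a) (c - a) := by simp [cross]; ring
    rw [h3] at hc
    have ht0 : t = 0 := (mul_eq_zero.1 hc).resolve_right h.2
    exact h0 i _ (mem_cell_pair.2 ⟨s, hs, by linarith, by rw [ht0]; simp⟩)
  · have := eq_zero_of_inner_eq_zero (n := !₂[ev (P 0) x, ev (P 1) x]) hc
      (by rw [inner_eq]; simpa using h1) (by rw [inner_eq]; simpa using h2)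
    fin_cases i
    · exact congrArg (fun z : Pt => z 0) this
    · exact congrArg (fun z : Pt => z 1) this

section Local

variable {k : ℕ} {T : Finset Pt} {a b c : Pt}

theorem exists_poly_repr (v : localV k T) :
    ∃ P : Fin 2 → Poly, (∀ i, (P i).totalDegree ≤ k) ∧ ∀ i x, v.1.1 x i = ev (P i) x := by
  choose P hP hv using fun i => exists_of_mem_polyOn (v.2.1 i)
  exact ⟨P, hP, fun i x => congrFun (hv i) x⟩

theorem snd_eq_of_jump_eq_zero {v : LocalWeak T} (hj : ∀ e x, jump v e x = 0) (e : edges T)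
    (x : cell (e : Finset Pt)) : v.2 e x = onEdge e.2 v.1 x :=
  (sub_eq_zero.1 (hj e x)).symm

/-- Integration by parts: without jumps the weak partial derivatives are the classical ones. -/
theorem weakPartial_eq_of_jump_eq_zero (h : IsTriangle T a b c) {v : localV k T}
    {P : Fin 2 → Poly} (hv : ∀ i x, v.1.1 x i = ev (P i) x) (hj : ∀ e x, jump v.1 e x = 0)
    (i j : Fin 2) (φ : Poly) : weakPartial k T i j v φ =
      ∫ x, evalOn (cell T) (MvPolynomial.pderiv j (P i)) x * evalOn (cell T) φ x ∂area T := by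
  classical
  have h1 : ∀ (e : edges T) (x : cell (e : Finset Pt)),
      v.1.2 e x i * (evalOn (cell (e : Finset Pt)) φ x * outwardNormal T e j) =
        evalOn (cell (e : Finset Pt)) (P i * φ) x * outwardNormal T e j := by
    intro e x
    rw [snd_eq_of_jump_eq_zero hj]
    simp only [onEdge, hv, evalOn_apply, ev_mul]
    ring
  have h2 : ∀ x, evalOn (cell T) (MvPolynomial.pderiv j (P i * φ)) x =
      evalOn (cell T) (P i) x * evalOn (cell T) (MvPolynomial.pderiv j φ) x +
        evalOn (cell T) (MvPolynomial.pderiv j (P i)) x * evalOn (cell T) φ x := by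
    intro x
    simp only [Derivation.leibniz, smul_eq_mul, evalOn_apply, ev_mul, ev_add]
    ring
  rw [weakPartial_apply]
  simp only [h1]
  rw [← integral_evalOn_pderiv h]
  simp only [h2]
  rw [integral_add (integrable_evalOn_mul _ _) (integrable_evalOn_mul _ _)]
  have h3 : ∀ x, v.1.1 x i = evalOn (cell T) (P i) x := hv i
  simp only [h3]
  ring

theorem weakGradient_eq_of_jump_eq_zero (h : IsTriangle T a b c) {v : localV k T}
    {P : Fin 2 → Poly} (hP : ∀ i, (P i).totalDegree ≤ k) (hv : ∀ i x, v.1.1 x i = ev (P i) x)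
    (hj : ∀ e x, jump v.1 e x = 0) (x : cell T) (i j : Fin 2) :
    (weakGradient k T v).1 x i j = ev (MvPolynomial.pderiv j (P i)) x := by
  choose Q hQ hG using fun i j => exists_of_mem_polyOn ((weakGradient k T v).2 i j)
  have hG' : ∀ i j x, (weakGradient k T v).1 x i j = evalOn (cell T) (Q i j) x :=
    fun i j x => congrFun (hG i j) x
  -- test with the difference of the two gradients
  let φ : Fin 2 → Fin 2 → Poly := fun i j => Q i j - MvPolynomial.pderiv j (P i)
  have hφ : ∀ i j, (φ i j).totalDegree ≤ k - 1 := fun i j =>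
    (MvPolynomial.totalDegree_sub _ _).trans (max_le (hQ i j)
      ((totalDegree_pderiv_le j (P i)).trans (Nat.sub_le_sub_right (hP i) 1)))
  have h1 := (isWeakGradient_iff v _ (continuous_matPolyOn _)).1 (weakGradient_spec h v) φ hφ
  simp only [hG', weakPartial_eq_of_jump_eq_zero h hv hj] at h1
  have h2 : ∀ i j, ∫ x, evalOn (cell T) (φ i j) x * evalOn (cell T) (φ i j) x ∂area T =
      (∫ x, evalOn (cell T) (Q i j) x * evalOn (cell T) (φ i j) x ∂area T) -
      ∫ x, evalOn (cell T) (MvPolynomial.pderiv j (P i)) x * evalOn (cell T) (φ i j) x ∂area T := by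
    intro i j
    rw [← integral_sub (integrable_evalOn_mul _ _) (integrable_evalOn_mul _ _)]
    simp [φ, sub_mul]
  have h3 : ∑ i, ∑ j, ∫ x, evalOn (cell T) (φ i j) x * evalOn (cell T) (φ i j) x ∂area T = 0 := by
    simp only [h2, Finset.sum_sub_distrib]
    rw [h1, sub_self]
  have hnn : ∀ i j, 0 ≤ ∫ x, evalOn (cell T) (φ i j) x * evalOn (cell T) (φ i j) x ∂area T :=
    fun i j => integral_nonneg fun x => mul_self_nonneg _
  have h4 := (Finset.sum_eq_zero_iff_of_nonneg fun i _ => Finset.sum_nonneg fun j _ => hnn i j).1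
    h3 i (Finset.mem_univ i)
  have h5 := (Finset.sum_eq_zero_iff_of_nonneg fun j _ => hnn i j).1 h4 j (Finset.mem_univ j)
  have h6 := mul_self_eq_zero.1 (eq_zero_of_integral_eq_zero h.isOpenPosMeasure_area (by fun_prop)
    (fun x => mul_self_nonneg _) h5 x)
  rw [hG']
  simp only [φ, map_sub, Pi.sub_apply] at h6
  exact sub_eq_zero.1 h6

/-- A weak function without jumps and without strain is a rigid motion: if it vanishes on an edge,
it vanishes. -/
theorem eq_zero_of_strain_of_jump (h : IsTriangle T a b c) {v : localV k T}
    (hj : ∀ e x, jump v.1 e x = 0) (hs : ∀ x i j, weakStrain k T v x i j = 0) (e : edges T)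
    (he : v.1.2 e = 0) : v.1.1 = 0 := by
  classical
  obtain ⟨a, b, c, h, hab⟩ := exists_isTriangle_of_mem_edges h e.2
  obtain ⟨P, hP, hv⟩ := exists_poly_repr v
  have hskew : ∀ i j, ∀ x ∈ cell T, ev (MvPolynomial.pderiv j (P i)) x +
      ev (MvPolynomial.pderiv i (P j)) x = 0 := by
    intro i j x hx
    have h1 := hs ⟨x, hx⟩ i j
    have h2 := weakGradient_eq_of_jump_eq_zero h hP hv hj ⟨x, hx⟩
    simp only [weakStrain, Matrix.smul_apply, Matrix.add_apply, Matrix.transpose_apply, h2,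
      smul_eq_mul] at h1
    linarith
  have hedge : ∀ i, ∀ x ∈ cell {a, b}, ev (P i) x = 0 := by
    intro i x hx
    rw [← hab] at hx
    have h1 := snd_eq_of_jump_eq_zero hj e ⟨x, hx⟩
    rw [he, onEdge] at h1
    have h2 := congrArg (fun z : Pt => z i) h1
    simp only [hv] at h2
    exact h2.symm
  funext x
  ext i
  rw [hv]
  exact eq_zero_of_skew_of_edge h hskew hedge i x.2

end Local

/-! ### Edge-closed sets of triangles -/

namespace Mesh

variable {M : Mesh}

/-- A finite set of triangles, each edge of which is shared by two of them, is empty: by the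
divergence theorem, its total area is a sum of boundary terms that cancel in pairs. -/
theorem eq_empty_of_edges_shared {𝒯 : Finset (Finset Pt)} (h𝒯 : 𝒯 ⊆ M.triangles)
    (h : ∀ T ∈ 𝒯, ∀ e ∈ edges T, ∃ T' ∈ 𝒯, T' ≠ T ∧ e ∈ edges T') : 𝒯 = ∅ := by
  classical
  let I : Finset Pt → ℝ := fun e => ∫ x, evalOn (cell e) (MvPolynomial.X 0) x ∂arcLength e
  have harea : ∀ T ∈ 𝒯, ∫ _ : cell T, (1 : ℝ) ∂area T =
      ∑ e ∈ edges T, I e * outwardNormal T e 0 := by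
    intro T hT
    obtain ⟨a, b, c, htri⟩ := exists_isTriangle (h𝒯 hT)
    have h1 := integral_evalOn_pderiv htri (MvPolynomial.X 0) 0
    simp only [MvPolynomial.pderiv_X_self, integral_mul_const] at h1
    rw [Finset.sum_coe_sort (edges T) (fun e => I e * outwardNormal T e 0)] at h1
    rw [← h1]
    congr 1
    funext x
    simp [evalOn_apply, ev]
  have hsum : ∑ T ∈ 𝒯, ∫ _ : cell T, (1 : ℝ) ∂area T = 0 := by
    rw [Finset.sum_congr rfl harea, Finset.sum_comm' (t' := edgesOf 𝒯)
      (s' := fun e => 𝒯.filter fun T => e ∈ edges T)]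
    · refine Finset.sum_eq_zero fun e he => ?_
      obtain ⟨T, hT, heT⟩ := Finset.mem_biUnion.1 he
      obtain ⟨T', hT', hne, heT'⟩ := h T hT e heT
      rw [filter_mem_edges_eq h𝒯 hT hT' hne.symm heT heT', Finset.sum_pair hne.symm, ← mul_add]
      have h2 := congrArg (fun z : Pt => z 0)
        (outwardNormal_add_eq_zero (h𝒯 hT) (h𝒯 hT') hne.symm heT heT')
      simp only [PiLp.add_apply, PiLp.zero_apply] at h2
      rw [h2, mul_zero]
    · intro T e
      simp only [Finset.mem_filter, edgesOf, Finset.mem_biUnion]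
      constructor
      · rintro ⟨h1, h2⟩; exact ⟨⟨h1, h2⟩, T, h1, h2⟩
      · rintro ⟨h1, -⟩; exact h1
  by_contra hne
  have hpos : 0 < ∑ T ∈ 𝒯, ∫ _ : cell T, (1 : ℝ) ∂area T := by
    refine Finset.sum_pos (fun T hT => ?_) (Finset.nonempty_iff_ne_empty.2 hne)
    obtain ⟨a, b, c, htri⟩ := exists_isTriangle (h𝒯 hT)
    exact htri.area_pos
  exact hpos.ne' hsum

theorem inner_edgeNormal_ne_zero {T e : Finset Pt} (hT : T ∈ M.triangles) (he : e ∈ edges T) :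
    (inner ℝ (edgeNormal e) (outwardNormal T e) : ℝ) ≠ 0 := by
  classical
  obtain ⟨a, b, c, h⟩ := exists_isTriangle hT
  obtain ⟨a, b, c, h, rfl⟩ := exists_isTriangle_of_mem_edges h he
  obtain ⟨n1, n2, -⟩ := outwardNormal_spec h
  obtain ⟨m1, m2⟩ := edgeNormal_spec h.ne
  intro h0
  rw [eq_inner_smul (sub_ne_zero.2 h.ne.symm) m2 n2 n1, h0, zero_smul, norm_zero] at m1
  exact zero_ne_one m1

theorem eq_zero_of_normal_of_tangent {T e : Finset Pt} (hT : T ∈ M.triangles) (he : e ∈ edges T)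
    {w : Pt} (hn : inner ℝ w (outwardNormal T e) = 0) (ht : inner ℝ w (edgeTangent e) = 0) :
    w = 0 := by
  classical
  obtain ⟨a, b, c, h⟩ := exists_isTriangle hT
  obtain ⟨a, b, c, h, rfl⟩ := exists_isTriangle_of_mem_edges h he
  obtain ⟨n1, n2, -⟩ := outwardNormal_spec h
  obtain ⟨-, r, hr⟩ := edgeTangent_spec h.ne
  have hw : inner ℝ w (b - a) = 0 := by rw [hr, inner_smul_right, ht, mul_zero]
  rw [eq_inner_smul (sub_ne_zero.2 h.ne.symm) hw n2 n1, hn, zero_smul]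

theorem diam_cell_pos {T : Finset Pt} (hT : T ∈ M.triangles) : 0 < Metric.diam (cell T) := by
  obtain ⟨a, b, c, h⟩ := exists_isTriangle hT
  exact Metric.diam_pos ⟨a, subset_convexHull ℝ _ (Finset.mem_coe.2 (h.mem_iff.2 (by simp))),
    b, subset_convexHull ℝ _ (Finset.mem_coe.2 (h.mem_iff.2 (by simp))), h.ne⟩
    (isCompact_cell T).isBounded

end Mesh

/-! ### Vanishing energy -/

section Energy

variable {k : ℕ} {M : Mesh}

theorem inv_mulVec_dotProduct_pos {A : Matrix (Fin 2) (Fin 2) ℝ} (hA : A.PosDef) {ξ : Fin 2 → ℝ}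
    (hξ : ξ ≠ 0) : 0 < A⁻¹.mulVec ξ ⬝ᵥ ξ := by
  have := hA.inv.dotProduct_mulVec_pos hξ
  rwa [star_trivial, dotProduct_comm] at this

theorem inv_mulVec_dotProduct_nonneg {A : Matrix (Fin 2) (Fin 2) ℝ} (hA : A.PosDef)
    (ξ : Fin 2 → ℝ) : 0 ≤ A⁻¹.mulVec ξ ⬝ᵥ ξ := by
  by_cases hξ : ξ = 0
  · simp [hξ]
  · exact (inv_mulVec_dotProduct_pos hA hξ).le

theorem invSqrt_mulVec_dotProduct_pos {A : Matrix (Fin 2) (Fin 2) ℝ} (hA : A.PosDef)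
    {ξ : Fin 2 → ℝ} (hξ : ξ ≠ 0) : 0 < (invSqrt A).mulVec ξ ⬝ᵥ ξ := by
  have := (invSqrt_spec hA).1.dotProduct_mulVec_pos hξ
  rwa [star_trivial, dotProduct_comm] at this

theorem IsPermeability.posDef_interface {κ : Pt → Matrix (Fin 2) (Fin 2) ℝ}
    (hκ : IsPermeability M κ) (e : M.interfaceEdges) (x : cell (e : Finset Pt)) :
    (κ x).PosDef := by
  obtain ⟨T, hT, he⟩ := exists_darcy_of_interface e
  exact hκ.posDef hT (convexHull_mono (Finset.coe_subset.2 (subset_of_mem_edges he)) x.2)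

theorem edgeTangent_ne_zero {e : Finset Pt} (he : e.card = 2) : (edgeTangent e).ofLp ≠ 0 := by
  classical
  obtain ⟨a, b, hab, rfl⟩ := Finset.card_eq_two.1 he
  intro h
  have h1 : edgeTangent {a, b} = 0 := by
    apply pt_ext
    · exact congrFun h 0
    · exact congrFun h 1
  have h2 := (edgeTangent_spec hab).1
  rw [h1, norm_zero] at h2
  exact zero_ne_one h2

theorem strain_integral_nonneg {μ : ℝ} (hμ : 0 < μ) (u : Vh0 k M) (T : M.stokes) :
    0 ≤ ∫ x, (∑ i, ∑ j, 2 * μ * weakStrain k T (loc (stokesPart u) T) x i j *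
      weakStrain k T (loc (stokesPart u) T) x i j) ∂area T := by
  refine integral_nonneg fun x => Finset.sum_nonneg fun i _ => Finset.sum_nonneg fun j _ => ?_
  rw [mul_assoc]
  have := mul_self_nonneg (weakStrain k T (loc (stokesPart u) T) x i j)
  positivity

theorem permeability_integral_nonneg {μ : ℝ} (hμ : 0 < μ) {κ : Pt → Matrix (Fin 2) (Fin 2) ℝ}
    (hκ : IsPermeability M κ) (u : Vh0 k M) (T : M.darcy) :
    0 ≤ ∫ x, μ * ((κ x)⁻¹.mulVec (u.1.2.1 T x).ofLp ⬝ᵥ (u.1.2.1 T x).ofLp) ∂area T :=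
  integral_nonneg fun x => mul_nonneg hμ.le (inv_mulVec_dotProduct_nonneg (hκ.posDef T.2 x.2) _)

theorem formA_self_nonneg {μ : ℝ} (hμ : 0 < μ) {κ : Pt → Matrix (Fin 2) (Fin 2) ℝ}
    (hκ : IsPermeability M κ) (u : Vh0 k M) : 0 ≤ formA μ κ u u :=
  add_nonneg (Finset.sum_nonneg fun T _ => strain_integral_nonneg hμ u T)
    (Finset.sum_nonneg fun T _ => permeability_integral_nonneg hμ hκ u T)

theorem weakStrain_eq_zero {μ : ℝ} (hμ : 0 < μ) {κ : Pt → Matrix (Fin 2) (Fin 2) ℝ}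
    (hκ : IsPermeability M κ) {u : Vh0 k M} (h : formA μ κ u u = 0) (T : M.stokes)
    (x : cell (T : Finset Pt)) (i j : Fin 2) :
    weakStrain k T (loc (stokesPart u) T) x i j = 0 := by
  have hs := fun T : M.stokes => strain_integral_nonneg hμ u T
  have h1 := ((add_eq_zero_iff_of_nonneg (Finset.sum_nonneg fun T _ => hs T)
    (Finset.sum_nonneg fun T _ => permeability_integral_nonneg hμ hκ u T)).1 h).1
  have h2 := (Finset.sum_eq_zero_iff_of_nonneg fun T _ => hs T).1 h1 T (Finset.mem_univ T)
  obtain ⟨a, b, c, htri⟩ := M.exists_isTriangle_stokes T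
  have hc := continuous_weakStrain (loc (stokesPart u) T)
  have hnn : ∀ x i j, 0 ≤ 2 * μ * weakStrain k T (loc (stokesPart u) T) x i j *
      weakStrain k T (loc (stokesPart u) T) x i j := by
    intro x i j
    rw [mul_assoc]
    have := mul_self_nonneg (weakStrain k T (loc (stokesPart u) T) x i j)
    positivity
  have h3 := eq_zero_of_integral_eq_zero htri.isOpenPosMeasure_area
    (continuous_finsetSum _ fun i _ => continuous_finsetSum _ fun j _ =>
      (continuous_const.mul (hc i j)).mul (hc i j))
    (fun x => Finset.sum_nonneg fun i _ => Finset.sum_nonneg fun j _ => hnn x i j) h2 x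
  have h4 := (Finset.sum_eq_zero_iff_of_nonneg fun i _ =>
    Finset.sum_nonneg fun j _ => hnn x i j).1 h3 i (Finset.mem_univ i)
  have h5 := (Finset.sum_eq_zero_iff_of_nonneg fun j _ => hnn x i j).1 h4 j (Finset.mem_univ j)
  rw [mul_assoc] at h5
  exact mul_self_eq_zero.1 ((mul_eq_zero.1 h5).resolve_left (by positivity))

theorem darcy_interior_eq_zero {μ : ℝ} (hμ : 0 < μ) {κ : Pt → Matrix (Fin 2) (Fin 2) ℝ}
    (hκ : IsPermeability M κ) {u : Vh0 k M} (h : formA μ κ u u = 0) (T : M.darcy) :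
    u.1.2.1 T = 0 := by
  have hd := fun T : M.darcy => permeability_integral_nonneg hμ hκ u T
  have h1 := ((add_eq_zero_iff_of_nonneg
    (Finset.sum_nonneg fun T _ => strain_integral_nonneg hμ u T)
    (Finset.sum_nonneg fun T _ => hd T)).1 h).2
  have h2 := (Finset.sum_eq_zero_iff_of_nonneg fun T _ => hd T).1 h1 T (Finset.mem_univ T)
  obtain ⟨a, b, c, htri⟩ := M.exists_isTriangle_darcy T
  have h3 := (integral_eq_zero_iff_of_nonneg
    (fun x => mul_nonneg hμ.le (inv_mulVec_dotProduct_nonneg (hκ.posDef T.2 x.2) _))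
    (integrable_permeability_term hκ u u T)).1 h2
  have hae : ∀ i, (fun x => u.1.2.1 T x i) =ᵐ[area T] fun _ => 0 := by
    intro i
    filter_upwards [h3] with x hx
    by_contra hne
    have hpos := inv_mulVec_dotProduct_pos (hκ.posDef T.2 x.2) (ξ := (u.1.2.1 T x).ofLp)
      fun h0 => hne (congrFun h0 i)
    exact (mul_pos hμ hpos).ne' hx
  have := htri.isOpenPosMeasure_area
  funext x
  ext i
  exact congrFun (((continuous_darcy_fst u T i).ae_eq_iff_eq _ continuous_const).1 (hae i)) x

theorem stokes_jump_integral_nonneg (u : Vh0 k M) (T : M.stokes) (e : edges (T : Finset Pt)) :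
    0 ≤ ∫ x, (inner ℝ (jump (loc (stokesPart u) T).1 e x)
      (jump (loc (stokesPart u) T).1 e x) : ℝ) ∂arcLength e :=
  integral_nonneg fun _ => real_inner_self_nonneg

theorem darcy_jump_integral_nonneg (u : Vh0 k M) (T : M.darcy) (e : edges (T : Finset Pt)) :
    0 ≤ ∫ x, (inner ℝ (jump (loc (darcyPart u) T).1 e x) (outwardNormal T e) *
      inner ℝ (jump (loc (darcyPart u) T).1 e x) (outwardNormal T e) : ℝ) ∂arcLength e :=
  integral_nonneg fun _ => mul_self_nonneg _

theorem formS_stokes_nonneg (u : Vh0 k M) : 0 ≤ ∑ T : M.stokes, (Metric.diam (cell T.1))⁻¹ *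
    ∑ e : edges T.1, (∫ x, inner ℝ (jump (loc (stokesPart u) T).1 e x)
      (jump (loc (stokesPart u) T).1 e x) ∂arcLength e) :=
  Finset.sum_nonneg fun T _ => mul_nonneg (inv_nonneg.2 Metric.diam_nonneg)
    (Finset.sum_nonneg fun e _ => stokes_jump_integral_nonneg u T e)

theorem formS_darcy_nonneg (u : Vh0 k M) : 0 ≤ ∑ T : M.darcy, (Metric.diam (cell T.1))⁻¹ *
    ∑ e : edges T.1, (∫ x, inner ℝ (jump (loc (darcyPart u) T).1 e x) (outwardNormal T e) *
      inner ℝ (jump (loc (darcyPart u) T).1 e x) (outwardNormal T e) ∂arcLength e) :=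
  Finset.sum_nonneg fun T _ => mul_nonneg (inv_nonneg.2 Metric.diam_nonneg)
    (Finset.sum_nonneg fun e _ => darcy_jump_integral_nonneg u T e)

theorem formS_self_nonneg (u : Vh0 k M) : 0 ≤ formS u u :=
  add_nonneg (formS_stokes_nonneg u) (formS_darcy_nonneg u)

theorem card_of_mem_edges {T : Finset Pt} (e : edges T) : (e : Finset Pt).card = 2 :=
  (Finset.mem_powersetCard.1 e.2).2

theorem stokes_jump_eq_zero {u : Vh0 k M} (h : formS u u = 0) (T : M.stokes)
    (e : edges (T : Finset Pt)) (x : cell (e : Finset Pt)) :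
    jump (loc (stokesPart u) T).1 e x = 0 := by
  have h1 := ((add_eq_zero_iff_of_nonneg (formS_stokes_nonneg u) (formS_darcy_nonneg u)).1 h).1
  have h2 := (Finset.sum_eq_zero_iff_of_nonneg fun T _ =>
    mul_nonneg (inv_nonneg.2 Metric.diam_nonneg)
      (Finset.sum_nonneg fun e _ => stokes_jump_integral_nonneg u T e)).1 h1 T (Finset.mem_univ T)
  have hd := M.diam_cell_pos (Mesh.mem_triangles.2 (Or.inl T.2))
  have h3 := (mul_eq_zero.1 h2).resolve_left (inv_pos.2 hd).ne'
  have h4 := (Finset.sum_eq_zero_iff_of_nonneg fun e _ =>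
    stokes_jump_integral_nonneg u T e).1 h3 e (Finset.mem_univ e)
  have hc := continuous_jump (loc (stokesPart u) T) e
  have h5 := eq_zero_of_integral_eq_zero (isOpenPosMeasure_arcLength (card_of_mem_edges e))
    (continuous_inner_of_coord hc hc) (fun _ => real_inner_self_nonneg) h4 x
  exact inner_self_eq_zero.1 h5

theorem darcy_normal_jump_eq_zero {u : Vh0 k M} (h : formS u u = 0) (T : M.darcy)
    (e : edges (T : Finset Pt)) (x : cell (e : Finset Pt)) :
    inner ℝ (jump (loc (darcyPart u) T).1 e x) (outwardNormal T e) = 0 := by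
  have h1 := ((add_eq_zero_iff_of_nonneg (formS_stokes_nonneg u) (formS_darcy_nonneg u)).1 h).2
  have h2 := (Finset.sum_eq_zero_iff_of_nonneg fun T _ =>
    mul_nonneg (inv_nonneg.2 Metric.diam_nonneg)
      (Finset.sum_nonneg fun e _ => darcy_jump_integral_nonneg u T e)).1 h1 T (Finset.mem_univ T)
  have hd := M.diam_cell_pos (Mesh.mem_triangles.2 (Or.inr T.2))
  have h3 := (mul_eq_zero.1 h2).resolve_left (inv_pos.2 hd).ne'
  have h4 := (Finset.sum_eq_zero_iff_of_nonneg fun e _ =>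
    darcy_jump_integral_nonneg u T e).1 h3 e (Finset.mem_univ e)
  have hc := continuous_inner_jump_const (loc (darcyPart u) T) e (outwardNormal T e)
  exact mul_self_eq_zero.1 (eq_zero_of_integral_eq_zero
    (isOpenPosMeasure_arcLength (card_of_mem_edges e)) (hc.mul hc) (fun _ => mul_self_nonneg _) h4 x)

theorem interface_integrand_nonneg {μ α : ℝ} (hμ : 0 < μ) (hα : 0 < α)
    {κ : Pt → Matrix (Fin 2) (Fin 2) ℝ} (hκ : IsPermeability M κ) (u : Vh0 k M)
    (e : M.interfaceEdges) (x : cell (e : Finset Pt)) :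
    0 ≤ α * μ * ((invSqrt (κ x)).mulVec (edgeTangent e).ofLp ⬝ᵥ (edgeTangent e).ofLp) *
      inner ℝ (u.1.1.2 ⟨e, M.stokes_of_interface e⟩ x) (edgeTangent e) *
      inner ℝ (u.1.1.2 ⟨e, M.stokes_of_interface e⟩ x) (edgeTangent e) := by
  have h1 := invSqrt_mulVec_dotProduct_pos (hκ.posDef_interface e x)
    (edgeTangent_ne_zero (card_of_mem_edgesOf (M.stokes_of_interface e)))
  rw [mul_assoc]
  exact mul_nonneg (by positivity) (mul_self_nonneg _)

theorem formBJS_self_nonneg {μ α : ℝ} (hμ : 0 < μ) (hα : 0 < α)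
    {κ : Pt → Matrix (Fin 2) (Fin 2) ℝ} (hκ : IsPermeability M κ) (u : Vh0 k M) :
    0 ≤ formBJS μ α κ u u :=
  Finset.sum_nonneg fun e _ => integral_nonneg fun x => interface_integrand_nonneg hμ hα hκ u e x

theorem interface_tangential_eq_zero {μ α : ℝ} (hμ : 0 < μ) (hα : 0 < α)
    {κ : Pt → Matrix (Fin 2) (Fin 2) ℝ} (hκ : IsPermeability M κ) {u : Vh0 k M}
    (h : formBJS μ α κ u u = 0) (e : M.interfaceEdges) (x : cell (e : Finset Pt)) :
    inner ℝ (u.1.1.2 ⟨e, M.stokes_of_interface e⟩ x) (edgeTangent e) = 0 := by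
  have hcard := card_of_mem_edgesOf (M.stokes_of_interface e)
  have h1 := (Finset.sum_eq_zero_iff_of_nonneg fun e _ => integral_nonneg fun x =>
    interface_integrand_nonneg hμ hα hκ u e x).1 h e (Finset.mem_univ e)
  have h2 := (integral_eq_zero_iff_of_nonneg (interface_integrand_nonneg hμ hα hκ u e)
    (integrable_interface_term hκ u u e)).1 h1
  have hae : (fun x => (inner ℝ (u.1.1.2 ⟨e, M.stokes_of_interface e⟩ x) (edgeTangent e) : ℝ))
      =ᵐ[arcLength e] fun _ => 0 := by
    filter_upwards [h2] with x hx
    have h3 := invSqrt_mulVec_dotProduct_pos (hκ.posDef_interface e x) (edgeTangent_ne_zero hcard)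
    have h4 := mul_pos (mul_pos hα hμ) h3
    rw [mul_assoc] at hx
    exact mul_self_eq_zero.1 ((mul_eq_zero.1 hx).resolve_left h4.ne')
  have := isOpenPosMeasure_arcLength hcard
  exact congrFun (((continuous_inner_interface u e _).ae_eq_iff_eq _ continuous_const).1 hae) x

/-- Velocities with vanishing energy vanish. -/
theorem eq_zero_of_formAs_self_eq_zero {μ α : ℝ} (hμ : 0 < μ) (hα : 0 < α)
    {κ : Pt → Matrix (Fin 2) (Fin 2) ℝ} (hκ : IsPermeability M κ) {u : Vh0 k M}
    (h : formAs μ α κ u u = 0) : u = 0 := by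
  classical
  have hA0 := formA_self_nonneg hμ hκ u
  have hS0 := mul_nonneg hμ.le (formS_self_nonneg u)
  have hB0 := formBJS_self_nonneg hμ hα hκ u
  rw [formAs] at h
  have hA : formA μ κ u u = 0 := by linarith
  have hS : formS u u = 0 := by
    have : μ * formS u u = 0 := by linarith
    exact (mul_eq_zero.1 this).resolve_left hμ.ne'
  have hB : formBJS μ α κ u u = 0 := by linarith
  have hd0 := darcy_interior_eq_zero hμ hκ hA
  -- the Darcy edge values: first their normal components, then everything
  have hdn : ∀ (T : M.darcy) (e : edges (T : Finset Pt)) (x : cell (e : Finset Pt)),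
      inner ℝ (u.1.2.2 ⟨e, mem_edgesOf T e⟩ x) (outwardNormal T e) = 0 := by
    intro T e x
    have h1 := darcy_normal_jump_eq_zero hS T e x
    have h2 : jump (loc (darcyPart u) T).1 e x = -u.1.2.2 ⟨e, mem_edgesOf T e⟩ x := by
      change u.1.2.1 T _ - u.1.2.2 ⟨e, mem_edgesOf T e⟩ x = _
      rw [hd0 T, Pi.zero_apply, zero_sub]
    rwa [h2, inner_neg_left, neg_eq_zero] at h1
  have hdb : ∀ e : edgesOf M.darcy, u.1.2.2 e = 0 := by
    rintro ⟨e, he⟩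
    obtain ⟨T, hT, heT⟩ := Finset.mem_biUnion.1 he
    have hn := hdn ⟨T, hT⟩ ⟨e, heT⟩
    have hTM : T ∈ M.triangles := Mesh.mem_triangles.2 (Or.inr hT)
    funext x
    by_cases hi : e ∈ M.interfaceEdges
    · refine Mesh.eq_zero_of_normal_of_tangent hTM heT (hn x) ?_
      have h1 := interface_tangential_eq_zero hμ hα hκ hB ⟨e, hi⟩ x
      rwa [u.2.2.2.2.2 ⟨e, hi⟩] at h1
    · obtain ⟨w, -, hw⟩ := u.2.2.1.2 ⟨e, he⟩ hi
      have h1 := hn x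
      rw [hw, inner_smul_left] at h1
      have h2 : w x = 0 :=
        (mul_eq_zero.1 h1).resolve_right (Mesh.inner_edgeNormal_ne_zero hTM heT)
      rw [hw]
      change w x • edgeNormal e = 0
      rw [h2, zero_smul]
  -- the Stokes component
  have hj := stokes_jump_eq_zero hS
  have hstr := weakStrain_eq_zero hμ hκ hA
  have hzero : ∀ (T : M.stokes) (e : edges (T : Finset Pt)),
      u.1.1.2 ⟨e, mem_edgesOf T e⟩ = 0 → u.1.1.1 T = 0 := by
    intro T e he
    obtain ⟨a, b, c, htri⟩ := M.exists_isTriangle_stokes T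
    exact eq_zero_of_strain_of_jump htri (hj T) (hstr T) e he
  have hsb : ∀ (T : M.stokes) (e : edges (T : Finset Pt)), u.1.1.1 T = 0 →
      u.1.1.2 ⟨e, mem_edgesOf T e⟩ = 0 := by
    intro T e h0
    funext x
    have h1 := snd_eq_of_jump_eq_zero (hj T) e x
    refine h1.trans ?_
    change u.1.1.1 T _ = 0
    rw [h0]; rfl
  let Z : Finset (Finset Pt) := M.stokes.filter fun T => ∃ hT : T ∈ M.stokes, u.1.1.1 ⟨T, hT⟩ ≠ 0
  have hZ : Z = ∅ := by
    refine Mesh.eq_empty_of_edges_shared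
      (fun T hT => Mesh.mem_triangles.2 (Or.inl (Finset.mem_filter.1 hT).1)) fun T hT e he => ?_
    obtain ⟨-, hTs, hne⟩ := Finset.mem_filter.1 hT
    have hue : u.1.1.2 ⟨e, mem_edgesOf ⟨T, hTs⟩ ⟨e, he⟩⟩ ≠ 0 :=
      fun h0 => hne (hzero ⟨T, hTs⟩ ⟨e, he⟩ h0)
    have hfr : ¬ cell e ⊆ frontier M.domain := fun hf => hue (u.2.2.2.1 _ hf)
    obtain ⟨T', hT', hTT, he'⟩ :=
      Mesh.exists_ne_of_not_subset_frontier (Mesh.mem_triangles.2 (Or.inl hTs)) he hfr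
    rcases Mesh.mem_triangles.1 hT' with hs' | hd'
    · refine ⟨T', Finset.mem_filter.2 ⟨hs', hs', fun h0 => hue ?_⟩, hTT, he'⟩
      exact hsb ⟨T', hs'⟩ ⟨e, he'⟩ h0
    · exfalso
      have hi : e ∈ M.interfaceEdges := Finset.mem_inter.2
        ⟨mem_edgesOf ⟨T, hTs⟩ ⟨e, he⟩, mem_edgesOf ⟨T', hd'⟩ ⟨e, he'⟩⟩
      exact hue ((u.2.2.2.2.2 ⟨e, hi⟩).trans (hdb _))
  have hs0 : ∀ T : M.stokes, u.1.1.1 T = 0 := by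
    intro T
    by_contra hne
    have : (T : Finset Pt) ∈ Z := Finset.mem_filter.2 ⟨T.2, T.2, hne⟩
    rw [hZ] at this
    exact absurd this (Finset.notMem_empty _)
  refine Subtype.ext (Prod.ext (Prod.ext (funext hs0) (funext ?_)) (Prod.ext (funext hd0)
    (funext hdb)))
  rintro ⟨e, he⟩
  obtain ⟨T, hT, heT⟩ := Finset.mem_biUnion.1 he
  exact hsb ⟨T, hT⟩ ⟨e, heT⟩ (hs0 _)

end Energy

/-! ### Injectivity of the discrete pressure gradient -/

section Pressure

variable {k : ℕ} {M : Mesh}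

theorem integral_weakDivergence_mul {T : Finset Pt} {a b c : Pt} (h : IsTriangle T a b c)
    (v : localV k T) {τ : Poly} (hτ : τ.totalDegree ≤ k) {q : cell T → ℝ}
    (hq : q = evalOn (cell T) τ) : ∫ x, (weakDivergence k T v).1 x * q x ∂area T =
      -(∫ x, (∑ i, v.1.1 x i * evalOn (cell T) (MvPolynomial.pderiv i τ) x) ∂area T)
      + ∑ e : edges T, (∫ x, inner ℝ (v.1.2 e x) (outwardNormal T e) *
          evalOn (cell (e : Finset Pt)) τ x ∂arcLength e) := by
  rw [hq]
  exact weakDivergence_spec h v τ hτ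

theorem vecPolyOn_gradient {S : Set Pt} {τ : Poly} (hτ : τ.totalDegree ≤ k) :
    (fun x : S => (WithLp.toLp 2 fun i => evalOn S (MvPolynomial.pderiv i τ) x : Pt)) ∈
      vecPolyOn k S := by
  intro i
  exact evalOn_mem_polyOn ((totalDegree_pderiv_le i τ).trans (by omega))

/-- A pressure orthogonal to all weak divergences is constant on each triangle: test with its
gradient in the interior. -/
theorem exists_const_of_formB_eq_zero {p : Wh k M} (hp : ∀ v : Vh0 k M, formB v p = 0) :
    ∃ c : Finset Pt → ℝ, (∀ (T : M.stokes) x, p.1.1 T x = c T) ∧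
      ∀ (T : M.darcy) x, p.1.2 T x = c T := by
  classical
  choose P hP hpP using fun T : M.stokes => exists_of_mem_polyOn (p.2.1 T)
  choose Q hQ hpQ using fun T : M.darcy => exists_of_mem_polyOn (p.2.2.1 T)
  let grad : ∀ (T : Finset Pt), Poly → cell T → Pt := fun T τ x =>
    WithLp.toLp 2 fun i => evalOn (cell T) (MvPolynomial.pderiv i τ) x
  let v : Vh0 k M := ⟨((fun T => grad T (P T), 0), (fun T => grad T (Q T), 0)),
    ⟨fun T => vecPolyOn_gradient (hP T), fun e => Submodule.zero_mem _⟩,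
    ⟨⟨fun T => vecPolyOn_gradient (hQ T), fun e => Submodule.zero_mem _⟩,
      fun e _ => ⟨0, Submodule.zero_mem _, by funext x; simp⟩⟩,
    fun e _ => rfl, fun e _ x => by simp, fun e => rfl⟩
  let G : ∀ (T : Finset Pt), Poly → ℝ := fun T τ =>
    ∫ x, (∑ i, evalOn (cell T) (MvPolynomial.pderiv i τ) x *
      evalOn (cell T) (MvPolynomial.pderiv i τ) x) ∂area T
  have hG0 : ∀ T τ, 0 ≤ G T τ := fun T τ =>
    integral_nonneg fun x => Finset.sum_nonneg fun i _ => mul_self_nonneg _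
  have h1 : ∀ T : M.stokes,
      (∫ x, (weakDivergence k T (loc (stokesPart v) T)).1 x * p.1.1 T x ∂area T) =
        -G T (P T) := by
    intro T
    obtain ⟨a, b, c, htri⟩ := M.exists_isTriangle_stokes T
    rw [integral_weakDivergence_mul htri _ (hP T) (hpP T)]
    have h2 : ∀ (e : edges (T : Finset Pt)) (x : cell (e : Finset Pt)),
        (loc (stokesPart v) T).1.2 e x = 0 := fun e x => rfl
    simp only [h2, inner_zero_left, zero_mul, integral_zero, Finset.sum_const_zero, add_zero]
    rfl
  have h2 : ∀ T : M.darcy,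
      (∫ x, (weakDivergence k T (loc (darcyPart v) T)).1 x * p.1.2 T x ∂area T) =
        -G T (Q T) := by
    intro T
    obtain ⟨a, b, c, htri⟩ := M.exists_isTriangle_darcy T
    rw [integral_weakDivergence_mul htri _ (hQ T) (hpQ T)]
    have h2 : ∀ (e : edges (T : Finset Pt)) (x : cell (e : Finset Pt)),
        (loc (darcyPart v) T).1.2 e x = 0 := fun e x => rfl
    simp only [h2, inner_zero_left, zero_mul, integral_zero, Finset.sum_const_zero, add_zero]
    rfl
  have h3 := hp v
  rw [formB] at h3
  simp only [h1, h2, Finset.sum_neg_distrib] at h3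
  have hs0 := Finset.sum_nonneg fun (T : M.stokes) (_ : T ∈ Finset.univ) => hG0 T (P T)
  have hd0 := Finset.sum_nonneg fun (T : M.darcy) (_ : T ∈ Finset.univ) => hG0 T (Q T)
  have hs : ∀ T : M.stokes, G T (P T) = 0 := fun T =>
    (Finset.sum_eq_zero_iff_of_nonneg fun T _ => hG0 _ _).1 (by linarith) T (Finset.mem_univ T)
  have hd : ∀ T : M.darcy, G T (Q T) = 0 := fun T =>
    (Finset.sum_eq_zero_iff_of_nonneg fun T _ => hG0 _ _).1 (by linarith) T (Finset.mem_univ T)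
  have key : ∀ (T : Finset Pt) (τ : Poly), (∃ a b c, IsTriangle T a b c) → G T τ = 0 →
      ∃ c : ℝ, ∀ x : cell T, evalOn (cell T) τ x = c := by
    rintro T τ ⟨a, b, c, htri⟩ h0
    have h4 := eq_zero_of_integral_eq_zero htri.isOpenPosMeasure_area (by fun_prop)
      (fun x => Finset.sum_nonneg fun i _ => mul_self_nonneg _) h0
    have h5 : ∀ i, ∀ x ∈ cell T, ev (MvPolynomial.pderiv i τ) x = 0 := by
      intro i x hx
      exact mul_self_eq_zero.1 ((Finset.sum_eq_zero_iff_of_nonneg fun i _ =>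
        mul_self_nonneg _).1 (h4 ⟨x, hx⟩) i (Finset.mem_univ i))
    obtain ⟨y, hy⟩ := htri.interior_nonempty
    exact ⟨ev τ y, fun x => ev_eq_of_pderiv_eq_zero h5 (interior_subset hy) x.2⟩
  choose cs hcs using fun T : M.stokes => key T (P T) (M.exists_isTriangle_stokes T) (hs T)
  choose cd hcd using fun T : M.darcy => key T (Q T) (M.exists_isTriangle_darcy T) (hd T)
  refine ⟨fun T => if h : T ∈ M.stokes then cs ⟨T, h⟩ else if h : T ∈ M.darcy then cd ⟨T, h⟩ else 0,
    fun T x => ?_, fun T x => ?_⟩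
  · beta_reduce
    rw [dif_pos T.2, hpP T, hcs T]
  · beta_reduce
    rw [dif_neg (Finset.disjoint_right.1 M.disjoint T.2), dif_pos T.2, hpQ T, hcd T]

open Classical in
/-- The weak function that is the constant unit normal on one interior edge and zero elsewhere. -/
noncomputable def edgeBump (k : ℕ) (M : Mesh) (e₀ : Finset Pt)
    (h : ¬ cell e₀ ⊆ frontier M.domain) : Vh0 k M :=
  ⟨((0, fun e _ => if (e : Finset Pt) = e₀ then edgeNormal e else 0),
    (0, fun e _ => if (e : Finset Pt) = e₀ then edgeNormal e else 0)), by
    have hmem : ∀ (S : Set Pt) (w : Pt), (fun _ : S => w) ∈ vecPolyOn k S := by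
      intro S w i
      refine ⟨MvPolynomial.C (w i), ?_, ?_⟩
      · rw [SetLike.mem_coe, MvPolynomial.mem_restrictTotalDegree, MvPolynomial.totalDegree_C]
        exact Nat.zero_le k
      · funext x; simp [evalOn_apply, ev]
    refine ⟨⟨fun T => Submodule.zero_mem _, fun e => hmem _ _⟩,
      ⟨⟨fun T => Submodule.zero_mem _, fun e => hmem _ _⟩, fun e _ => ?_⟩,
      fun e he => ?_, fun e he x => ?_, fun e => rfl⟩
    · refine ⟨fun _ => if (e : Finset Pt) = e₀ then 1 else 0,
        ⟨MvPolynomial.C (if (e : Finset Pt) = e₀ then 1 else 0), ?_, ?_⟩, ?_⟩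
      · rw [SetLike.mem_coe, MvPolynomial.mem_restrictTotalDegree, MvPolynomial.totalDegree_C]
        exact Nat.zero_le k
      · funext x; simp [evalOn_apply, ev]
      · funext x
        by_cases h1 : (e : Finset Pt) = e₀ <;> simp [h1]
    · have h1 : (e : Finset Pt) ≠ e₀ := fun h1 => h (h1 ▸ he)
      simp only [if_neg h1]
      rfl
    · have h1 : (e : Finset Pt) ≠ e₀ := fun h1 => h (h1 ▸ he)
      simp only [if_neg h1, inner_zero_left]⟩

open Classical in
/-- The weak divergence of a weak function that is constant on one edge and zero elsewhere, tested
with a constant. -/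
theorem integral_weakDivergence_edge {T : Finset Pt} {a b c : Pt} (h : IsTriangle T a b c)
    {v : localV k T} {e₀ : Finset Pt} (h0 : v.1.1 = 0)
    (hb : ∀ (e : edges T) x, v.1.2 e x = if (e : Finset Pt) = e₀ then edgeNormal e else 0)
    {q : cell T → ℝ} {r : ℝ} (hq : ∀ x, q x = r) :
    ∫ x, (weakDivergence k T v).1 x * q x ∂area T = if e₀ ∈ edges T then
      r * (inner ℝ (edgeNormal e₀) (outwardNormal T e₀) * ∫ _ : cell e₀, (1 : ℝ) ∂arcLength e₀)
      else 0 := by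
  have hr : ∀ S : Set Pt, ∀ x : S, evalOn S (MvPolynomial.C r) x = r := by
    intro S x; simp [evalOn_apply, ev]
  rw [integral_weakDivergence_mul h v (τ := MvPolynomial.C r)
    (by rw [MvPolynomial.totalDegree_C]; exact Nat.zero_le k) (by funext x; rw [hq, hr])]
  simp only [h0, hr, hb, MvPolynomial.pderiv_C, map_zero, Pi.zero_apply, PiLp.zero_apply, mul_zero,
    Finset.sum_const_zero, integral_zero, neg_zero, zero_add]
  have h1 : ∀ e : edges T, ∫ _ : cell (e : Finset Pt),
      (inner ℝ (if (e : Finset Pt) = e₀ then edgeNormal e else 0) (outwardNormal T e) * r : ℝ)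
        ∂arcLength e =
      if (e : Finset Pt) = e₀ then
      r * (inner ℝ (edgeNormal e₀) (outwardNormal T e₀) * ∫ _ : cell e₀, (1 : ℝ) ∂arcLength e₀)
      else 0 := by
    rintro ⟨e, he⟩
    by_cases h2 : e = e₀
    · subst h2
      simp only [if_true, integral_const, smul_eq_mul, mul_one]
      ring
    · simp only [if_neg h2, inner_zero_left, zero_mul, integral_zero]
  simp only [h1]
  rw [Finset.sum_coe_sort (edges T) (fun e => if e = e₀ then
      r * (inner ℝ (edgeNormal e₀) (outwardNormal T e₀) * ∫ _ : cell e₀, (1 : ℝ) ∂arcLength e₀)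
      else 0), Finset.sum_ite_eq']

theorem arcLength_pos {e : Finset Pt} (he : e.card = 2) :
    0 < ∫ _ : cell e, (1 : ℝ) ∂arcLength e := by
  classical
  obtain ⟨a, b, hab, rfl⟩ := Finset.card_eq_two.1 he
  rw [integral_arcLength hab (fun _ => 1)]
  simpa using hab

theorem Mesh.sum_triangles (F : Finset Pt → ℝ) :
    ∑ T : M.stokes, F T + ∑ T : M.darcy, F T = ∑ T ∈ M.triangles, F T := by
  classical
  rw [Finset.sum_coe_sort M.stokes F, Finset.sum_coe_sort M.darcy F,
    ← Finset.sum_union M.disjoint]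
  unfold Mesh.triangles
  congr!

/-- The inf-sup condition in its algebraic form: a pressure of mean zero orthogonal to all weak
divergences vanishes. -/
theorem pressure_eq_zero {p : Wh k M} (hp : ∀ v : Vh0 k M, formB v p = 0) : p = 0 := by
  classical
  obtain ⟨c, hcs, hcd⟩ := exists_const_of_formB_eq_zero hp
  have hconst : ∀ {T₀ T₁ : Finset Pt}, T₀ ∈ M.triangles → T₁ ∈ M.triangles → c T₀ = c T₁ := by
    refine Mesh.eq_of_eq_across_edges c fun T hT T' hT' hne e he he' hfr => ?_
    -- test with the unit normal on the common edge
    let F : Finset Pt → ℝ := fun T => if e ∈ edges T then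
      c T * (inner ℝ (edgeNormal e) (outwardNormal T e) * ∫ _ : cell e, (1 : ℝ) ∂arcLength e) else 0
    have h1 := hp (edgeBump k M e hfr)
    rw [formB, neg_eq_zero] at h1
    have h2 : ∀ T : M.stokes, (∫ x, (weakDivergence k T
        (loc (stokesPart (edgeBump k M e hfr)) T)).1 x * p.1.1 T x ∂area T) = F T := by
      intro T
      obtain ⟨a, b, d, htri⟩ := M.exists_isTriangle_stokes T
      exact integral_weakDivergence_edge htri rfl (fun _ _ => rfl) (hcs T)
    have h3 : ∀ T : M.darcy, (∫ x, (weakDivergence k T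
        (loc (darcyPart (edgeBump k M e hfr)) T)).1 x * p.1.2 T x ∂area T) = F T := by
      intro T
      obtain ⟨a, b, d, htri⟩ := M.exists_isTriangle_darcy T
      exact integral_weakDivergence_edge htri rfl (fun _ _ => rfl) (hcd T)
    simp only [h2, h3] at h1
    rw [Mesh.sum_triangles F, ← Finset.sum_filter,
      Mesh.filter_mem_edges_eq (Finset.Subset.refl _) hT hT' hne he he', Finset.sum_pair hne] at h1
    have h4 : outwardNormal T' e = -outwardNormal T e :=
      (neg_eq_of_add_eq_zero_right (Mesh.outwardNormal_add_eq_zero hT hT' hne he he')).symm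
    rw [h4, inner_neg_right] at h1
    have h5 := mul_ne_zero (Mesh.inner_edgeNormal_ne_zero hT he)
      (arcLength_pos (card_of_mem_edges ⟨e, he⟩)).ne'
    have h6 : (c T - c T') * (inner ℝ (edgeNormal e) (outwardNormal T e) *
        ∫ _ : cell e, (1 : ℝ) ∂arcLength e) = 0 := by linear_combination h1
    exact sub_eq_zero.1 ((mul_eq_zero.1 h6).resolve_right h5)
  have hmean := p.2.2.2
  simp only [hcs, hcd] at hmean
  rw [Mesh.sum_triangles fun T => ∫ _ : cell T, c T ∂area T] at hmean
  have hzero : ∀ T ∈ M.triangles, c T = 0 := by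
    intro T hT
    have h1 : ∀ S ∈ M.triangles, ∫ _ : cell S, c S ∂area S =
        c T * ∫ _ : cell S, (1 : ℝ) ∂area S := by
      intro S hS
      rw [hconst hS hT, ← integral_const_mul, mul_one]
    rw [Finset.sum_congr rfl h1, ← Finset.mul_sum] at hmean
    refine (mul_eq_zero.1 hmean).resolve_right (Finset.sum_pos (fun S hS => ?_) ⟨T, hT⟩).ne'
    obtain ⟨a, b, d, htri⟩ := Mesh.exists_isTriangle hS
    exact htri.area_pos
  refine Subtype.ext (Prod.ext (funext fun T => funext fun x => ?_)
    (funext fun T => funext fun x => ?_))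
  · rw [hcs, hzero T (Mesh.mem_triangles.2 (Or.inl T.2))]; rfl
  · rw [hcd, hzero T (Mesh.mem_triangles.2 (Or.inr T.2))]; rfl

end Pressure

end StokesDarcyWG

theorem mainTheorem2 (k : ℕ) (hk : 1 ≤ k) (M : StokesDarcyWG.Mesh)
    (μ α : ℝ) (hμ : 0 < μ) (hα : 0 < α)
    (κ : StokesDarcyWG.Pt → Matrix (Fin 2) (Fin 2) ℝ) (hκ : StokesDarcyWG.IsPermeability M κ)
    (f_s f_d : StokesDarcyWG.Pt → StokesDarcyWG.Pt) (g_s g_d : StokesDarcyWG.Pt → ℝ)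
    (hfs : MemLp f_s 2 (volume.restrict M.stokesDomain))
    (hfd : MemLp f_d 2 (volume.restrict M.darcyDomain))
    (hgs : MemLp g_s 2 (volume.restrict M.stokesDomain))
    (hgd : MemLp g_d 2 (volume.restrict M.darcyDomain))
    (hg : (∫ x in M.stokesDomain, g_s x) + (∫ x in M.darcyDomain, g_d x) = 0) :
    ∃! up : StokesDarcyWG.Vh0 k M × StokesDarcyWG.Wh k M,
      StokesDarcyWG.IsSolution μ α κ f_s f_d g_s g_d up.1 up.2 := by
  have hG := StokesDarcyWG.isLinearMap_loadG (k := k) hgs hgd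
  refine StokesDarcyWG.existsUnique_saddle_point (StokesDarcyWG.isBilin_formAs hκ)
    StokesDarcyWG.isBilin_formB (StokesDarcyWG.isLinearMap_loadF hfs hfd)
    (G := fun q => -StokesDarcyWG.loadG g_s g_d q)
    ⟨fun p q => by rw [hG.map_add, neg_add], fun r q => by rw [hG.map_smul, smul_neg]⟩
    fun u p h1 h2 => ?_
  have hu : u = 0 := by
    apply StokesDarcyWG.eq_zero_of_formAs_self_eq_zero hμ hα hκ
    have h3 := h1 u
    rwa [h2 p, add_zero] at h3
  refine ⟨hu, StokesDarcyWG.pressure_eq_zero fun v => ?_⟩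
  obtain ⟨A, hA⟩ := StokesDarcyWG.isBilin_formAs (k := k) (μ := μ) (α := α) hκ
  have h3 := h1 v
  rwa [hu, ← hA, map_zero, LinearMap.zero_apply, zero_add] at h3
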